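/- Let $w\colon\mathbb Z\to\mathbb R$ be a submultiplicative normalized weight, that is, $w_n=w_{-n}\ge 1$ and $w_{n+m}\le w_nw_m$ for all $n,m\in\mathbb Z$. For $q=\sum_{n\in\mathbb Z}q_n e^{2n\pi i x}\in L^2(S^1,\mathbb C)$ (complex-valued, of period $1$) put $\|q\|_w^2=\sum_{n\in\mathbb Z}w_n^2|q_n|^2$, and let $\mathcal H^w$ be the space of all such $q$ with $\|q\|_w<\infty$. For $q\in L^2(S^1,\mathbb C)$ consider Hill's operator $L=-\frac{d^2}{dx^2}+q$ on $[0,1]$ with periodic or anti-periodic boundary conditions. Its periodic eigenvalues (those of both boundary conditions taken together), counted with algebraic multiplicity and ordered lexicographically, first by real part and then by imaginary part, form a sequence $$\lambda_0^+,\ \lambda_1^-,\ \lambda_1^+,\ \lambda_2^-,\ \lambda_2^+,\ \dots,$$ and the gap lengths of $q$ are $\gamma_n(q)=\lambda_n^+-\lambda_n^-\in\mathbb C$, $n\ge1$. Let $q\in\mathcal H^w$ and let $N\ge1$ be an integer with $N\ge4\|q\|_w$. Then the periodic eigenvalues of $q$ can be listed in this way, in exactly one manner, and $$\sum_{n\ge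 N}w_n^2|\gamma_n(q)|^2\le 9\,\|T_Nq\|_w^2+\frac{576}{N}\,\|q\|_w^4,\qquad T_Nq=\sum_{|n|\ge N}q_ne^{2n\pi i x},$$ where in particular the series on the left converges. Moreover, $w_n|\gamma_n(q)|\le 6\|q\|_w$ for every $n\ge N$. -/

import Mathlib

open MeasureTheory AddCircle

noncomputable section

/-- The space `L²(S¹, ℂ)` of complex square integrable functions of period `1`. -/
abbrev L2Circle : Type := Lp ℂ 2 (haarAddCircle : Measure UnitAddCircle)

/-- Submultiplicative normalized weights: `w_n = w_{-n} ≥ 1` and `w_{n+m} ≤ w_n w_m`. -/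
structure IsSubmulWeight (w : ℤ → ℝ) : Prop where
  even : ∀ n, w (-n) = w n
  one_le : ∀ n, 1 ≤ w n
  submul : ∀ n m, w (n + m) ≤ w n * w m

/-- The weighted Sobolev space `H^w`: all `q` in `L²(S¹, ℂ)` with `∑ w_n² |q_n|² < ∞`, where `q_n`
is the coefficient of `q` at `exp (2 n π i x)`. -/
def weightedSobolev (w : ℤ → ℝ) : Set L2Circle :=
  {q | Summable fun n : ℤ => w n ^ 2 * ‖fourierCoeff q n‖ ^ 2}

/-- The `w`-norm, `‖q‖_w² = ∑ w_n² |q_n|²` (meaningful for `q` in `H^w`). -/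
def wNorm (w : ℤ → ℝ) (q : L2Circle) : ℝ :=
  √(∑' n : ℤ, w n ^ 2 * ‖fourierCoeff q n‖ ^ 2)

/-- The Fourier tail `T_N q = ∑_{|n| ≥ N} q_n exp (2 n π i x)`, a convergent series in `L²`. -/
def fourierTail (N : ℕ) (q : L2Circle) : L2Circle :=
  ∑' n : {n : ℤ // (N : ℤ) ≤ |n|}, fourierCoeff q (n : ℤ) • fourierLp 2 (n : ℤ)

/-- `IsHillImage q ε f h` says that `f` lies in the domain of Hill's operator
`L = -d²/dx² + q` on `[0,1]` with the boundary conditions `f 1 = ε f 0`, `f' 1 = ε f' 0`, and that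
`L f = h`. Functions on `[0,1]` are extended to the line by `f (x + 1) = ε f x`, so that the
boundary conditions become differentiability across the integers. The last field says that `f'` is
absolutely continuous with `-f'' + q f = h` almost everywhere. Here `ε = 1` gives periodic and
`ε = -1` gives anti-periodic boundary conditions. -/
structure IsHillImage (q : L2Circle) (ε : ℂ) (f h : ℝ → ℂ) : Prop where
  quasiperiodic : ∀ x, f (x + 1) = ε * f x
  image_quasiperiodic : ∀ x, h (x + 1) = ε * h x
  image_memLp : MemLp h 2 (volume.restrict (Set.Ioc 0 1))
  differentiable : Differentiable ℝ f
  deriv_eq : ∀ x : ℝ,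
    deriv f x = deriv f 0 + ∫ t in (0 : ℝ)..x, (q (t : UnitAddCircle) * f t - h t)

/-- `IsRootFunction q ε μ k f` says that `f` lies in the kernel of `(L - μ)^k`, where `L` is Hill's
operator with boundary conditions given by `ε`. -/
def IsRootFunction (q : L2Circle) (ε μ : ℂ) : ℕ → (ℝ → ℂ) → Prop
  | 0, f => f = 0
  | k + 1, f => ∃ g, IsRootFunction q ε μ k g ∧ IsHillImage q ε f (fun x => μ * f x + g x)

/-- The root space (generalized eigenspace) of `μ`: the union of the kernels of the `(L - μ)^k`.
This union is a linear space, so that taking its span adds nothing. -/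
def rootSpace (q : L2Circle) (ε μ : ℂ) : Submodule ℂ (ℝ → ℂ) :=
  Submodule.span ℂ {f | ∃ k, IsRootFunction q ε μ k f}

/-- The algebraic multiplicity of `μ` as a periodic eigenvalue of `q`, where periodic and
anti-periodic boundary conditions are taken together (it is `0` if `μ` is not an eigenvalue). -/
def algMultiplicity (q : L2Circle) (μ : ℂ) : ℕ∞ :=
  Cardinal.toENat (Module.rank ℂ (rootSpace q 1 μ)) +
    Cardinal.toENat (Module.rank ℂ (rootSpace q (-1) μ))

/-- The lexicographic order on `ℂ`: first by the real part, then by the imaginary part. -/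
def LexLE (z z' : ℂ) : Prop :=
  z.re < z'.re ∨ (z.re = z'.re ∧ z.im ≤ z'.im)

/-- `lam` is the sequence of all periodic eigenvalues of `q`, listed with algebraic
multiplicities in lexicographic order:
`lam 0 = λ₀⁺`, `lam (2 n - 1) = λ_n⁻`, `lam (2 n) = λ_n⁺` for `n ≥ 1`. -/
structure IsPeriodicSpectrum (q : L2Circle) (lam : ℕ → ℂ) : Prop where
  ordered : ∀ j k, j ≤ k → LexLE (lam j) (lam k)
  multiplicity : ∀ μ, {k | lam k = μ}.encard = algMultiplicity q μ

/-- The gap length `γ_n = λ_n⁺ - λ_n⁻`, for `n ≥ 1`. -/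
def gapLength (lam : ℕ → ℂ) (n : ℕ) : ℂ :=
  lam (2 * n) - lam (2 * n - 1)

end

/-! On Fourier coefficients, Hill's operator with multiplier `(-1)^p` is the diagonal of the numbers
`π²(2j+p)²` plus convolution with `a`, the coefficient sequence of `q`. The lines `Re z = cut n`,
halfway between consecutive `(n-1)²π²` and `n²π²`, divide the plane into strips. In the strip of
`n`, `|μ - π²k²| ≥ (9/2) n ||k| - n|`, so the resolvent without the modes `±n` is an `ℓ²` sequence
of norm at most `1/n`. Convolution with `a` maps `ℓ²` to bounded sequences with norm `‖a‖`, and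
multiplication by the resolvent maps back to `ℓ²`. The product has norm at most `‖a‖/n ≤ 1/4` as
soon as `n ≥ 4‖q‖_w`.

Gap estimate. Inverting on the modes other than `±n` (Lyapunov-Schmidt) leaves a `2 × 2` problem: an
eigenvalue in the strip satisfies `(μ - n²π² - A)² = B C` (`IsEigSeq.det_eq_zero`). The diagonal
entries agree because convolution is symmetric under `k ↦ -k` (`IsRedSol.diagonal_eq`), and `A` is
Lipschitz in `μ` with constant `1/9`. Two eigenvalues in one strip thus differ by at most `9/8`
times the sum of their two values of `√|BC|`. Here `B` and `C` are `a_{-n}` and `a_n` up to an error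
whose weighted size is at most `(4/3)‖q‖_w²/n`, since submultiplicativity lets the whole inversion
be done with a shifted weight (`L2Z.exists_weighted_solution`). Squaring and summing over `n ≥ N`
gives the theorem, with better constants.

Counting. It remains that `λ_n^±` lie in the strip of `n`, that is, that `2m-1` eigenvalues lie to
the left of `cut m` for `m ≥ N`. For one sufficiently large `n`, all root functions with eigenvalue
to the left of `cut n` lie in a finite dimensional invariant subspace, a graph over the modes of
frequency below `n` found by a contraction (`exists_fixed_ricc`, `exists_eq_invMap`). Algebraic
multiplicities become multiplicities of roots of a characteristic polynomial
(`toENat_rank_rootSpace`). Along the path `t a`, `0 ≤ t ≤ 1`, no eigenvalue meets the line `Re z =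
cut m` (`IsEigSeq.re_ne_cut`), so the count is that for `a = 0` (`card_roots_invMat`). These counts
also yield existence and uniqueness of the ordered list. -/

noncomputable section

/-! ### The space `ℓ²(ℤ)`, convolutions and small operators -/

/-- Square summable complex sequences on `ℤ`. -/
abbrev L2Z : Type := lp (fun _ : ℤ => ℂ) 2

namespace L2Z

theorem summable_sq (x : L2Z) : Summable fun j => ‖x j‖ ^ 2 := by
  simpa using (lp.memℓp x).summable (by norm_num)

theorem norm_sq_eq (x : L2Z) : ‖x‖ ^ 2 = ∑' j, ‖x j‖ ^ 2 := by
  simpa using lp.norm_rpow_eq_tsum (p := 2) (by norm_num) x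

/-- The element of `ℓ²` given by a square summable function. -/
def mk (f : ℤ → ℂ) (hf : Summable fun j => ‖f j‖ ^ 2) : L2Z :=
  ⟨f, memℓp_gen (by simpa using hf)⟩

@[simp] theorem mk_apply (f : ℤ → ℂ) (hf) (j : ℤ) : mk f hf j = f j := rfl

theorem norm_mk_sq (f : ℤ → ℂ) (hf) : ‖mk f hf‖ ^ 2 = ∑' j, ‖f j‖ ^ 2 := by
  rw [norm_sq_eq]; rfl

theorem norm_mk_le {f : ℤ → ℂ} (hf) {C : ℝ} (hC : 0 ≤ C) (h : ∑' j, ‖f j‖ ^ 2 ≤ C ^ 2) :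
    ‖mk f hf‖ ≤ C := by
  rw [← norm_mk_sq f hf] at h
  exact (sq_le_sq₀ (norm_nonneg _) hC).1 h

theorem norm_apply_le (x : L2Z) (j : ℤ) : ‖x j‖ ≤ ‖x‖ :=
  lp.norm_apply_le_norm (by norm_num) x j

theorem ext_iff' {x y : L2Z} : x = y ↔ ∀ j, x j = y j :=
  ⟨fun h _ => h ▸ rfl, fun h => lp.ext (funext h)⟩

@[simp] theorem add_apply (x y : L2Z) (j : ℤ) : (x + y) j = x j + y j := rfl
@[simp] theorem sub_apply (x y : L2Z) (j : ℤ) : (x - y) j = x j - y j := rfl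
@[simp] theorem neg_apply (x : L2Z) (j : ℤ) : (-x) j = -x j := rfl
@[simp] theorem smul_apply (c : ℂ) (x : L2Z) (j : ℤ) : (c • x) j = c * x j := rfl

theorem sum_apply {ι : Type*} (s : Finset ι) (f : ι → L2Z) (j : ℤ) :
    (∑ i ∈ s, f i) j = ∑ i ∈ s, f i j := by
  classical
  induction s using Finset.induction_on with
  | empty => simp
  | insert a s ha ih => rw [Finset.sum_insert ha, Finset.sum_insert ha, add_apply, ih]

theorem summable_norm_mul (r x : L2Z) : Summable fun l => ‖r l‖ * ‖x l‖ :=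
  lp.summable_mul (by norm_num [Real.holderConjugate_iff]) r x

theorem summable_mul (r x : L2Z) : Summable fun l => r l * x l :=
  Summable.of_norm (by simpa using summable_norm_mul r x)

theorem tsum_norm_mul_le (r x : L2Z) : ∑' l, ‖r l‖ * ‖x l‖ ≤ ‖r‖ * ‖x‖ :=
  lp.tsum_mul_le_mul_norm (by norm_num [Real.holderConjugate_iff]) r x |>.2

/-- The bilinear pairing `∑ r_l x_l` of square summable sequences, as a functional of `x`. -/
def pair (r : L2Z) : L2Z →L[ℂ] ℂ :=
  LinearMap.mkContinuous
    { toFun := fun x => ∑' l, r l * x l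
      map_add' := fun x y => by
        simp only [add_apply, mul_add]
        exact (summable_mul r x).tsum_add (summable_mul r y)
      map_smul' := fun c x => by
        simp only [smul_apply, RingHom.id_apply, smul_eq_mul, ← tsum_mul_left]
        exact tsum_congr fun l => by ring } ‖r‖ fun x => by
    refine (norm_tsum_le_tsum_norm ?_).trans ?_
    · simpa using summable_norm_mul r x
    · simpa using tsum_norm_mul_le r x

theorem pair_apply (r x : L2Z) : pair r x = ∑' l, r l * x l := rfl

theorem norm_pair_le (r x : L2Z) : ‖pair r x‖ ≤ ‖r‖ * ‖x‖ :=
  (LinearMap.mkContinuous_norm_le _ (norm_nonneg r) _).trans' le_rfl |> fun h =>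
    (ContinuousLinearMap.le_opNorm _ x).trans (mul_le_mul_of_nonneg_right h (norm_nonneg x))

/-- The product of a square summable sequence and a bounded one. -/
def mulBdd (g : L2Z) (φ : ℤ → ℂ) (C : ℝ) (h : ∀ j, ‖φ j‖ ≤ C) : L2Z :=
  mk (fun j => g j * φ j) <| by
    refine Summable.of_nonneg_of_le (fun _ => by positivity) (fun j => ?_)
      ((summable_sq g).mul_right (C ^ 2))
    rw [norm_mul, mul_pow]
    gcongr
    exact h j

@[simp] theorem mulBdd_apply (g : L2Z) (φ : ℤ → ℂ) (C : ℝ) (h) (j : ℤ) :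
    mulBdd g φ C h j = g j * φ j := rfl

theorem norm_mulBdd_le (g : L2Z) (φ : ℤ → ℂ) (C : ℝ) (h : ∀ j, ‖φ j‖ ≤ C) :
    ‖mulBdd g φ C h‖ ≤ ‖g‖ * C := by
  have hC : 0 ≤ C := (norm_nonneg _).trans (h 0)
  refine norm_mk_le _ (by positivity) ?_
  rw [mul_pow, norm_sq_eq, ← tsum_mul_right]
  refine Summable.tsum_le_tsum (fun j => ?_) (mulBdd g φ C h).summable_sq
    ((summable_sq g).mul_right (C ^ 2))
  rw [norm_mul, mul_pow]
  gcongr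
  exact h j

theorem norm_pair_le_of_le (K : ℤ → L2Z) (β : ℝ) (hK : ∀ j, ‖K j‖ ≤ β) (x : L2Z) (j : ℤ) :
    ‖pair (K j) x‖ ≤ β * ‖x‖ :=
  (norm_pair_le _ _).trans (mul_le_mul_of_nonneg_right (hK j) (norm_nonneg x))

/-- The operator `x ↦ (g_j ∑_l K_{jl} x_l)_j` with rows `K_j` bounded in `ℓ²` and `g` in `ℓ²`. -/
def kerOp (g : L2Z) (K : ℤ → L2Z) (β : ℝ) (hK : ∀ j, ‖K j‖ ≤ β) : L2Z →L[ℂ] L2Z :=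
  LinearMap.mkContinuous
    { toFun := fun x => mulBdd g (fun j => pair (K j) x) (β * ‖x‖) (norm_pair_le_of_le K β hK x)
      map_add' := fun x y => ext_iff'.2 fun j => by simp [mul_add]
      map_smul' := fun c x => ext_iff'.2 fun j => by simp; ring } (‖g‖ * β) fun x =>
    (norm_mulBdd_le g (fun j => pair (K j) x) (β * ‖x‖)
      (norm_pair_le_of_le K β hK x)).trans_eq (mul_assoc _ _ _).symm

theorem kerOp_apply (g : L2Z) (K : ℤ → L2Z) (β : ℝ) (hK) (x : L2Z) (j : ℤ) :
    kerOp g K β hK x j = g j * pair (K j) x := rfl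

/-- Pairing with the rows maps `ℓ²` to bounded sequences with norm at most `β`, and multiplication
by `g` maps these back to `ℓ²`. With `g` a resolvent sequence of norm at most `1/n`, this
factorization makes the perturbation small. -/
theorem norm_kerOp_le (g : L2Z) (K : ℤ → L2Z) (β : ℝ) (hK : ∀ j, ‖K j‖ ≤ β) :
    ‖kerOp g K β hK‖ ≤ ‖g‖ * β :=
  LinearMap.mkContinuous_norm_le _
    (mul_nonneg (norm_nonneg _) ((norm_nonneg _).trans (hK 0))) _

/-- The diagonal operator given by a sequence in `ℓ²`. -/
def diag (g : L2Z) : L2Z →L[ℂ] L2Z :=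
  LinearMap.mkContinuous
    { toFun := fun x => mulBdd g (fun j => x j) ‖x‖ (norm_apply_le x)
      map_add' := fun x y => ext_iff'.2 fun j => by
        simp only [mulBdd_apply, add_apply, mul_add]
      map_smul' := fun c x => ext_iff'.2 fun j => by
        simp only [mulBdd_apply, smul_apply, RingHom.id_apply]; ring } ‖g‖ fun x =>
    norm_mulBdd_le g (fun j => x j) ‖x‖ (norm_apply_le x)

@[simp] theorem diag_apply (g x : L2Z) (j : ℤ) : diag g x j = g j * x j := rfl

theorem norm_diag_le (g x : L2Z) : ‖diag g x‖ ≤ ‖g‖ * ‖x‖ :=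
  norm_mulBdd_le g (fun j => x j) ‖x‖ (norm_apply_le x)

/-- The row `l ↦ a_{j-l}` of the convolution with `a`. -/
def row (a : L2Z) (j : ℤ) : L2Z :=
  mk (fun l => a (j - l)) ((Equiv.subLeft j).summable_iff.2 a.summable_sq)

theorem norm_row (a : L2Z) (j : ℤ) : ‖row a j‖ = ‖a‖ := by
  rw [← sq_eq_sq₀ (norm_nonneg _) (norm_nonneg _), norm_sq_eq, norm_sq_eq]
  exact (Equiv.subLeft j).tsum_eq (fun l => ‖a l‖ ^ 2)

/-- The `j`-th entry of the convolution `a * x`, as a functional of `x`. -/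
def conv (a : L2Z) (j : ℤ) : L2Z →L[ℂ] ℂ := pair (row a j)

theorem conv_apply (a : L2Z) (j : ℤ) (x : L2Z) : conv a j x = ∑' l, a (j - l) * x l := rfl

theorem norm_conv_le (a : L2Z) (j : ℤ) (x : L2Z) : ‖conv a j x‖ ≤ ‖a‖ * ‖x‖ :=
  (norm_pair_le _ _).trans_eq (by rw [norm_row])

theorem conv_smul (t : ℂ) (a : L2Z) (j : ℤ) (x : L2Z) : conv (t • a) j x = t * conv a j x := by
  simp only [conv_apply, smul_apply, ← tsum_mul_left]
  exact tsum_congr fun l => by ring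

/-- The standard unit vector. -/
def unit (k : ℤ) : L2Z := lp.single 2 k (1 : ℂ)

theorem unit_apply (k j : ℤ) : unit k j = if j = k then 1 else 0 := by
  unfold unit
  rw [lp.single_apply, Pi.single_apply]

theorem norm_unit (k : ℤ) : ‖unit k‖ = 1 := by
  simp [unit, lp.norm_single]

theorem conv_unit (a : L2Z) (j k : ℤ) : conv a j (unit k) = a (j - k) := by
  rw [conv_apply, tsum_eq_single k]
  · simp [unit_apply]
  · intro l hl; simp [unit_apply, hl]

/-- A linear equation `x = b + T x` with `‖T‖ ≤ 1/4` is solvable. -/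
theorem exists_eq_add (T : L2Z →L[ℂ] L2Z) (hT : ‖T‖ ≤ 1 / 4) (b : L2Z) :
    ∃ x, x = b + T x ∧ ‖x‖ ≤ 4 / 3 * ‖b‖ := by
  have h1 : ‖T‖ < 1 := by linarith
  set u := Units.oneSub T h1
  have hx : (u : L2Z →L[ℂ] L2Z) ((↑u⁻¹ : L2Z →L[ℂ] L2Z) b) = b := by
    rw [← mul_apply_eq_comp, Units.mul_inv]; rfl
  set x := (↑u⁻¹ : L2Z →L[ℂ] L2Z) b
  have hx' : x - T x = b := hx
  have e : x = b + T x := by rw [← hx']; abel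
  refine ⟨x, e, ?_⟩
  -- The constant is `4/3 = 1/(1 - 1/4)`.
  have h2 : ‖x‖ ≤ ‖b‖ + ‖T x‖ := by
    conv_lhs => rw [e]
    exact norm_add_le _ _
  have h3 : ‖T x‖ ≤ 1 / 4 * ‖x‖ :=
    (T.le_opNorm x).trans (mul_le_mul_of_nonneg_right hT (norm_nonneg x))
  linarith

end L2Z

/-! ### Distances from the strips to the squares `π²k²` -/

theorem hasSum_int_one_div_sq :
    HasSum (fun k : ℤ => 1 / (k : ℝ) ^ 2) (Real.pi ^ 2 / 6 + Real.pi ^ 2 / 6) := by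
  have h := HasSum.of_nat_of_neg (f := fun k : ℤ => 1 / (k : ℝ) ^ 2) (by simpa using hasSum_zeta_two)
    (by simpa using hasSum_zeta_two)
  simpa using h

theorem pi_sq_lt_ten : Real.pi ^ 2 < 10 := by
  nlinarith [Real.pi_lt_d2, Real.pi_pos]

theorem nine_lt_pi_sq : 9 < Real.pi ^ 2 := by
  nlinarith [Real.pi_gt_three]

/-- Since `|k|` is `k` or `-k`, the sum is dominated by two shifted copies of `∑ 1/k² = π²/3`, and
`2π²/3 < 8`. Terms with `|k| = m` are `0` by the convention `1/0 = 0`. -/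
theorem summable_one_div_abs_sub_sq (m : ℤ) :
    (Summable fun k : ℤ => 1 / ((|k| - m : ℤ) : ℝ) ^ 2) ∧
      ∑' k : ℤ, 1 / ((|k| - m : ℤ) : ℝ) ^ 2 ≤ 8 := by
  have h1 := (Equiv.subRight m).hasSum_iff.2 hasSum_int_one_div_sq
  have h2 := (Equiv.addRight m).hasSum_iff.2 hasSum_int_one_div_sq
  have h3 := h1.add h2
  have le : ∀ k : ℤ, 1 / ((|k| - m : ℤ) : ℝ) ^ 2 ≤
      ((fun k : ℤ => 1 / (k : ℝ) ^ 2) ∘ Equiv.subRight m) k +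
      ((fun k : ℤ => 1 / (k : ℝ) ^ 2) ∘ Equiv.addRight m) k := by
    intro k
    simp only [Function.comp_apply, Equiv.subRight_apply, Equiv.coe_addRight]
    rcases abs_choice k with h | h <;> rw [h]
    · exact le_add_of_nonneg_right (by positivity)
    · rw [show -k - m = -(k + m) by ring, Int.cast_neg, neg_sq]
      exact le_add_of_nonneg_left (by positivity)
  have hs := Summable.of_nonneg_of_le (fun k => by positivity) le h3.summable
  refine ⟨hs, (hs.tsum_le_tsum le h3.summable).trans ?_⟩
  rw [h3.tsum_eq]
  linarith [pi_sq_lt_ten]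

/-- The square sum is at most `8 · (2/(9n))² = 32/(81n²)`. At `|k j| = m` the hypothesis reads `‖φ
j‖ ≤ 1/0 = 0`, so `φ` has to vanish there. -/
theorem summable_sq_of_le_one_div {n : ℝ} (hn : 0 < n) (m : ℤ) {k : ℤ → ℤ}
    (hk : Function.Injective k) {φ : ℤ → ℂ}
    (hφ : ∀ j, ‖φ j‖ ≤ 1 / (9 / 2 * n * |((|k j| - m : ℤ) : ℝ)|)) :
    (Summable fun j => ‖φ j‖ ^ 2) ∧ ∑' j, ‖φ j‖ ^ 2 ≤ (1 / n) ^ 2 := by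
  obtain ⟨hs, h8⟩ := summable_one_div_abs_sub_sq m
  have le : ∀ j, ‖φ j‖ ^ 2 ≤ 4 / (81 * n ^ 2) * (1 / ((|k j| - m : ℤ) : ℝ) ^ 2) := by
    intro j
    refine (pow_le_pow_left₀ (norm_nonneg _) (hφ j) 2).trans_eq ?_
    rw [div_pow, mul_pow, sq_abs]
    by_cases h : ((|k j| - m : ℤ) : ℝ) = 0
    · simp [h]
    · field_simp; norm_num
  have hs2 := (hs.comp_injective hk).mul_left (4 / (81 * n ^ 2))
  have hs1 := Summable.of_nonneg_of_le (fun j => by positivity) le hs2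
  refine ⟨hs1, (hs1.tsum_le_tsum le hs2).trans ?_⟩
  rw [tsum_mul_left]
  have h9 : ∑' j, 1 / ((|k j| - m : ℤ) : ℝ) ^ 2 ≤ 8 :=
    (tsum_comp_le_tsum_of_inj hs (fun k => by positivity) hk).trans h8
  calc 4 / (81 * n ^ 2) * ∑' j, 1 / ((|k j| - m : ℤ) : ℝ) ^ 2
      ≤ 4 / (81 * n ^ 2) * 8 := by gcongr
    _ ≤ (1 / n) ^ 2 := by
      rw [div_pow, div_mul_eq_mul_div, div_le_div_iff₀ (by positivity) (by positivity)]
      nlinarith [sq_nonneg n]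

/-- The midpoint between `(n-1)²π²` and `n²π²`. -/
def cut (n : ℕ) : ℝ := Real.pi ^ 2 * ((n : ℝ) ^ 2 - n + 1 / 2)

theorem cut_le_cut {m n : ℕ} (hmn : m ≤ n) : cut m ≤ cut n := by
  unfold cut
  have h : (m : ℝ) ≤ n := by exact_mod_cast hmn
  have : (m : ℝ) ^ 2 - m ≤ (n : ℝ) ^ 2 - n := by
    -- The case `m = 0` is separate because `x² - x` decreases up to `1/2`; in fact `cut 0 = cut 1`.
    rcases Nat.eq_zero_or_pos m with rfl | hm
    · rcases Nat.eq_zero_or_pos n with rfl | hn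
      · simp
      · have : (1 : ℝ) ≤ n := by exact_mod_cast hn
        push_cast; nlinarith
    · have : (1 : ℝ) ≤ m := by exact_mod_cast hm
      nlinarith
  gcongr

/-- Integrality of `|k|` puts `π²k²` at distance at least `π² n ||k| - n| / 2` from the strip when
`|k| ≠ n`, and `π² > 9`. -/
theorem le_norm_sub_of_mem_tile {n : ℕ} (hn : 1 ≤ n) {lam : ℂ} (h1 : cut n ≤ lam.re)
    (h2 : lam.re ≤ cut (n + 1)) (k : ℤ) :
    9 / 2 * (n : ℝ) * |((|k| - n : ℤ) : ℝ)| ≤ ‖lam - ((Real.pi * k) ^ 2 : ℝ)‖ := by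
  have hn' : (1 : ℝ) ≤ n := by exact_mod_cast hn
  refine le_trans ?_ (Complex.abs_re_le_norm _)
  rw [Complex.sub_re, Complex.ofReal_re, mul_pow, ← sq_abs (k : ℝ), ← Int.cast_abs]
  unfold cut at h1 h2
  push_cast at h2 ⊢
  set x : ℝ := |(k : ℝ)| with hx
  have hxk : x = ((|k| : ℤ) : ℝ) := by push_cast; rfl
  have hx0 : 0 ≤ x := abs_nonneg _
  have hpi := nine_lt_pi_sq
  rcases lt_trichotomy |k| (n : ℤ) with h | h | h
  · have h' : x + 1 ≤ n := by rw [hxk]; exact_mod_cast h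
    have key : (n - x) * n / 2 ≤ (n : ℝ) ^ 2 - n + 1 / 2 - x ^ 2 := by
      nlinarith [mul_nonneg (sub_nonneg.2 h') hx0, mul_nonneg (sub_nonneg.2 h') (sub_nonneg.2 hn'),
        sq_nonneg (n - x - 1)]
    rw [abs_of_nonpos (by linarith)]
    refine le_trans ?_ (le_abs_self _)
    have : 0 ≤ (n - x) * n / 2 := by
      have := mul_nonneg (by linarith : (0 : ℝ) ≤ n - x) (by linarith : (0 : ℝ) ≤ n)
      linarith
    nlinarith
  · have : x = n := by rw [hxk, h]; simp
    rw [this]; simp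
  · have h' : (n : ℝ) + 1 ≤ x := by rw [hxk]; exact_mod_cast h
    have key : (x - n) * n / 2 ≤ x ^ 2 - ((n + 1 : ℝ) ^ 2 - (n + 1) + 1 / 2) := by
      nlinarith [mul_nonneg (sub_nonneg.2 h') hx0]
    rw [abs_of_nonneg (by linarith)]
    refine le_trans ?_ (neg_le_abs _)
    have : 0 ≤ (x - n) * n / 2 := by
      have := mul_nonneg (by linarith : (0 : ℝ) ≤ x - n) (by linarith : (0 : ℝ) ≤ n)
      linarith
    nlinarith

/-- The shift is `n - 1` and not `n`, so that the bound stays positive at `|k| = n`, the first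
frequency to the right of `cut n`. -/
theorem le_sub_re_of_le_cut {n : ℕ} (hn : 1 ≤ n) {r : ℝ} (h : r ≤ cut n) {k : ℤ}
    (hk : (n : ℤ) ≤ |k|) :
    9 / 2 * (n : ℝ) * |((|k| - (n - 1) : ℤ) : ℝ)| ≤ (Real.pi * k) ^ 2 - r := by
  have hn' : (1 : ℝ) ≤ n := by exact_mod_cast hn
  rw [mul_pow, ← sq_abs (k : ℝ)]
  unfold cut at h
  push_cast
  set x : ℝ := |(k : ℝ)| with hx
  have hxk : x = ((|k| : ℤ) : ℝ) := by push_cast; rfl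
  have h' : (n : ℝ) ≤ x := by rw [hxk]; exact_mod_cast hk
  have hpi := nine_lt_pi_sq
  rw [abs_of_nonneg (by linarith)]
  have key : (x - (n - 1)) * n / 2 ≤ x ^ 2 - ((n : ℝ) ^ 2 - n + 1 / 2) := by
    nlinarith [mul_nonneg (sub_nonneg.2 h') (by linarith : (0 : ℝ) ≤ n)]
  have : 0 ≤ (x - (n - 1)) * n / 2 := by
    have := mul_nonneg (by linarith : (0 : ℝ) ≤ x - (n - 1)) (by linarith : (0 : ℝ) ≤ n)
    linarith
  nlinarith

theorem two_mul_div_three_lt_dist_cut {n : ℕ} (hn : 1 ≤ n) :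
    2 * (n : ℝ) / 3 < (Real.pi * n) ^ 2 - cut n ∧
      2 * (n : ℝ) / 3 < cut (n + 1) - (Real.pi * n) ^ 2 := by
  have hn' : (1 : ℝ) ≤ n := by exact_mod_cast hn
  have hpi := nine_lt_pi_sq
  unfold cut
  push_cast
  constructor <;> nlinarith

/-! ### Localization of the eigenvalues -/

/-- The square `π²(2j+p)²` of the frequency of the mode `j`, for modes `exp (π i (2j+p) x)`. -/
def freqSq (p j : ℤ) : ℝ := (Real.pi * ((2 * j + p : ℤ) : ℝ)) ^ 2

theorem freq_injective (p : ℤ) : Function.Injective fun j : ℤ => 2 * j + p := fun i j h => by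
  have : 2 * i + p = 2 * j + p := h
  omega

theorem freqSq_of_abs_eq {p j : ℤ} {n : ℕ} (h : |2 * j + p| = n) :
    freqSq p j = (Real.pi * n) ^ 2 := by
  have : ((2 * j + p : ℤ) : ℝ) ^ 2 = (n : ℝ) ^ 2 := by
    rw [← sq_abs, ← Int.cast_abs, h]; simp
  rw [freqSq, mul_pow, this, mul_pow]

/-- The reduced resolvent of `-d²/dx²`, vanishing on the modes of frequency `±n`. -/
def redRes (p : ℤ) (n : ℕ) (mu : ℂ) (j : ℤ) : ℂ :=
  if |2 * j + p| = n then 0 else 1 / (mu - freqSq p j)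

/-- `mu` lies in the closed strip around `n²π²` bounded by the midpoints. -/
def InTile (n : ℕ) (mu : ℂ) : Prop := cut n ≤ mu.re ∧ mu.re ≤ cut (n + 1)

theorem norm_sub_freqSq_pos {p : ℤ} {n : ℕ} (hn : 1 ≤ n) {mu : ℂ} (hmu : InTile n mu) {j : ℤ}
    (hj : |2 * j + p| ≠ n) : 0 < ‖mu - freqSq p j‖ := by
  have h := le_norm_sub_of_mem_tile hn hmu.1 hmu.2 (2 * j + p)
  have hn' : (1 : ℝ) ≤ n := by exact_mod_cast hn
  refine lt_of_lt_of_le ?_ h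
  have : (0 : ℝ) < |((|2 * j + p| - n : ℤ) : ℝ)| :=
    abs_pos.2 (Int.cast_ne_zero.2 (sub_ne_zero.2 hj))
  positivity

theorem redRes_summable {p : ℤ} {n : ℕ} (hn : 1 ≤ n) {mu : ℂ} (hmu : InTile n mu) :
    (Summable fun j => ‖redRes p n mu j‖ ^ 2) ∧
      ∑' j, ‖redRes p n mu j‖ ^ 2 ≤ (1 / (n : ℝ)) ^ 2 := by
  have hn' : (1 : ℝ) ≤ n := by exact_mod_cast hn
  refine summable_sq_of_le_one_div (by linarith) n (freq_injective p) fun j => ?_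
  unfold redRes
  split_ifs with h
  · rw [norm_zero]; positivity
  · rw [norm_div, norm_one]
    have hp : (0 : ℝ) < |((|2 * j + p| - n : ℤ) : ℝ)| :=
      abs_pos.2 (Int.cast_ne_zero.2 (sub_ne_zero.2 h))
    exact one_div_le_one_div_of_le (by positivity)
      (le_norm_sub_of_mem_tile hn hmu.1 hmu.2 (2 * j + p))

theorem redRes_mul {p : ℤ} {n : ℕ} (hn : 1 ≤ n) {mu : ℂ} (hmu : InTile n mu) {j : ℤ}
    (hj : |2 * j + p| ≠ n) : redRes p n mu j * (mu - freqSq p j) = 1 := by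
  rw [redRes, if_neg hj, one_div_mul_cancel]
  exact norm_pos_iff.1 (norm_sub_freqSq_pos hn hmu hj)

/-- The sequence `u` in `ℓ²` solves the equation of an eigenfunction of `-d²/dx² + q` with eigenvalue
`mu`, where `a` is the sequence of Fourier coefficients of `q`. -/
def IsEigSeq (a : L2Z) (p : ℤ) (mu : ℂ) (u : L2Z) : Prop :=
  ∀ j, (freqSq p j : ℂ) * u j + L2Z.conv a j u = mu * u j

theorem indicator_summable (p : ℤ) (n : ℕ) :
    (Summable fun j : ℤ => ‖(if |2 * j + p| = n then 1 else 0 : ℂ)‖ ^ 2) ∧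
      ∑' j : ℤ, ‖(if |2 * j + p| = n then 1 else 0 : ℂ)‖ ^ 2 ≤ 2 ^ 2 := by
  -- The only candidates solve `2j + p = ±n`; if the parities of `n` and `p` differ, neither rounded
  -- quotient is a solution, and the sum is `0`.
  have hsub : ∀ j ∉ ({((n : ℤ) - p) / 2, (-(n : ℤ) - p) / 2} : Finset ℤ),
      ‖(if |2 * j + p| = n then 1 else 0 : ℂ)‖ ^ 2 = 0 := by
    intro j hj
    rw [if_neg]
    · simp
    · intro h
      apply hj
      simp only [Finset.mem_insert, Finset.mem_singleton]
      rcases abs_choice (2 * j + p) with h' | h' <;> omega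
  refine ⟨summable_of_ne_finset_zero hsub, ?_⟩
  rw [tsum_eq_sum hsub]
  refine (Finset.sum_le_card_nsmul _ _ 1 fun j _ => ?_).trans ?_
  · split_ifs <;> simp
  · have := Finset.card_le_two (a := ((n : ℤ) - p) / 2) (b := (-(n : ℤ) - p) / 2)
    have : ((({((n : ℤ) - p) / 2, (-(n : ℤ) - p) / 2} : Finset ℤ).card : ℕ) : ℝ) ≤ 2 := by
      exact_mod_cast this
    simp only [nsmul_eq_mul, mul_one]
    linarith

/-- If `mu` were farther than `2n/3` from `n²π²`, the full resolvent, consisting of the reduced one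
and `s⁻¹` on the modes `±n`, would have norm less than `1/n + 3/n`. As `u` is this resolvent applied
to `a * u` and `‖a‖ ≤ n/4`, this would give `‖u‖ < ‖u‖`. -/
theorem IsEigSeq.norm_sub_le {a : L2Z} {p : ℤ} {mu : ℂ} {u : L2Z} (hu : IsEigSeq a p mu u)
    (hu0 : u ≠ 0) {n : ℕ} (hn : 1 ≤ n) (ha : ‖a‖ ≤ n / 4) (hmu : InTile n mu) :
    ‖mu - ((Real.pi * n) ^ 2 : ℝ)‖ ≤ 2 * n / 3 := by
  by_contra! hlt
  have hn' : (1 : ℝ) ≤ n := by exact_mod_cast hn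
  set s : ℂ := mu - ((Real.pi * n) ^ 2 : ℝ) with hs
  have hs0 : s ≠ 0 := norm_pos_iff.1 (lt_trans (by positivity) hlt)
  obtain ⟨g1, g2⟩ := redRes_summable (p := p) hn hmu
  obtain ⟨i1, i2⟩ := indicator_summable p n
  set g := L2Z.mk _ g1
  set e := L2Z.mk _ i1
  have hg : ‖g‖ ≤ 1 / n := L2Z.norm_mk_le g1 (by positivity) g2
  have he : ‖e‖ ≤ 2 := L2Z.norm_mk_le i1 (by positivity) i2
  have hu1 : u = L2Z.mulBdd (g + s⁻¹ • e) (fun j => L2Z.conv a j u) (‖a‖ * ‖u‖)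
      (fun j => L2Z.norm_conv_le a j u) := by
    refine L2Z.ext_iff'.2 fun j => ?_
    rw [L2Z.mulBdd_apply, L2Z.add_apply, L2Z.smul_apply]
    have hj : L2Z.conv a j u = (mu - freqSq p j) * u j := by
      rw [sub_mul, ← hu j]; ring
    rw [hj, ← mul_assoc]
    change u j = (redRes p n mu j + s⁻¹ * (if |2 * j + p| = n then 1 else 0 : ℂ)) *
      (mu - freqSq p j) * u j
    by_cases h : |2 * j + p| = n
    · rw [redRes, if_pos h, if_pos h, freqSq_of_abs_eq h, ← hs]
      field_simp; ring
    · rw [if_neg h, mul_zero, add_zero, redRes_mul hn hmu h, one_mul]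
  have h1 : ‖u‖ ≤ ‖g + s⁻¹ • e‖ * (‖a‖ * ‖u‖) := by
    conv_lhs => rw [hu1]
    exact L2Z.norm_mulBdd_le _ _ _ _
  have h2 : ‖g + s⁻¹ • e‖ < 4 / n := by
    refine (norm_add_le _ _).trans_lt ?_
    have h3 : ‖s⁻¹ • e‖ < 3 / n := by
      rw [norm_smul, norm_inv]
      calc ‖s‖⁻¹ * ‖e‖ ≤ ‖s‖⁻¹ * 2 := by gcongr
        _ < (2 * (n : ℝ) / 3)⁻¹ * 2 := by
          gcongr
        _ = 3 / n := by field_simp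
    calc ‖g‖ + ‖s⁻¹ • e‖ < 1 / n + 3 / n := add_lt_add_of_le_of_lt hg h3
      _ = 4 / n := by ring
  have hu2 : 0 < ‖u‖ := norm_pos_iff.2 hu0
  have h4 : ‖g + s⁻¹ • e‖ * (‖a‖ * ‖u‖) ≤ ‖g + s⁻¹ • e‖ * (n / 4 * ‖u‖) := by gcongr
  have h5 : ‖g + s⁻¹ • e‖ * (n / 4 * ‖u‖) < 4 / n * (n / 4 * ‖u‖) := by gcongr
  have h6 : 4 / (n : ℝ) * (n / 4 * ‖u‖) = ‖u‖ := by field_simp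
  linarith

/-- The line belongs to the closed strip of `n` but lies farther than `2n/3` from its centre. This
keeps eigenvalues from crossing it while the potential is deformed. -/
theorem IsEigSeq.re_ne_cut {a : L2Z} {p : ℤ} {mu : ℂ} {u : L2Z} (hu : IsEigSeq a p mu u)
    (hu0 : u ≠ 0) {n : ℕ} (hn : 1 ≤ n) (ha : ‖a‖ ≤ n / 4) : mu.re ≠ cut n := by
  intro h
  have h1 := hu.norm_sub_le hu0 hn ha ⟨h.ge, h.le.trans (cut_le_cut (Nat.le_succ n))⟩
  have h2 := (Complex.abs_re_le_norm _).trans h1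
  rw [Complex.sub_re, Complex.ofReal_re, h] at h2
  linarith [(two_mul_div_three_lt_dist_cut hn).1, neg_abs_le (cut n - (Real.pi * n) ^ 2)]

theorem freqSq_nonneg (p j : ℤ) : 0 ≤ freqSq p j := sq_nonneg _

/-- Off the possible mode of frequency zero, `u` decays like `1/k²`. This is the regularity by which
solutions in `ℓ²` of the eigenvalue equation are in `ℓ¹`. -/
theorem summable_norm_of_freqSq_mul_le {p : ℤ} {u : ℤ → ℂ} {C : ℝ}
    (h : ∀ j, ‖(freqSq p j : ℂ) * u j‖ ≤ C) : Summable fun j => ‖u j‖ := by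
  have hC : 0 ≤ C := (norm_nonneg _).trans (h 0)
  have h1 : Summable fun j : ℤ => C * (1 / ((2 * j + p : ℤ) : ℝ) ^ 2) :=
    (hasSum_int_one_div_sq.summable.comp_injective (freq_injective p)).mul_left C
  have h2 : Summable fun j : ℤ => if 2 * j + p = 0 then ‖u j‖ else 0 := by
    refine summable_of_ne_finset_zero (s := {-p / 2}) fun j hj => if_neg fun h => hj ?_
    rw [Finset.mem_singleton]; omega
  refine Summable.of_nonneg_of_le (fun _ => norm_nonneg _) (fun j => ?_) (h1.add h2)
  by_cases hj : 2 * j + p = 0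
  · simp [hj]
  · rw [if_neg hj, add_zero, mul_one_div]
    have hp : (0 : ℝ) < ((2 * j + p : ℤ) : ℝ) ^ 2 := by
      have : ((2 * j + p : ℤ) : ℝ) ≠ 0 := Int.cast_ne_zero.2 hj
      positivity
    rw [le_div_iff₀ hp]
    refine le_trans ?_ (h j)
    rw [norm_mul, Complex.norm_real, Real.norm_of_nonneg (freqSq_nonneg p j), freqSq,
      mul_pow, mul_comm]
    gcongr
    nlinarith [nine_lt_pi_sq]

/-! ### Reduction to a `2 × 2` problem and the gap estimate -/

namespace L2Z

/-- The inner sums over `b.2` are at most `‖a‖ ‖y‖`, and `x` is in `ℓ¹`; this justifies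
interchanging the sums in the symmetry of the pairing. -/
theorem summable_reflect_mul_conv (a x y : L2Z) (n : ℤ) (hx : Summable fun j => ‖x j‖) :
    Summable fun b : ℤ × ℤ => x (-n - b.1) * (a (b.1 - b.2) * y b.2) := by
  refine Summable.of_norm ((summable_prod_of_nonneg fun _ => norm_nonneg _).2 ⟨fun j => ?_, ?_⟩)
  · simp only [norm_mul]
    exact (summable_norm_mul (row a j) y).mul_left _
  · have hx' : Summable fun j => ‖x (-n - j)‖ := (Equiv.subLeft (-n)).summable_iff.2 hx
    refine Summable.of_nonneg_of_le (fun j => tsum_nonneg fun _ => norm_nonneg _) (fun j => ?_)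
      (hx'.mul_right (‖a‖ * ‖y‖))
    simp only [norm_mul]
    rw [tsum_mul_left]
    gcongr
    exact (tsum_norm_mul_le (row a j) y).trans_eq (by rw [norm_row])

theorem summable_reflect_mul (a x y : L2Z) (n : ℤ) (hx : Summable fun j => ‖x j‖) :
    Summable fun j => x (-n - j) * conv a j y := by
  have h := (summable_reflect_mul_conv a x y n hx).prod
  simp only [tsum_mul_left] at h
  exact h

/-- Convolution is symmetric with respect to the bilinear pairing `∑ x_{-n-j} y_j`. -/
theorem tsum_reflect_mul_conv_comm (a x y : L2Z) (n : ℤ) (hx : Summable fun j => ‖x j‖) :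
    ∑' j, x (-n - j) * conv a j y = ∑' j, y (-n - j) * conv a j x := by
  have h := Summable.tsum_comm (f := fun j l => x (-n - j) * (a (j - l) * y l))
    (summable_reflect_mul_conv a x y n hx)
  have e1 : ∀ j, x (-n - j) * conv a j y = ∑' l, x (-n - j) * (a (j - l) * y l) := fun j => by
    rw [tsum_mul_left, conv_apply]
  rw [tsum_congr e1, ← h, ← (Equiv.subLeft (-n)).tsum_eq]
  refine tsum_congr fun j => ?_
  rw [conv_apply, ← tsum_mul_left, ← (Equiv.subLeft (-n)).tsum_eq]
  refine tsum_congr fun l => ?_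
  simp only [Equiv.subLeft_apply]
  rw [show -n - (-n - l) = l by ring, show -n - l - (-n - j) = j - l by ring]
  ring

/-- Solution of `x = g (a * (e_s + x))` with a weighted bound centred at `s`. -/
theorem exists_weighted_solution {w : ℤ → ℝ} (hw : IsSubmulWeight w) (a g : L2Z) {β : ℝ}
    (ha : Summable fun j => w j ^ 2 * ‖a j‖ ^ 2)
    (hβ : √(∑' j, w j ^ 2 * ‖a j‖ ^ 2) = β) {n : ℝ} (hn : 0 < n)
    (hβn : β ≤ n / 4) (hg : ‖g‖ ≤ 1 / n) (s : ℤ) :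
    ∃ x : L2Z, (∀ j, x j = g j * conv a j (unit s + x)) ∧ ‖x‖ ≤ 1 / 3 ∧
      ∀ j, w (j - s) * ‖conv a j x‖ ≤ 4 / 3 * β ^ 2 / n := by
  have wpos : ∀ j, 0 < w j := fun j => lt_of_lt_of_le one_pos (hw.one_le j)
  have hβ0 : 0 ≤ β := hβ ▸ Real.sqrt_nonneg _
  have hβ2 : ∑' j, w j ^ 2 * ‖a j‖ ^ 2 = β ^ 2 := by
    rw [← hβ, Real.sq_sqrt (tsum_nonneg fun j => by positivity)]
  -- Conjugation with the shifted weight `w (· - s)` turns convolution with `a` into this kernel.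
  -- From `w (j - s) ≤ w (j - l) w (l - s)` it is dominated by `w (j - l) |a (j - l)|`, so its rows
  -- have norm at most `β` whatever `s` is.
  have kle : ∀ j l, ‖((w (j - s) / w (l - s) : ℝ) : ℂ) * a (j - l)‖ ^ 2 ≤
      w (j - l) ^ 2 * ‖a (j - l)‖ ^ 2 := fun j l => by
    rw [norm_mul, Complex.norm_real, mul_pow,
      Real.norm_of_nonneg (div_nonneg (wpos _).le (wpos _).le)]
    have h1 : w (j - s) / w (l - s) ≤ w (j - l) := by
      rw [div_le_iff₀ (wpos _)]
      have := hw.submul (j - l) (l - s)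
      rwa [sub_add_sub_cancel] at this
    have h2 : 0 ≤ w (j - s) / w (l - s) := div_nonneg (wpos _).le (wpos _).le
    gcongr
  have hs : ∀ j, Summable fun l => w (j - l) ^ 2 * ‖a (j - l)‖ ^ 2 := fun j =>
    (Equiv.subLeft j).summable_iff.2 ha
  have hK : ∀ j, Summable fun l => ‖((w (j - s) / w (l - s) : ℝ) : ℂ) * a (j - l)‖ ^ 2 := fun j =>
    Summable.of_nonneg_of_le (fun _ => by positivity) (kle j) (hs j)
  have hKn : ∀ j, ‖mk _ (hK j)‖ ≤ β := fun j => by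
    refine norm_mk_le _ hβ0 (((hK j).tsum_le_tsum (kle j) (hs j)).trans_eq ?_)
    rw [← hβ2]
    exact (Equiv.subLeft j).tsum_eq fun l => w l ^ 2 * ‖a l‖ ^ 2
  set K : ℤ → L2Z := fun j => mk _ (hK j)
  have hKa : ∀ j l, K j l = ((w (j - s) / w (l - s) : ℝ) : ℂ) * a (j - l) := fun _ _ => rfl
  have hb : ∀ j, ‖(w (j - s) : ℂ) * a (j - s)‖ ≤ β := fun j => by
    have h1 := ha.le_tsum (j - s) fun i _ => by positivity
    rw [hβ2, ← mul_pow] at h1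
    rw [norm_mul, Complex.norm_real, Real.norm_of_nonneg (wpos _).le]
    exact (sq_le_sq₀ (mul_nonneg (wpos _).le (norm_nonneg _)) hβ0).1 h1
  set b : L2Z := mulBdd g (fun j => (w (j - s) : ℂ) * a (j - s)) β hb
  have hbn : ‖b‖ ≤ 1 / n * β := (norm_mulBdd_le g _ β hb).trans (mul_le_mul_of_nonneg_right hg hβ0)
  have hT : ‖kerOp g K β hKn‖ ≤ 1 / 4 := by
    refine (norm_kerOp_le g K β hKn).trans ?_
    calc ‖g‖ * β ≤ 1 / n * (n / 4) := by gcongr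
      _ = 1 / 4 := by field_simp
  -- The unknown is `z j = w (j - s) x j`; `w ≥ 1` puts `x` itself in `ℓ²`.
  obtain ⟨z, hz, hzn⟩ := exists_eq_add _ hT b
  have hxle : ∀ j, ‖((w (j - s))⁻¹ : ℂ) * z j‖ ^ 2 ≤ ‖z j‖ ^ 2 := fun j => by
    refine pow_le_pow_left₀ (norm_nonneg _) ?_ 2
    rw [norm_mul, norm_inv, Complex.norm_real, Real.norm_of_nonneg (wpos _).le]
    exact mul_le_of_le_one_left (norm_nonneg _) (inv_le_one_of_one_le₀ (hw.one_le _))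
  have hxs : Summable fun j => ‖((w (j - s))⁻¹ : ℂ) * z j‖ ^ 2 :=
    Summable.of_nonneg_of_le (fun _ => by positivity) hxle z.summable_sq
  set x : L2Z := mk _ hxs
  have hxz : ∀ j, x j = ((w (j - s))⁻¹ : ℂ) * z j := fun _ => rfl
  have hwc : ∀ j, (w j : ℂ) ≠ 0 := fun j => Complex.ofReal_ne_zero.2 (wpos j).ne'
  have hpair : ∀ j, pair (K j) z = w (j - s) * conv a j x := fun j => by
    rw [pair_apply, conv_apply, ← tsum_mul_left]
    refine tsum_congr fun l => ?_
    rw [hKa, hxz]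
    push_cast
    field_simp
  have hzn' : ‖z‖ ≤ 4 / 3 * (1 / n * β) := hzn.trans (by gcongr)
  have hxn : ‖x‖ ≤ ‖z‖ := by
    refine norm_mk_le _ (norm_nonneg _) ?_
    rw [norm_sq_eq]
    exact hxs.tsum_le_tsum hxle z.summable_sq
  refine ⟨x, fun j => ?_, ?_, fun j => ?_⟩
  · have h := ext_iff'.1 hz j
    rw [add_apply, kerOp_apply, hpair, mulBdd_apply] at h
    rw [hxz, h, map_add, conv_unit]
    field_simp [hwc]
  · calc ‖x‖ ≤ 4 / 3 * (1 / n * (n / 4)) := (hxn.trans hzn').trans (by gcongr)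
      _ = 1 / 3 := by field_simp
  · have h1 := norm_pair_le_of_le K β hKn z j
    rw [hpair, norm_mul, Complex.norm_real, Real.norm_of_nonneg (wpos _).le] at h1
    calc _ ≤ β * ‖z‖ := h1
      _ ≤ β * (4 / 3 * (1 / n * β)) := by gcongr
      _ = 4 / 3 * β ^ 2 / n := by ring

end L2Z

/-- `x` is the part of the solution `e_s + x` of the reduced eigenvalue equation off the modes of
frequency `±n`. -/
def IsRedSol (a : L2Z) (n : ℕ) (mu : ℂ) (s : ℤ) (x : L2Z) : Prop :=
  ∀ j, x j = redRes n n mu j * L2Z.conv a j (L2Z.unit s + x)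

/-- With `p = n` the mode `j` has frequency `2j + n`, so the two exceptional modes, of frequency `n`
and `-n`, are `j = 0` and `j = -n`. -/
theorem redRes_self_zero (n : ℕ) (mu : ℂ) : redRes n n mu 0 = 0 := by simp [redRes]

theorem redRes_self_neg (n : ℕ) (mu : ℂ) : redRes n n mu (-n) = 0 := by
  rw [redRes, if_pos]
  rw [show 2 * -(n : ℤ) + n = -n by ring, abs_neg]; simp

theorem abs_two_mul_add_ne {n : ℕ} {j : ℤ} (h0 : j ≠ 0) (h1 : j ≠ -n) : |2 * j + n| ≠ (n : ℤ) := by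
  intro h
  rcases abs_choice (2 * j + n) with h' | h' <;> omega

theorem IsRedSol.mul_eq {a : L2Z} {n : ℕ} {mu : ℂ} {s : ℤ} {x : L2Z} (hx : IsRedSol a n mu s x)
    (hn : 1 ≤ n) (hmu : InTile n mu) {j : ℤ} (h0 : j ≠ 0) (h1 : j ≠ -n) :
    (mu - freqSq n j) * x j = L2Z.conv a j (L2Z.unit s + x) := by
  rw [hx j, ← mul_assoc, mul_comm (mu - _), redRes_mul hn hmu (abs_two_mul_add_ne h0 h1), one_mul]

theorem IsRedSol.apply_zero {a : L2Z} {n : ℕ} {mu : ℂ} {s : ℤ} {x : L2Z}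
    (hx : IsRedSol a n mu s x) : x 0 = 0 := by rw [hx, redRes_self_zero, zero_mul]

theorem IsRedSol.apply_neg {a : L2Z} {n : ℕ} {mu : ℂ} {s : ℤ} {x : L2Z}
    (hx : IsRedSol a n mu s x) : x (-n) = 0 := by rw [hx, redRes_self_neg, zero_mul]

theorem IsRedSol.summable_norm {a : L2Z} {n : ℕ} {mu : ℂ} {s : ℤ} {x : L2Z}
    (hx : IsRedSol a n mu s x) (hn : 1 ≤ n) (hmu : InTile n mu) : Summable fun j => ‖x j‖ := by
  refine summable_norm_of_freqSq_mul_le (p := n)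
    (C := ‖mu‖ * ‖x‖ + ‖a‖ * ‖L2Z.unit s + x‖) fun j => ?_
  by_cases h0 : j = 0
  · rw [h0, hx.apply_zero, mul_zero, norm_zero]; positivity
  by_cases h1 : j = -n
  · rw [h1, hx.apply_neg, mul_zero, norm_zero]; positivity
  have h := hx.mul_eq hn hmu h0 h1
  rw [show (freqSq n j : ℂ) * x j = mu * x j - L2Z.conv a j (L2Z.unit s + x) by rw [← h]; ring]
  refine (norm_sub_le _ _).trans (add_le_add ?_ (L2Z.norm_conv_le _ _ _))
  rw [norm_mul]
  exact mul_le_mul_of_nonneg_left (L2Z.norm_apply_le _ _) (norm_nonneg _)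

/-- For `p = n` the reflection `j ↦ -n - j` is `k ↦ -k` on frequencies. -/
theorem freqSq_reflect (n : ℤ) (j : ℤ) : freqSq n (-n - j) = freqSq n j := by
  unfold freqSq
  push_cast
  ring

/-- The two diagonal entries of the reduced `2 × 2` problem agree. -/
theorem IsRedSol.diagonal_eq {a : L2Z} {n : ℕ} {mu : ℂ} {x y : L2Z} (hx : IsRedSol a n mu 0 x)
    (hy : IsRedSol a n mu (-n) y) (hn : 1 ≤ n) (hmu : InTile n mu) :
    L2Z.conv a 0 (L2Z.unit 0 + x) = L2Z.conv a (-n) (L2Z.unit (-n) + y) := by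
  set X := L2Z.unit 0 + x with hX
  set Y := L2Z.unit (-n) + y with hY
  have hn0 : (n : ℤ) ≠ 0 := by omega
  have unit_summable : ∀ s, Summable fun j => ‖L2Z.unit s j‖ := fun s => by
    refine summable_of_ne_finset_zero (s := {s}) fun j hj => ?_
    rw [L2Z.unit_apply, if_neg (by simpa using hj), norm_zero]
  have hXs : Summable fun j => ‖X j‖ :=
    Summable.of_nonneg_of_le (fun _ => norm_nonneg _) (fun j => norm_add_le _ _)
      ((unit_summable 0).add (hx.summable_norm hn hmu))
  have hYs : Summable fun j => ‖Y j‖ :=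
    Summable.of_nonneg_of_le (fun _ => norm_nonneg _) (fun j => norm_add_le _ _)
      ((unit_summable (-n)).add (hy.summable_norm hn hmu))
  have s1 := L2Z.summable_reflect_mul a Y X n hYs
  have s2 := L2Z.summable_reflect_mul a X Y n hXs
  have s2' := (Equiv.subLeft (-(n : ℤ))).summable_iff.2 s2
  have e := L2Z.tsum_reflect_mul_conv_comm a Y X n hYs
  rw [← (Equiv.subLeft (-(n : ℤ))).tsum_eq (fun j => X (-n - j) * L2Z.conv a j Y), ← sub_eq_zero] at e
  replace e := (s1.tsum_sub s2').trans e
  have hX0 : X 0 = 1 := by rw [hX, L2Z.add_apply, L2Z.unit_apply, hx.apply_zero]; simp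
  have hXn : X (-n) = 0 := by
    rw [hX, L2Z.add_apply, L2Z.unit_apply, hx.apply_neg, if_neg (by omega)]; simp
  have hY0 : Y 0 = 0 := by
    rw [hY, L2Z.add_apply, L2Z.unit_apply, hy.apply_zero, if_neg (by omega)]; simp
  have hYn : Y (-n) = 1 := by rw [hY, L2Z.add_apply, L2Z.unit_apply, hy.apply_neg]; simp
  -- The two symmetric pairings are compared term by term. Off `0` and `-n` both terms equal `(mu -
  -- freqSq n j) x_j y_{-n-j}` and cancel, at `-n` both vanish, and `j = 0` leaves the difference of
  -- the diagonal entries.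
  rw [tsum_eq_single 0] at e
  · simp only [Equiv.subLeft_apply, sub_zero, hYn, Function.comp_apply, sub_self, hX0] at e
    rw [one_mul, one_mul] at e
    exact sub_eq_zero.1 e
  · intro j hj
    simp only [Equiv.subLeft_apply, Function.comp_apply, sub_sub_cancel]
    by_cases h1 : j = -n
    · rw [h1, sub_self, hY0, hXn]; simp
    · have hxj : X j = x j := by
        rw [hX, L2Z.add_apply, L2Z.unit_apply, if_neg hj, zero_add]
      have hyj : Y (-n - j) = y (-n - j) := by
        rw [hY, L2Z.add_apply, L2Z.unit_apply, if_neg (by omega), zero_add]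
      rw [← hx.mul_eq hn hmu hj h1, ← hy.mul_eq hn hmu (by omega) (by omega), hxj, hyj,
        freqSq_reflect]
      ring

/-- The diagonal entry of the reduced problem depends little on the spectral parameter. -/
theorem IsRedSol.norm_conv_sub_le {a : L2Z} {n : ℕ} {mu nu : ℂ} {s : ℤ} {x y : L2Z}
    (hx : IsRedSol a n mu s x) (hy : IsRedSol a n nu s y) (hn : 1 ≤ n) (ha : ‖a‖ ≤ n / 4)
    (hmu : InTile n mu) (hnu : InTile n nu) (hyn : ‖y‖ ≤ 1 / 3) (i : ℤ) :
    ‖L2Z.conv a i (L2Z.unit s + x) - L2Z.conv a i (L2Z.unit s + y)‖ ≤ ‖mu - nu‖ / 9 := by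
  have hn' : (0 : ℝ) < n := by exact_mod_cast hn
  obtain ⟨g1, g2⟩ := redRes_summable (p := n) hn hmu
  obtain ⟨k1, k2⟩ := redRes_summable (p := n) hn hnu
  set g := L2Z.mk _ g1
  set k := L2Z.mk _ k1
  have hg : ‖g‖ ≤ 1 / n := L2Z.norm_mk_le g1 (by positivity) g2
  have hk : ‖k‖ ≤ 1 / n := L2Z.norm_mk_le k1 (by positivity) k2
  set d := x - y with hd
  -- The resolvent identity.
  have hdiff : ∀ j, g j - k j = (nu - mu) * (g j * k j) := fun j => by
    change redRes n n mu j - redRes n n nu j = _ * (redRes n n mu j * redRes n n nu j)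
    by_cases h : |2 * j + n| = (n : ℤ)
    · simp [redRes, h]
    · have e1 := redRes_mul hn hmu h
      have e2 := redRes_mul hn hnu h
      linear_combination redRes n n nu j * e1 - redRes n n mu j * e2
  have hde : d = L2Z.mulBdd g (fun j => L2Z.conv a j d) _ (L2Z.norm_conv_le a · d) +
      (nu - mu) • L2Z.mulBdd (L2Z.diag g k) (fun j => L2Z.conv a j (L2Z.unit s + y)) _
        (L2Z.norm_conv_le a · _) := by
    refine L2Z.ext_iff'.2 fun j => ?_
    rw [L2Z.add_apply, L2Z.smul_apply, L2Z.mulBdd_apply, L2Z.mulBdd_apply, L2Z.diag_apply,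
      ← mul_assoc, ← hdiff]
    rw [hd, L2Z.sub_apply, hx j, hy j, map_sub, map_add, map_add]
    change g j * _ - k j * _ = _
    ring
  -- The equation for `d` contains `d` with factor `1/4`; absorbing it turns `4/3` into `16/9`, and
  -- using `‖a‖/n ≤ 1/4` twice leaves `1/9`.
  have hdn : ‖d‖ ≤ 1 / n * (n / 4 * ‖d‖) + ‖nu - mu‖ * (1 / n * (1 / n) * (‖a‖ * (4 / 3))) := by
    have h1 : ‖d‖ ≤ ‖g‖ * (‖a‖ * ‖d‖) +
        ‖nu - mu‖ * (‖L2Z.diag g k‖ * (‖a‖ * ‖L2Z.unit s + y‖)) := by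
      conv_lhs => rw [hde]
      refine (norm_add_le _ _).trans (add_le_add (L2Z.norm_mulBdd_le _ _ _ _) ?_)
      rw [norm_smul]
      exact mul_le_mul_of_nonneg_left (L2Z.norm_mulBdd_le _ _ _ _) (norm_nonneg _)
    refine h1.trans ?_
    have h2 : ‖L2Z.diag g k‖ ≤ 1 / n * (1 / n) :=
      (L2Z.norm_diag_le _ _).trans (by gcongr)
    have h3 : ‖L2Z.unit s + y‖ ≤ 4 / 3 := (norm_add_le _ _).trans (by rw [L2Z.norm_unit]; linarith)
    gcongr
  have hd1 : ‖d‖ ≤ 16 / 9 * (‖a‖ / n ^ 2) * ‖mu - nu‖ := by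
    rw [norm_sub_rev nu] at hdn
    have e1 : 1 / (n : ℝ) * (n / 4 * ‖d‖) = ‖d‖ / 4 := by field_simp
    have e2 : ‖mu - nu‖ * (1 / (n : ℝ) * (1 / n) * (‖a‖ * (4 / 3))) =
      4 / 3 * (‖a‖ / n ^ 2) * ‖mu - nu‖ := by field_simp
    rw [e1, e2] at hdn
    linarith
  rw [← map_sub, add_sub_add_left_eq_sub, ← hd]
  calc ‖L2Z.conv a i d‖ ≤ ‖a‖ * (16 / 9 * (‖a‖ / n ^ 2) * ‖mu - nu‖) :=
        (L2Z.norm_conv_le _ _ _).trans (by gcongr)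
    _ = 16 / 9 * (‖a‖ / n) ^ 2 * ‖mu - nu‖ := by ring
    _ ≤ 16 / 9 * (1 / 4) ^ 2 * ‖mu - nu‖ := by
        have : ‖a‖ / n ≤ 1 / 4 := by rw [div_le_iff₀ hn']; linarith
        gcongr
    _ = ‖mu - nu‖ / 9 := by ring

/-- A sequence solving `u = g (a * u)` with small `a` and `g` vanishes. -/
theorem L2Z.eq_zero_of_eq_mul_conv {a g u : L2Z} {n : ℝ} (hn : 0 < n) (ha : ‖a‖ ≤ n / 4)
    (hg : ‖g‖ ≤ 1 / n) (h : ∀ j, u j = g j * conv a j u) : u = 0 := by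
  have hu : u = mulBdd g (fun j => conv a j u) _ (norm_conv_le a · u) :=
    ext_iff'.2 h
  have h1 : ‖u‖ ≤ ‖g‖ * (‖a‖ * ‖u‖) := by
    conv_lhs => rw [hu]
    exact norm_mulBdd_le _ _ _ _
  have h2 : ‖g‖ * (‖a‖ * ‖u‖) ≤ 1 / n * (n / 4 * ‖u‖) := by gcongr
  have h3 : 1 / n * (n / 4 * ‖u‖) = ‖u‖ / 4 := by field_simp
  rw [← norm_le_zero_iff]
  linarith [norm_nonneg u]

/-- An eigenvalue in the strip around `n²π²` solves the reduced `2 × 2` problem. -/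
theorem IsEigSeq.det_eq_zero {a : L2Z} {n : ℕ} {mu : ℂ} {u x y : L2Z} (hu : IsEigSeq a n mu u)
    (hu0 : u ≠ 0) (hn : 1 ≤ n) (ha : ‖a‖ ≤ n / 4) (hmu : InTile n mu)
    (hx : IsRedSol a n mu 0 x) (hy : IsRedSol a n mu (-n) y) :
    (mu - ((Real.pi * n) ^ 2 : ℝ) - L2Z.conv a 0 (L2Z.unit 0 + x)) ^ 2 =
      L2Z.conv a (-n) (L2Z.unit 0 + x) * L2Z.conv a 0 (L2Z.unit (-n) + y) := by
  have hn' : (0 : ℝ) < n := by exact_mod_cast hn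
  obtain ⟨g1, g2⟩ := redRes_summable (p := n) hn hmu
  set g := L2Z.mk _ g1
  have hg : ‖g‖ ≤ 1 / n := L2Z.norm_mk_le g1 (by positivity) g2
  have hA := hx.diagonal_eq hy hn hmu
  set X := L2Z.unit 0 + x with hX
  set Y := L2Z.unit (-n) + y with hY
  have hX0 : X 0 = 1 := by rw [hX, L2Z.add_apply, L2Z.unit_apply, hx.apply_zero]; simp
  have hXn : X (-n) = 0 := by
    rw [hX, L2Z.add_apply, L2Z.unit_apply, hx.apply_neg, if_neg (by omega)]; simp
  have hY0 : Y 0 = 0 := by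
    rw [hY, L2Z.add_apply, L2Z.unit_apply, hy.apply_zero, if_neg (by omega)]; simp
  have hYn : Y (-n) = 1 := by rw [hY, L2Z.add_apply, L2Z.unit_apply, hy.apply_neg]; simp
  -- Both exceptional coordinates of this difference vanish, so it solves the homogeneous reduced
  -- equation, which has only the zero solution.
  have hr : u - (u 0 • X + u (-n) • Y) = 0 := by
    refine L2Z.eq_zero_of_eq_mul_conv hn' ha hg fun j => ?_
    change _ = redRes n n mu j * _
    rw [L2Z.sub_apply, L2Z.add_apply, L2Z.smul_apply, L2Z.smul_apply]
    by_cases h0 : j = 0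
    · rw [h0, hX0, hY0, redRes_self_zero]; ring
    by_cases h1 : j = -n
    · rw [h1, hXn, hYn, redRes_self_neg]; ring
    · have e1 : X j = redRes n n mu j * L2Z.conv a j X := by
        rw [← hx j, hX, L2Z.add_apply, L2Z.unit_apply, if_neg h0, zero_add]
      have e2 : Y j = redRes n n mu j * L2Z.conv a j Y := by
        rw [← hy j, hY, L2Z.add_apply, L2Z.unit_apply, if_neg h1, zero_add]
      have e3 : u j = redRes n n mu j * L2Z.conv a j u := by
        have : L2Z.conv a j u = (mu - freqSq n j) * u j := by rw [sub_mul, ← hu j]; ring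
        rw [this, ← mul_assoc, redRes_mul hn hmu (abs_two_mul_add_ne h0 h1), one_mul]
      rw [map_sub, map_add, map_smul, map_smul, smul_eq_mul, smul_eq_mul]
      linear_combination e3 - u 0 * e1 - u (-n) * e2
  have hu' : u = u 0 • X + u (-n) • Y := sub_eq_zero.1 hr
  have f0 : freqSq n 0 = (Real.pi * n) ^ 2 := freqSq_of_abs_eq (by simp)
  have fn : freqSq n (-n) = (Real.pi * n) ^ 2 :=
    freqSq_of_abs_eq (by rw [show 2 * -(n : ℤ) + n = -n by ring, abs_neg]; simp)
  have c : ∀ j, L2Z.conv a j u = u 0 * L2Z.conv a j X + u (-n) * L2Z.conv a j Y := fun j => by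
    conv_lhs => rw [hu']
    rw [map_add, map_smul, map_smul, smul_eq_mul, smul_eq_mul]
  have e0 := hu 0
  have en := hu (-n)
  rw [c, f0] at e0
  rw [c, fn, ← hA] at en
  -- `e0` and `en` are a homogeneous `2 × 2` system for `u 0` and `u (-n)`. Eliminating the other
  -- unknown gives a nonzero coordinate times the determinant.
  have hne : u 0 ≠ 0 ∨ u (-n) ≠ 0 := by
    by_contra! h
    apply hu0
    rw [hu', h.1, h.2]
    simp
  rcases hne with h | h
  · refine mul_left_cancel₀ h ?_
    linear_combination (-(mu - ((Real.pi * n) ^ 2 : ℝ) - L2Z.conv a 0 X)) * e0 -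
      L2Z.conv a 0 Y * en
  · refine mul_left_cancel₀ h ?_
    linear_combination (-(mu - ((Real.pi * n) ^ 2 : ℝ) - L2Z.conv a 0 X)) * en -
      L2Z.conv a (-n) X * e0

/-- Eigenfunctions for an eigenvalue in the strip around `n²π²` have the parity of `n`, and can be
reindexed accordingly. -/
theorem IsEigSeq.exists_reindex {a : L2Z} {p : ℤ} {n : ℕ} {mu : ℂ} {u : L2Z}
    (hu : IsEigSeq a p mu u) (hu0 : u ≠ 0) (hn : 1 ≤ n) (ha : ‖a‖ ≤ n / 4) (hmu : InTile n mu) :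
    ∃ v, v ≠ 0 ∧ IsEigSeq a n mu v := by
  have hn' : (0 : ℝ) < n := by exact_mod_cast hn
  rcases Int.even_or_odd' (n - p) with ⟨m, hm | hm⟩
  · have hs : Summable fun j => ‖u (j + m)‖ ^ 2 := (Equiv.addRight m).summable_iff.2 u.summable_sq
    refine ⟨L2Z.mk _ hs, fun h => hu0 (L2Z.ext_iff'.2 fun j => ?_), fun j => ?_⟩
    · have := L2Z.ext_iff'.1 h (j - m)
      simpa using this
    · have h := hu (j + m)
      have hf : freqSq p (j + m) = freqSq n j := by
        unfold freqSq
        rw [show 2 * (j + m) + p = 2 * j + n by omega]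
      have hc : L2Z.conv a j (L2Z.mk _ hs) = L2Z.conv a (j + m) u := by
        rw [L2Z.conv_apply, L2Z.conv_apply, 
          ← (Equiv.addRight m).tsum_eq (fun l => a (j + m - l) * u l)]
        refine tsum_congr fun l => ?_
        simp [add_sub_add_right_eq_sub]
      rw [hf] at h
      rw [hc]
      exact h
  -- If `n - p` is odd, no mode has frequency `±n`. The reduced resolvent is then the full one, and
  -- the small fixed point equation forces `u = 0`.
  · exfalso
    obtain ⟨g1, g2⟩ := redRes_summable (p := p) hn hmu
    refine hu0 (L2Z.eq_zero_of_eq_mul_conv (g := L2Z.mk _ g1) hn' ha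
      (L2Z.norm_mk_le g1 (by positivity) g2) fun j => ?_)
    have hne : |2 * j + p| ≠ n := fun h => by
      rcases abs_choice (2 * j + p) with h' | h' <;> omega
    have : L2Z.conv a j u = (mu - freqSq p j) * u j := by rw [sub_mul, ← hu j]; ring
    rw [this, L2Z.mk_apply, ← mul_assoc, redRes_mul hn hmu hne, one_mul]

/-- The root equations bound `l1 - l2` up to `A1 - A2`, which is absorbed at the cost of the factor
`1/(1 - 1/9) = 9/8`. -/
theorem norm_sub_le_of_sq_eq {l1 l2 A1 A2 B1 C1 B2 C2 σ : ℂ} (h1 : (l1 - σ - A1) ^ 2 = B1 * C1)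
    (h2 : (l2 - σ - A2) ^ 2 = B2 * C2) (hA : ‖A1 - A2‖ ≤ ‖l1 - l2‖ / 9) :
    ‖l1 - l2‖ ≤ 9 / 8 * (√(‖B1‖ * ‖C1‖) + √(‖B2‖ * ‖C2‖)) := by
  have e1 : ‖l1 - σ - A1‖ = √(‖B1‖ * ‖C1‖) := by
    rw [← norm_mul, ← h1, norm_pow, Real.sqrt_sq (norm_nonneg _)]
  have e2 : ‖l2 - σ - A2‖ = √(‖B2‖ * ‖C2‖) := by
    rw [← norm_mul, ← h2, norm_pow, Real.sqrt_sq (norm_nonneg _)]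
  have e3 : l1 - l2 = (l1 - σ - A1) - (l2 - σ - A2) + (A1 - A2) := by ring
  have e4 : ‖l1 - l2‖ ≤ ‖l1 - σ - A1‖ + ‖l2 - σ - A2‖ + ‖A1 - A2‖ := by
    conv_lhs => rw [e3]
    exact (norm_add_le _ _).trans (add_le_add_left (norm_sub_le _ _) _)
  rw [e1, e2] at e4
  linarith

/-- The bounds on the distance of two eigenvalues in the strip around `n²π²`. -/
theorem weighted_gap_le {w : ℤ → ℝ} (hw : IsSubmulWeight w) {a : L2Z} {β : ℝ}
    (ha : Summable fun j => w j ^ 2 * ‖a j‖ ^ 2)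
    (hβ : √(∑' j, w j ^ 2 * ‖a j‖ ^ 2) = β) {n : ℕ} (hn : 1 ≤ n) (hβn : β ≤ n / 4)
    {p1 p2 : ℤ} {l1 l2 : ℂ} {u1 u2 : L2Z} (h1 : IsEigSeq a p1 l1 u1) (h2 : IsEigSeq a p2 l2 u2)
    (hu1 : u1 ≠ 0) (hu2 : u2 ≠ 0) (ht1 : InTile n l1) (ht2 : InTile n l2) :
    w n * ‖l1 - l2‖ ≤ 6 * β ∧
      w n ^ 2 * ‖l1 - l2‖ ^ 2 ≤
        6 * (w n ^ 2 * ‖a n‖ ^ 2 + w (-n) ^ 2 * ‖a (-n)‖ ^ 2) + 22 * β ^ 4 / n ^ 2 := by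
  have wpos : ∀ j, 0 < w j := fun j => lt_of_lt_of_le one_pos (hw.one_le j)
  have hn' : (0 : ℝ) < n := by exact_mod_cast hn
  have hn1 : (1 : ℝ) ≤ n := by exact_mod_cast hn
  have hβ0 : 0 ≤ β := hβ ▸ Real.sqrt_nonneg _
  have hβ2 : ∑' j, w j ^ 2 * ‖a j‖ ^ 2 = β ^ 2 := by
    rw [← hβ, Real.sq_sqrt (tsum_nonneg fun j => by positivity)]
  have haβ : ‖a‖ ≤ β := by
    rw [← sq_le_sq₀ (norm_nonneg _) hβ0, ← hβ2, L2Z.norm_sq_eq]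
    refine a.summable_sq.tsum_le_tsum (fun j => ?_) ha
    exact le_mul_of_one_le_left (sq_nonneg _) (one_le_pow₀ (hw.one_le j))
  have ha4 : ‖a‖ ≤ n / 4 := haβ.trans hβn
  have hb : ∀ j, w j * ‖a j‖ ≤ β := fun j => by
    have h1 := ha.le_tsum j fun i _ => by positivity
    rw [hβ2, ← mul_pow] at h1
    exact (sq_le_sq₀ (mul_nonneg (wpos _).le (norm_nonneg _)) hβ0).1 h1
  -- The entries `B`, `C` depend on the eigenvalue, their bounds do not. The weight is centred at
  -- `0` for `x` and at `-n` for `y`, so that at the opposite exceptional mode it equals `w n` in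
  -- both cases.
  have main : ∀ {p : ℤ} {l : ℂ} {u : L2Z}, IsEigSeq a p l u → u ≠ 0 → InTile n l →
      ∃ x B C, IsRedSol a n l 0 x ∧ ‖x‖ ≤ 1 / 3 ∧
        (l - ((Real.pi * n) ^ 2 : ℝ) - L2Z.conv a 0 (L2Z.unit 0 + x)) ^ 2 = B * C ∧
        w n * ‖B‖ ≤ w (-n) * ‖a (-n)‖ + 4 / 3 * β ^ 2 / n ∧
        w n * ‖C‖ ≤ w n * ‖a n‖ + 4 / 3 * β ^ 2 / n := by
    intro p l u hu hu0 hl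
    obtain ⟨v, hv0, hv⟩ := hu.exists_reindex hu0 hn ha4 hl
    obtain ⟨g1, g2⟩ := redRes_summable (p := n) hn hl
    have hg : ‖L2Z.mk _ g1‖ ≤ 1 / n := L2Z.norm_mk_le g1 (by positivity) g2
    obtain ⟨x, hx, hxn, hxw⟩ := L2Z.exists_weighted_solution hw a _ ha hβ hn' hβn hg 0
    obtain ⟨y, hy, hyn, hyw⟩ := L2Z.exists_weighted_solution hw a _ ha hβ hn' hβn hg (-n)
    refine ⟨x, _, _, hx, hxn, hv.det_eq_zero hv0 hn ha4 hl hx hy, ?_, ?_⟩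
    · rw [map_add, L2Z.conv_unit, sub_zero]
      have := hxw (-n)
      rw [sub_zero, hw.even] at this
      rw [hw.even]
      calc _ ≤ w n * (‖a (-n)‖ + ‖L2Z.conv a (-n) x‖) :=
            mul_le_mul_of_nonneg_left (norm_add_le _ _) (wpos _).le
        _ ≤ _ := by rw [mul_add]; linarith
    · rw [map_add, L2Z.conv_unit, zero_sub, neg_neg]
      have := hyw 0
      rw [zero_sub, neg_neg] at this
      calc _ ≤ w n * (‖a n‖ + ‖L2Z.conv a 0 y‖) :=
            mul_le_mul_of_nonneg_left (norm_add_le _ _) (wpos _).le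
        _ ≤ _ := by rw [mul_add]; linarith
  obtain ⟨x1, B1, C1, hx1, hn1', hd1, hB1, hC1⟩ := main h1 hu1 ht1
  obtain ⟨x2, B2, C2, hx2, hn2', hd2, hB2, hC2⟩ := main h2 hu2 ht2
  have hgap := norm_sub_le_of_sq_eq hd1 hd2 (hx1.norm_conv_sub_le hx2 hn ha4 ht1 ht2 hn2' 0)
  set ρ := 4 / 3 * β ^ 2 / n with hρ
  set b := w (-n) * ‖a (-n)‖ with hbdef
  set c := w n * ‖a n‖ with hcdef
  have hρ0 : 0 ≤ ρ := by positivity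
  have hb0 : 0 ≤ b := mul_nonneg (wpos _).le (norm_nonneg _)
  have hc0 : 0 ≤ c := mul_nonneg (wpos _).le (norm_nonneg _)
  have hρβ : ρ ≤ β / 3 := by
    rw [hρ, div_le_iff₀ hn']
    nlinarith
  have sq : ∀ B C : ℂ, w n * ‖B‖ ≤ b + ρ → w n * ‖C‖ ≤ c + ρ →
      (w n * √(‖B‖ * ‖C‖)) ^ 2 ≤ (b + ρ) * (c + ρ) := by
    intro B C hB hC
    rw [mul_pow, Real.sq_sqrt (by positivity)]
    calc w n ^ 2 * (‖B‖ * ‖C‖) = (w n * ‖B‖) * (w n * ‖C‖) := by ring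
      _ ≤ _ := mul_le_mul hB hC (mul_nonneg (wpos _).le (norm_nonneg _)) (by positivity)
  set φ1 := w n * √(‖B1‖ * ‖C1‖) with hφ1
  set φ2 := w n * √(‖B2‖ * ‖C2‖) with hφ2
  have q1 : φ1 ^ 2 ≤ _ := sq _ _ hB1 hC1
  have q2 : φ2 ^ 2 ≤ _ := sq _ _ hB2 hC2
  have hφ10 : 0 ≤ φ1 := mul_nonneg (wpos _).le (Real.sqrt_nonneg _)
  have hφ20 : 0 ≤ φ2 := mul_nonneg (wpos _).le (Real.sqrt_nonneg _)
  have hg : w n * ‖l1 - l2‖ ≤ 9 / 8 * (φ1 + φ2) := by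
    calc _ ≤ w n * (9 / 8 * (√(‖B1‖ * ‖C1‖) + √(‖B2‖ * ‖C2‖))) :=
          mul_le_mul_of_nonneg_left hgap (wpos _).le
      _ = _ := by rw [hφ1, hφ2]; ring
  have hbc : (b + ρ) * (c + ρ) ≤ (4 / 3 * β) ^ 2 := by
    have hb' : b + ρ ≤ 4 / 3 * β := by linarith [hb (-n)]
    have hc' : c + ρ ≤ 4 / 3 * β := by linarith [hb n]
    rw [_root_.sq]
    exact mul_le_mul hb' hc' (by positivity) (by positivity)
  constructor
  -- This gives `9/8 · 2 · 4/3 = 3` in place of `6`.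
  · have p1 : φ1 ≤ 4 / 3 * β := (sq_le_sq₀ hφ10 (by positivity)).1 (q1.trans hbc)
    have p2 : φ2 ≤ 4 / 3 * β := (sq_le_sq₀ hφ20 (by positivity)).1 (q2.trans hbc)
    linarith
  · have r0 : 0 ≤ w n * ‖l1 - l2‖ := mul_nonneg (wpos _).le (norm_nonneg _)
    have r1 : w n ^ 2 * ‖l1 - l2‖ ^ 2 ≤ (9 / 8 * (φ1 + φ2)) ^ 2 := by
      rw [← mul_pow]
      exact pow_le_pow_left₀ r0 hg 2
    have r2 : (9 / 8 * (φ1 + φ2)) ^ 2 ≤ 81 / 16 * ((b + ρ) * (c + ρ)) := by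
      have h3 : (φ1 + φ2) ^ 2 ≤ 2 * (φ1 ^ 2 + φ2 ^ 2) := by
        linarith only [sq_nonneg (φ1 - φ2), add_sq φ1 φ2, sub_sq φ1 φ2]
      rw [mul_pow]
      linarith only [h3, q1, q2]
    have r3 : (b + ρ) * (c + ρ) ≤ b ^ 2 + c ^ 2 + 2 * ρ ^ 2 := by
      nlinarith only [sq_nonneg (b - c), sq_nonneg (b - ρ), sq_nonneg (c - ρ)]
    have r4 : ρ ^ 2 = 16 / 9 * (β ^ 4 / n ^ 2) := by rw [hρ]; ring
    have r5 : 0 ≤ β ^ 4 / (n : ℝ) ^ 2 := by positivity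
    rw [mul_div_assoc, ← mul_pow (w (-n)), ← mul_pow (w n) ‖a n‖, ← hbdef, ← hcdef]
    -- The constants are `81/16 ≤ 6` and `(81/16) · 2 · (16/9) = 18 ≤ 22`.
    linarith only [sq_nonneg b, sq_nonneg c, r1, r2, r3, r4, r5]

/-! ### The invariant subspace over the low modes -/

/-- The indices of the modes of frequency less than `n`. -/
def modes (p : ℤ) (n : ℕ) : Finset ℤ := Finset.Ioc ((-n - p) / 2) ((n - p - 1) / 2)

theorem mem_modes {p : ℤ} {n : ℕ} {j : ℤ} : j ∈ modes p n ↔ |2 * j + p| < n := by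
  rw [modes, Finset.mem_Ioc, abs_lt]
  omega

theorem card_modes_le (p : ℤ) (n : ℕ) : (modes p n).card ≤ n := by
  rw [modes, Int.card_Ioc]
  omega

/-- Even (periodic) and odd (anti-periodic) frequencies together are all integers `k` with `|k| <
n`. -/
theorem card_modes_add_card_modes {n : ℕ} (hn : 1 ≤ n) :
    (modes 0 n).card + (modes 1 n).card = 2 * n - 1 := by
  rw [modes, modes, Int.card_Ioc, Int.card_Ioc]
  omega

theorem freqSq_lt_cut {p : ℤ} {n : ℕ} {j : ℤ} (h : j ∈ modes p n) : freqSq p j < cut n := by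
  rw [mem_modes] at h
  have h1 : |((2 * j + p : ℤ) : ℝ)| ≤ n - 1 := by
    rw [← Int.cast_abs]
    have : |2 * j + p| ≤ n - 1 := by omega
    exact_mod_cast this
  have h2 : ((2 * j + p : ℤ) : ℝ) ^ 2 ≤ (n - 1 : ℝ) ^ 2 := by
    rw [← sq_abs]
    exact pow_le_pow_left₀ (abs_nonneg _) h1 2
  have h3 : (1 : ℝ) ≤ n := by linarith [abs_nonneg ((2 * j + p : ℤ) : ℝ)]
  rw [freqSq, cut, mul_pow]
  have := nine_lt_pi_sq
  gcongr
  nlinarith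

theorem cut_lt_freqSq {p : ℤ} {n : ℕ} (hn : 1 ≤ n) {j : ℤ} (h : j ∉ modes p n) :
    cut n < freqSq p j := by
  rw [mem_modes, not_lt] at h
  have h1 := le_sub_re_of_le_cut hn le_rfl h
  have hn' : (0 : ℝ) < n := by exact_mod_cast hn
  have h2 : (0 : ℝ) < |((|2 * j + p| - (n - 1) : ℤ) : ℝ)| :=
    abs_pos.2 (Int.cast_ne_zero.2 (by omega))
  have h3 : 0 < 9 / 2 * (n : ℝ) * |((|2 * j + p| - (n - 1) : ℤ) : ℝ)| := by positivity
  exact sub_pos.1 (h3.trans_le h1)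

/-- The inverse of `-d²/dx² - mu` on the modes of frequency at least `n`. -/
def hiRes (p : ℤ) (n : ℕ) (mu : ℂ) (j : ℤ) : ℂ :=
  if j ∈ modes p n then 0 else 1 / (freqSq p j - mu)

theorem hiRes_mul {p : ℤ} {n : ℕ} (hn : 1 ≤ n) {mu : ℂ} (hmu : mu.re ≤ cut n) {j : ℤ}
    (hj : j ∉ modes p n) : hiRes p n mu j * (freqSq p j - mu) = 1 := by
  rw [hiRes, if_neg hj, one_div_mul_cancel]
  intro h
  have := congrArg Complex.re h
  rw [Complex.sub_re, Complex.ofReal_re, Complex.zero_re] at this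
  linarith [cut_lt_freqSq hn hj]

theorem hiRes_summable {p : ℤ} {n : ℕ} (hn : 1 ≤ n) {mu : ℂ} (hmu : mu.re ≤ cut n) :
    (Summable fun j => ‖hiRes p n mu j‖ ^ 2) ∧
      ∑' j, ‖hiRes p n mu j‖ ^ 2 ≤ (1 / (n : ℝ)) ^ 2 := by
  have hn' : (1 : ℝ) ≤ n := by exact_mod_cast hn
  refine summable_sq_of_le_one_div (by linarith) (n - 1) (freq_injective p) fun j => ?_
  unfold hiRes
  split_ifs with h
  · rw [norm_zero]; positivity
  · rw [mem_modes, not_lt] at h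
    rw [norm_div, norm_one]
    have hp : (0 : ℝ) < |((|2 * j + p| - (n - 1) : ℤ) : ℝ)| :=
      abs_pos.2 (Int.cast_ne_zero.2 (by omega))
    refine one_div_le_one_div_of_le (by positivity) ?_
    refine ((le_sub_re_of_le_cut hn hmu h).trans ?_).trans (Complex.abs_re_le_norm _)
    rw [Complex.sub_re, Complex.ofReal_re]
    exact le_abs_self _

/-- `hiRes` as an element of `ℓ²`. -/
def hiResL (p : ℤ) (n : ℕ) (mu : ℂ) : L2Z :=
  -- The default value `0` makes the bound `1/n` unconditional and `ricc` defined for all arguments.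
  if h : 1 ≤ n ∧ mu.re ≤ cut n then L2Z.mk _ (hiRes_summable (p := p) h.1 h.2).1 else 0

theorem hiResL_apply {p : ℤ} {n : ℕ} (hn : 1 ≤ n) {mu : ℂ} (hmu : mu.re ≤ cut n) (j : ℤ) :
    hiResL p n mu j = hiRes p n mu j := by
  rw [hiResL, dif_pos ⟨hn, hmu⟩]; rfl

theorem norm_hiResL_le (p : ℤ) (n : ℕ) (mu : ℂ) : ‖hiResL p n mu‖ ≤ 1 / n := by
  unfold hiResL
  split_ifs with h
  · exact L2Z.norm_mk_le _ (by positivity) (hiRes_summable h.1 h.2).2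
  · rw [norm_zero]; positivity

section

variable {p : ℤ} {n : ℕ}

/-- The map whose fixed points `X` give the invariant subspaces spanned by the `e_k + X_k`, where `k`
runs over the modes of frequency less than `n`. -/
def ricc (a : L2Z) (X : modes p n → L2Z) (k : modes p n) : L2Z :=
  -(L2Z.kerOp (hiResL p n (freqSq p k)) (L2Z.row a) ‖a‖ (fun j => (L2Z.norm_row a j).le)
      (L2Z.unit k + X k) -
    ∑ i : modes p n, L2Z.conv a i (L2Z.unit k + X k) • L2Z.diag (hiResL p n (freqSq p k)) (X i))

/-- Invariance means that the operator sends `e_k + X_k` to a combination of the `e_i + X_i`. Its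
low coordinates fix the coefficients as `δ_{ik} freqSq p k + (a * (e_k + X_k))_i`; inserting these
in the high coordinates and dividing by `freqSq p j - freqSq p k` gives this Riccati equation. -/
theorem ricc_apply (a : L2Z) (X : modes p n → L2Z) (k : modes p n) (j : ℤ) :
    ricc a X k j = -(hiResL p n (freqSq p k) j * (L2Z.conv a j (L2Z.unit k + X k) -
      ∑ i : modes p n, L2Z.conv a i (L2Z.unit k + X k) * X i j)) := by
  rw [ricc, L2Z.neg_apply, L2Z.sub_apply, L2Z.sum_apply, L2Z.kerOp_apply, mul_sub, Finset.mul_sum]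
  congr 2
  refine Finset.sum_congr rfl fun i _ => ?_
  rw [L2Z.smul_apply, L2Z.diag_apply]; ring

theorem ricc_smul (t : ℂ) (a : L2Z) (X : modes p n → L2Z) : ricc (t • a) X = t • ricc a X := by
  funext k
  refine L2Z.ext_iff'.2 fun j => ?_
  rw [Pi.smul_apply, L2Z.smul_apply, ricc_apply, ricc_apply]
  simp only [L2Z.conv_smul, mul_assoc]
  rw [← Finset.mul_sum]; ring

/-- Cauchy-Schwarz over at most `n` modes. A factor `n` instead of `√n` would cancel the smallness
`1/n` of the resolvent. -/
theorem sum_norm_apply_sub_le (a : L2Z) (k : ℤ) :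
    ∑ i : modes p n, ‖a (i - k)‖ ≤ √n * ‖a‖ := by
  rw [← sq_le_sq₀ (Finset.sum_nonneg fun _ _ => norm_nonneg _) (by positivity), mul_pow,
    Real.sq_sqrt (Nat.cast_nonneg n)]
  refine (sq_sum_le_card_mul_sum_sq).trans ?_
  have h1 : ((Finset.univ : Finset (modes p n)).card : ℝ) ≤ n := by
    rw [Finset.card_univ, Fintype.card_coe]
    exact_mod_cast card_modes_le p n
  have h2 : ∑ i : modes p n, ‖a (i - k)‖ ^ 2 ≤ ‖a‖ ^ 2 := by
    rw [L2Z.norm_sq_eq, ← (Equiv.subRight k).tsum_eq]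
    have hs : Summable fun i : ℤ => ‖a (i - k)‖ ^ 2 :=
      (Equiv.subRight k).summable_iff.2 a.summable_sq
    rw [Finset.sum_coe_sort (modes p n) fun i : ℤ => ‖a (i - k)‖ ^ 2]
    exact hs.sum_le_tsum _ fun _ _ => sq_nonneg _
  exact mul_le_mul h1 h2 (Finset.sum_nonneg fun _ _ => sq_nonneg _) (Nat.cast_nonneg n)

/-- `n` is large compared with the norm `β` of the potential. -/
def IsLarge (n : ℕ) (β : ℝ) : Prop := 0 ≤ β ∧ 36 * (β + 1) ^ 2 ≤ n

theorem IsLarge.one_le {β : ℝ} (h : IsLarge n β) : 1 ≤ n := by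
  have : (1 : ℝ) ≤ n := le_trans (by nlinarith [h.1]) h.2
  exact_mod_cast this

/-- With `IsLarge.sqrt_bound` this makes the Lipschitz constant of `ricc` at most `1/9 + 1/6 < 1/2`;
the `36` in `IsLarge` serves both. -/
theorem IsLarge.bound {β : ℝ} (h : IsLarge n β) : β / n + 4 * β ^ 2 / n ≤ 1 / 9 := by
  have hn : (0 : ℝ) < n := by exact_mod_cast h.one_le
  rw [← add_div, div_le_iff₀ hn]
  nlinarith [h.1, h.2]

theorem IsLarge.sqrt_bound {β : ℝ} (h : IsLarge n β) : 1 / n * (√n * β) ≤ 1 / 6 := by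
  have hn : (0 : ℝ) < n := by exact_mod_cast h.one_le
  have h1 : 6 * β ≤ √n := Real.le_sqrt_of_sq_le (by nlinarith [h.1, h.2])
  have h2 : √n * √n = n := Real.mul_self_sqrt hn.le
  rw [one_div_mul_eq_div, div_le_iff₀ hn]
  nlinarith [Real.sqrt_nonneg n]

/-- The map is quadratic in `X`. On a ball of radius `O(‖a‖/n)` each of the at most `n` quadratic
terms varies by `O(‖a‖²/n²)` times the distance, and the terms with `a (i - k)` are summed by
Cauchy-Schwarz. -/
theorem norm_ricc_sub_le {a : L2Z} (hL : IsLarge n ‖a‖) {X Y : modes p n → L2Z}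
    (hX : ‖X‖ ≤ 2 * ‖a‖ / n) (hY : ‖Y‖ ≤ 2 * ‖a‖ / n) :
    ‖ricc a X - ricc a Y‖ ≤ 1 / 2 * ‖X - Y‖ := by
  have hn : (0 : ℝ) < n := by exact_mod_cast hL.one_le
  refine (pi_norm_le_iff_of_nonneg (by positivity)).2 fun k => ?_
  set Λ := hiResL p n (freqSq p k)
  have hΛ : ‖Λ‖ ≤ 1 / n := norm_hiResL_le _ _ _
  set d := ‖X - Y‖ with hd
  set ρ := 2 * ‖a‖ / n with hρ
  have hρ0 : 0 ≤ ρ := by positivity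
  have hdk : ∀ i, ‖X i - Y i‖ ≤ d := fun i => norm_le_pi_norm (X - Y) i
  have hXi : ∀ i, ‖X i‖ ≤ ρ := fun i => (norm_le_pi_norm X i).trans hX
  have hYi : ∀ i, ‖Y i‖ ≤ ρ := fun i => (norm_le_pi_norm Y i).trans hY
  set T := L2Z.kerOp Λ (L2Z.row a) ‖a‖ (fun j => (L2Z.norm_row a j).le)
  have hT : ‖T‖ ≤ 1 / n * ‖a‖ := (L2Z.norm_kerOp_le _ _ _ _).trans (by gcongr)
  have key : (ricc a X - ricc a Y) k = -(T (X k - Y k)) +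
      ∑ i : modes p n, (L2Z.conv a i (X k - Y k) • L2Z.diag Λ (X i) +
        L2Z.conv a i (L2Z.unit k + Y k) • L2Z.diag Λ (X i - Y i)) := by
    have e : ∀ i : modes p n, L2Z.conv a i (X k - Y k) • L2Z.diag Λ (X i) +
        L2Z.conv a i (L2Z.unit k + Y k) • L2Z.diag Λ (X i - Y i) =
        L2Z.conv a i (L2Z.unit k + X k) • L2Z.diag Λ (X i) -
          L2Z.conv a i (L2Z.unit k + Y k) • L2Z.diag Λ (Y i) := fun i => by
      rw [map_sub, map_add, map_add, map_sub]
      module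
    rw [Finset.sum_congr rfl fun i _ => e i, Finset.sum_sub_distrib, Pi.sub_apply]
    change -(T (L2Z.unit k + X k) - _) - -(T (L2Z.unit k + Y k) - _) = _
    rw [map_add, map_add, map_sub]
    abel
  have hterm : ∀ i : modes p n, ‖L2Z.conv a i (X k - Y k) • L2Z.diag Λ (X i) +
        L2Z.conv a i (L2Z.unit k + Y k) • L2Z.diag Λ (X i - Y i)‖ ≤
      (‖a‖ * d * (1 / n * ρ) + ‖a‖ * ρ * (1 / n * d)) + ‖a (i - k)‖ * (1 / n * d) := fun i => by
    refine (norm_add_le _ _).trans ?_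
    rw [norm_smul, norm_smul, add_assoc, ← add_mul]
    have h1 : ‖L2Z.conv a i (X k - Y k)‖ ≤ ‖a‖ * d :=
      (L2Z.norm_conv_le _ _ _).trans (by gcongr; exact hdk k)
    have h2 : ‖L2Z.diag Λ (X i)‖ ≤ 1 / n * ρ :=
      (L2Z.norm_diag_le _ _).trans (mul_le_mul hΛ (hXi i) (norm_nonneg _) (by positivity))
    have h3 : ‖L2Z.diag Λ (X i - Y i)‖ ≤ 1 / n * d :=
      (L2Z.norm_diag_le _ _).trans (mul_le_mul hΛ (hdk i) (norm_nonneg _) (by positivity))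
    have h4 : ‖L2Z.conv a i (L2Z.unit k + Y k)‖ ≤ ‖a‖ * ρ + ‖a (i - k)‖ := by
      rw [map_add, L2Z.conv_unit, add_comm]
      refine (norm_add_le _ _).trans (add_le_add_left ?_ _)
      exact (L2Z.norm_conv_le _ _ _).trans (mul_le_mul_of_nonneg_left (hYi k) (norm_nonneg _))
    exact add_le_add (mul_le_mul h1 h2 (norm_nonneg _) (by positivity))
      (mul_le_mul h4 h3 (norm_nonneg _) (by positivity))
  have hcard : (Fintype.card (modes p n) : ℝ) ≤ n := by
    rw [Fintype.card_coe]; exact_mod_cast card_modes_le p n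
  rw [key]
  calc _ ≤ ‖T (X k - Y k)‖ + ∑ i : modes p n,
        ((‖a‖ * d * (1 / n * ρ) + ‖a‖ * ρ * (1 / n * d)) + ‖a (i - k)‖ * (1 / n * d)) := by
        refine (norm_add_le _ _).trans (add_le_add (norm_neg _).le ?_)
        exact (norm_sum_le _ _).trans (Finset.sum_le_sum fun i _ => hterm i)
    _ ≤ 1 / n * ‖a‖ * d + (n * (‖a‖ * d * (1 / n * ρ) + ‖a‖ * ρ * (1 / n * d)) +
        √n * ‖a‖ * (1 / n * d)) := by
        rw [Finset.sum_add_distrib, Finset.sum_const, ← Finset.sum_mul, Finset.card_univ,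
          nsmul_eq_mul]
        have := sum_norm_apply_sub_le (p := p) (n := n) a k
        have hTd : ‖T (X k - Y k)‖ ≤ 1 / n * ‖a‖ * d :=
          (T.le_opNorm _).trans (mul_le_mul hT (hdk k) (norm_nonneg _) (by positivity))
        gcongr
    _ = (‖a‖ / n + 4 * ‖a‖ ^ 2 / n + 1 / n * (√n * ‖a‖)) * d := by
        rw [hρ]; field_simp; ring
    _ ≤ 1 / 2 * d := by
        have := hL.bound
        have := hL.sqrt_bound
        gcongr
        linarith

theorem norm_ricc_zero_le {a : L2Z} : ‖ricc a (0 : modes p n → L2Z)‖ ≤ ‖a‖ / n := by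
  refine (pi_norm_le_iff_of_nonneg (by positivity)).2 fun k => ?_
  have e : ricc a (0 : modes p n → L2Z) k =
      -(L2Z.kerOp (hiResL p n (freqSq p k)) (L2Z.row a) ‖a‖ (fun j => (L2Z.norm_row a j).le)
        (L2Z.unit k)) := by
    refine L2Z.ext_iff'.2 fun j => ?_
    rw [ricc_apply, L2Z.neg_apply, L2Z.kerOp_apply]
    simp [L2Z.conv]
  rw [e, norm_neg]
  refine (ContinuousLinearMap.le_opNorm _ _).trans ?_
  rw [L2Z.norm_unit, mul_one]
  refine (L2Z.norm_kerOp_le _ _ _ _).trans ?_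
  rw [div_eq_inv_mul, ← one_div]
  gcongr
  exact norm_hiResL_le _ _ _

/-- The image of `0` has norm at most half the radius, and the contraction contributes at most the
other half. -/
theorem norm_ricc_le {a : L2Z} (hL : IsLarge n ‖a‖) {X : modes p n → L2Z}
    (hX : ‖X‖ ≤ 2 * ‖a‖ / n) : ‖ricc a X‖ ≤ 2 * ‖a‖ / n := by
  have h1 := norm_ricc_sub_le hL hX (Y := 0) (by rw [norm_zero]; positivity)
  have h2 := norm_ricc_zero_le (p := p) (n := n) (a := a)
  rw [sub_zero] at h1
  have h3 := norm_le_norm_add_norm_sub' (ricc a X) (ricc a (0 : modes p n → L2Z))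
  have h4 : 2 * ‖a‖ / n = 2 * (‖a‖ / n) := by ring
  rw [h4] at hX ⊢
  linarith

theorem exists_fixed_ricc {a : L2Z} (hL : IsLarge n ‖a‖) (p : ℤ) :
    ∃ X : modes p n → L2Z, ricc a X = X ∧ ‖X‖ ≤ 2 * ‖a‖ / n := by
  set s := Metric.closedBall (0 : modes p n → L2Z) (2 * ‖a‖ / n)
  have hs : IsComplete s := Metric.isClosed_closedBall.isComplete
  have hm : ∀ X, X ∈ s ↔ ‖X‖ ≤ 2 * ‖a‖ / n := fun X => by simp [s]
  have hmaps : Set.MapsTo (ricc a) s s := fun X hX => (hm _).2 (norm_ricc_le hL ((hm _).1 hX))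
  have hc : ContractingWith (1 / 2) (hmaps.restrict (ricc a) s s) := by
    refine ⟨by norm_num, LipschitzWith.of_dist_le_mul fun X Y => ?_⟩
    rw [Subtype.dist_eq, Subtype.dist_eq, dist_eq_norm, dist_eq_norm]
    have := norm_ricc_sub_le hL ((hm _).1 X.2) ((hm _).1 Y.2)
    simpa using this
  have h0 : (0 : modes p n → L2Z) ∈ s := (hm _).2 (by rw [norm_zero]; positivity)
  obtain ⟨X, hXs, hX, -⟩ := hc.exists_fixedPoint' hs hmaps h0 (edist_ne_top _ _)
  exact ⟨X, hX, (hm _).1 hXs⟩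

/-- The basis of the invariant subspace. -/
def invVec (X : modes p n → L2Z) (k : modes p n) : L2Z := L2Z.unit k + X k

/-- The element of the invariant subspace with given coordinates. -/
def invMap (X : modes p n → L2Z) : (modes p n → ℂ) →ₗ[ℂ] L2Z :=
  Fintype.linearCombination ℂ (invVec X)

/-- The matrix of the operator on the invariant subspace. -/
def invMat (a : L2Z) (X : modes p n → L2Z) : Matrix (modes p n) (modes p n) ℂ :=
  Matrix.of fun i k => (if i = k then (freqSq p k : ℂ) else 0) + L2Z.conv a i (invVec X k)

theorem invMap_apply (X : modes p n → L2Z) (b : modes p n → ℂ) (j : ℤ) :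
    invMap X b j = ∑ k, b k * invVec X k j := by
  rw [invMap, Fintype.linearCombination_apply, L2Z.sum_apply]
  rfl

theorem conv_invMap (a : L2Z) (X : modes p n → L2Z) (b : modes p n → ℂ) (j : ℤ) :
    L2Z.conv a j (invMap X b) = ∑ k, b k * L2Z.conv a j (invVec X k) := by
  rw [invMap, Fintype.linearCombination_apply, map_sum]
  simp

theorem fixed_apply_of_mem {a : L2Z} {X : modes p n → L2Z} (hX : ricc a X = X)
    (hn : 1 ≤ n) (k : modes p n) {j : ℤ} (hj : j ∈ modes p n) : X k j = 0 := by
  rw [← hX, ricc_apply, hiResL_apply hn, hiRes, if_pos hj]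
  · simp
  · exact (freqSq_lt_cut k.2).le

theorem invVec_apply_of_mem {a : L2Z} {X : modes p n → L2Z} (hX : ricc a X = X)
    (hn : 1 ≤ n) (k i : modes p n) :
    invVec X k i = if i = k then 1 else 0 := by
  rw [invVec, L2Z.add_apply, fixed_apply_of_mem hX hn k i.2, add_zero, L2Z.unit_apply]
  exact if_congr Subtype.coe_inj rfl rfl

theorem invMap_apply_of_mem {a : L2Z} {X : modes p n → L2Z} (hX : ricc a X = X)
    (hn : 1 ≤ n) (b : modes p n → ℂ) (i : modes p n) : invMap X b i = b i := by
  rw [invMap_apply]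
  simp only [invVec_apply_of_mem hX hn, mul_ite, mul_one, mul_zero, Finset.sum_ite_eq,
    Finset.mem_univ, if_true]

theorem invVec_apply_of_notMem (X : modes p n → L2Z) (k : modes p n) {j : ℤ} (hj : j ∉ modes p n) :
    invVec X k j = X k j := by
  rw [invVec, L2Z.add_apply, L2Z.unit_apply, if_neg, zero_add]
  rintro rfl
  exact hj k.2

theorem fixed_eq {a : L2Z} {X : modes p n → L2Z} (hX : ricc a X = X)
    (hn : 1 ≤ n) (k : modes p n) {j : ℤ} (hj : j ∉ modes p n) :
    (freqSq p j - freqSq p k : ℂ) * X k j = -(L2Z.conv a j (invVec X k) -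
      ∑ i : modes p n, L2Z.conv a i (invVec X k) * X i j) := by
  have hr : ((freqSq p k : ℝ) : ℂ).re ≤ cut n := (freqSq_lt_cut k.2).le
  conv_lhs => rw [← hX, ricc_apply, hiResL_apply hn hr]
  rw [mul_neg, ← mul_assoc, mul_comm (_ - _), hiRes_mul hn hr hj, one_mul]
  rfl

/-- In the low coordinates the `e_i + X_i` are unit vectors and the identity is the definition of
the matrix; in the high ones it is the Riccati equation. -/
theorem invVec_eq {a : L2Z} {X : modes p n → L2Z} (hX : ricc a X = X)
    (hn : 1 ≤ n) (k : modes p n) (j : ℤ) :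
    (freqSq p j : ℂ) * invVec X k j + L2Z.conv a j (invVec X k) =
      ∑ i : modes p n, invMat a X i k * invVec X i j := by
  simp only [invMat, Matrix.of_apply, add_mul, Finset.sum_add_distrib, ite_mul, zero_mul,
    Finset.sum_ite_eq', Finset.mem_univ, if_true]
  by_cases hj : j ∈ modes p n
  · have e : ∀ i, invVec X i j = if (⟨j, hj⟩ : modes p n) = i then 1 else 0 := fun i =>
      invVec_apply_of_mem hX hn i ⟨j, hj⟩
    simp only [e, mul_ite, mul_one, mul_zero, Finset.sum_ite_eq, Finset.mem_univ, if_true]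
    split_ifs with h
    · rw [← h]
    · rfl
  · have h := fixed_eq hX hn k hj
    simp only [invVec_apply_of_notMem X _ hj]
    linear_combination h

theorem invMap_eq {a : L2Z} {X : modes p n → L2Z} (hX : ricc a X = X)
    (hn : 1 ≤ n) (b : modes p n → ℂ) (j : ℤ) :
    (freqSq p j : ℂ) * invMap X b j + L2Z.conv a j (invMap X b) =
      invMap X ((invMat a X).mulVec b) j := by
  rw [invMap_apply, invMap_apply, conv_invMap, Finset.mul_sum, ← Finset.sum_add_distrib]
  have e : ∀ k, (freqSq p j : ℂ) * (b k * invVec X k j) + b k * L2Z.conv a j (invVec X k) =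
      ∑ i : modes p n, invMat a X i k * b k * invVec X i j := fun k => by
    have h := invVec_eq hX hn k j
    rw [show (freqSq p j : ℂ) * (b k * invVec X k j) + b k * L2Z.conv a j (invVec X k) =
      b k * ((freqSq p j : ℂ) * invVec X k j + L2Z.conv a j (invVec X k)) by ring, h,
      Finset.mul_sum]
    exact Finset.sum_congr rfl fun i _ => by ring
  rw [Finset.sum_congr rfl fun k _ => e k, Finset.sum_comm]
  refine Finset.sum_congr rfl fun i _ => ?_
  rw [Matrix.mulVec, dotProduct, Finset.sum_mul]

theorem invMap_injective {a : L2Z} {X : modes p n → L2Z} (hX : ricc a X = X)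
    (hn : 1 ≤ n) : Function.Injective (invMap X) := fun b c h => by
  funext i
  rw [← invMap_apply_of_mem hX hn b i, ← invMap_apply_of_mem hX hn c i, h]

/-- The invariant subspace contains all solutions for spectral parameters to the left of `cut n`. -/
theorem exists_eq_invMap {a : L2Z} {X : modes p n → L2Z} (hX : ricc a X = X)
    (hn : 1 ≤ n) (hL : IsLarge n ‖a‖) (hXn : ‖X‖ ≤ 2 * ‖a‖ / n) {mu : ℂ}
    (hmu : mu.re ≤ cut n) {u : L2Z} {g : modes p n → ℂ}
    (hu : ∀ j, (freqSq p j : ℂ) * u j + L2Z.conv a j u = mu * u j + invMap X g j) :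
    ∃ b, u = invMap X b ∧ (invMat a X).mulVec b = mu • b + g := by
  have hn' : (0 : ℝ) < n := by exact_mod_cast hn
  set b : modes p n → ℂ := fun i => u i with hb
  -- `b` consists of the low coordinates of `u`, so that `z` has only high ones; the claim is `z =
  -- 0`.
  obtain ⟨z, hz⟩ : ∃ z, z = u - invMap X b := ⟨_, rfl⟩
  have hzm : ∀ i : modes p n, z i = 0 := fun i => by
    rw [hz, L2Z.sub_apply, invMap_apply_of_mem hX hn]; exact sub_self _
  have hu' : u = z + invMap X b := by rw [hz]; abel
  have hzeq : ∀ j, (freqSq p j : ℂ) * z j + L2Z.conv a j z =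
      mu * z j + invMap X (mu • b + g - (invMat a X).mulVec b) j := fun j => by
    have h1 := hu j
    rw [hu'] at h1
    have h2 := invMap_eq hX hn b j
    rw [map_add, L2Z.add_apply] at h1
    rw [map_sub, map_add, map_smul, L2Z.sub_apply, L2Z.add_apply, L2Z.smul_apply]
    linear_combination h1 - h2
  have hin : ∀ i : modes p n, (mu • b + g - (invMat a X).mulVec b) i = L2Z.conv a i z := fun i => by
    have h := hzeq i
    rw [hzm, invMap_apply_of_mem hX hn] at h
    linear_combination -h
  set Λ := hiResL p n mu
  have hΛ : ‖Λ‖ ≤ 1 / n := norm_hiResL_le _ _ _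
  -- By `hin` the low coordinates of `a * z` are the coefficients of the inhomogeneity, so the high
  -- coordinates are a homogeneous linear equation for `z` with operator norm at most `‖a‖/n +
  -- 2‖a‖²/n ≤ 1/9`.
  have hze : z = -(L2Z.mulBdd Λ (fun j => L2Z.conv a j z) _ (L2Z.norm_conv_le a · z) -
      ∑ i : modes p n, L2Z.conv a i z • L2Z.diag Λ (X i)) := by
    refine L2Z.ext_iff'.2 fun j => ?_
    rw [L2Z.neg_apply, L2Z.sub_apply, L2Z.sum_apply, L2Z.mulBdd_apply]
    simp only [L2Z.smul_apply, L2Z.diag_apply]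
    rw [hiResL_apply hn hmu]
    by_cases hj : j ∈ modes p n
    · rw [hzm ⟨j, hj⟩, hiRes, if_pos hj]; simp
    · have h := hzeq j
      rw [invMap_apply] at h
      simp only [hin, invVec_apply_of_notMem X _ hj] at h
      have e : ∑ i : modes p n, L2Z.conv a i z * (hiRes p n mu j * X i j) =
          hiRes p n mu j * ∑ i : modes p n, L2Z.conv a i z * X i j := by
        rw [Finset.mul_sum]; exact Finset.sum_congr rfl fun i _ => by ring
      rw [e]
      linear_combination hiRes p n mu j * h - z j * hiRes_mul hn hmu hj
  have hcard : (Fintype.card (modes p n) : ℝ) ≤ n := by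
    rw [Fintype.card_coe]; exact_mod_cast card_modes_le p n
  have hzn : ‖z‖ ≤ 1 / n * (‖a‖ * ‖z‖) + n * (‖a‖ * ‖z‖ * (1 / n * (2 * ‖a‖ / n))) := by
    conv_lhs => rw [hze]
    rw [norm_neg]
    refine (norm_sub_le _ _).trans (add_le_add ?_ ?_)
    · exact (L2Z.norm_mulBdd_le _ _ _ _).trans (by gcongr)
    · refine (norm_sum_le_of_le _ (f := fun i : modes p n => L2Z.conv a i z • L2Z.diag Λ (X i))
        (n := fun _ => ‖a‖ * ‖z‖ * (1 / n * (2 * ‖a‖ / n))) fun i _ => ?_).trans ?_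
      · rw [norm_smul]
        refine mul_le_mul (L2Z.norm_conv_le _ _ _) ?_ (norm_nonneg _) (by positivity)
        exact (L2Z.norm_diag_le _ _).trans
          (mul_le_mul hΛ ((norm_le_pi_norm X i).trans hXn) (norm_nonneg _) (by positivity))
      · rw [Finset.sum_const, Finset.card_univ, nsmul_eq_mul]
        gcongr
  have hz0 : z = 0 := by
    have e : 1 / n * (‖a‖ * ‖z‖) + n * (‖a‖ * ‖z‖ * (1 / n * (2 * ‖a‖ / n))) =
        (‖a‖ / n + 2 * ‖a‖ ^ 2 / n) * ‖z‖ := by field_simp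
    rw [e] at hzn
    have h1 : ‖a‖ / n + 2 * ‖a‖ ^ 2 / n ≤ 1 / 9 := by
      have := hL.bound
      have h2 : 2 * ‖a‖ ^ 2 / n ≤ 4 * ‖a‖ ^ 2 / n := by gcongr; norm_num
      linarith
    have h3 := mul_le_mul_of_nonneg_right h1 (norm_nonneg z)
    rw [← norm_le_zero_iff]
    linarith [norm_nonneg z]
  refine ⟨b, by rw [hu', hz0, zero_add], ?_⟩
  funext i
  have h := hin i
  rw [hz0, map_zero, Pi.sub_apply] at h
  exact (sub_eq_zero.1 h).symm

end

/-! ### Continuity of the roots of characteristic polynomials -/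

section

open Filter Topology Polynomial

/-- An eigenvector is compared with its image in the maximum norm. The bound is crude but continuous
in `M`, so the roots along a compact path stay in a compact set. -/
theorem Matrix.norm_le_of_isRoot_charpoly {ι : Type*} [Fintype ι] [DecidableEq ι]
    (M : Matrix ι ι ℂ) {mu : ℂ} (h : M.charpoly.IsRoot mu) : ‖mu‖ ≤ ∑ i, ∑ j, ‖M i j‖ := by
  rw [IsRoot.def, Matrix.eval_charpoly, ← Matrix.exists_mulVec_eq_zero_iff] at h
  obtain ⟨v, hv0, hv⟩ := h
  have hmv : ∀ i, mu * v i = ∑ j, M i j * v j := fun i => by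
    have := congrFun hv i
    rw [Matrix.sub_mulVec, Matrix.scalar_apply, Pi.sub_apply, Matrix.mulVec_diagonal,
      Pi.zero_apply, sub_eq_zero] at this
    exact this
  have h1 : ‖mu • v‖ ≤ (∑ i, ∑ j, ‖M i j‖) * ‖v‖ := by
    refine (pi_norm_le_iff_of_nonneg (by positivity)).2 fun i => ?_
    rw [Pi.smul_apply, smul_eq_mul, hmv]
    calc _ ≤ ∑ j, ‖M i j‖ * ‖v‖ := by
          refine norm_sum_le_of_le _ fun j _ => ?_
          rw [norm_mul]
          exact mul_le_mul_of_nonneg_left (norm_le_pi_norm v j) (norm_nonneg _)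
      _ ≤ _ := by
          rw [← Finset.sum_mul]
          refine mul_le_mul_of_nonneg_right ?_ (norm_nonneg _)
          exact Finset.single_le_sum (f := fun i => ∑ j, ‖M i j‖)
            (fun i _ => Finset.sum_nonneg fun j _ => norm_nonneg _) (Finset.mem_univ i)
  rw [norm_smul] at h1
  exact le_of_mul_le_mul_right h1 (norm_pos_iff.2 hv0)

theorem Multiset.exists_eq_map_univ {α : Type*} (s : Multiset α) {d : ℕ} (h : s.card = d) :
    ∃ z : Fin d → α, s = Finset.univ.val.map z := by
  subst h
  induction s using Quotient.inductionOn with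
  | _ l => exact ⟨l.get, ((Fin.univ_val_map l.get).trans (by rw [List.ofFn_get]; rfl)).symm⟩

theorem Matrix.charpoly_roots_card {ι : Type*} [Fintype ι] [DecidableEq ι] (M : Matrix ι ι ℂ) :
    M.charpoly.roots.card = Fintype.card ι := by
  rw [IsAlgClosed.card_roots_eq_natDegree, Matrix.charpoly_natDegree_eq_dim]

theorem Matrix.eval_charpoly_eq_prod {ι : Type*} [Fintype ι] [DecidableEq ι] {M : Matrix ι ι ℂ}
    {d : ℕ} {z : Fin d → ℂ} (h : M.charpoly.roots = Finset.univ.val.map z) (x : ℂ) :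
    M.charpoly.eval x = ∏ i, (x - z i) := by
  have h1 := prod_multiset_X_sub_C_of_monic_of_roots_card_eq (Matrix.charpoly_monic M)
    (IsAlgClosed.card_roots_eq_natDegree)
  rw [h, Multiset.map_map] at h1
  rw [← h1]
  change eval x (∏ i, (X - C (z i))) = _
  rw [eval_prod]
  simp

/-- The number of eigenvalues in a half plane does not change along a continuous path of matrices, as
long as no eigenvalue crosses the boundary. -/
theorem Matrix.card_roots_re_lt_eq {ι : Type*} [Fintype ι] [DecidableEq ι]
    {B : ℝ → Matrix ι ι ℂ} (hB : ContinuousOn B (Set.Icc 0 1)) (c : ℝ)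
    (h : ∀ t ∈ Set.Icc (0 : ℝ) 1, ∀ mu, (B t).charpoly.IsRoot mu → mu.re ≠ c) :
    ((B 0).charpoly.roots.filter fun z => z.re < c).card =
      ((B 1).charpoly.roots.filter fun z => z.re < c).card := by
  set d := Fintype.card ι
  have hz : ∀ t, ∃ z : Fin d → ℂ, (B t).charpoly.roots = Finset.univ.val.map z := fun t =>
    Multiset.exists_eq_map_univ _ (Matrix.charpoly_roots_card _)
  choose z hz using hz
  set N : ℝ → ℕ := fun t => ((B t).charpoly.roots.filter fun z => z.re < c).card
  have hroot : ∀ t i, (B t).charpoly.IsRoot (z t i) := fun t i => by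
    refine (mem_roots (Matrix.charpoly_monic (B t)).ne_zero).1 ?_
    rw [hz]
    exact Multiset.mem_map_of_mem _ (Finset.mem_univ i)
  have hsum : ContinuousOn (fun t => ∑ i, ∑ j, ‖B t i j‖) (Set.Icc 0 1) := by
    refine continuousOn_finsetSum _ fun i _ => continuousOn_finsetSum _ fun j _ => ?_
    exact (((continuous_apply j).comp (continuous_apply i)).comp_continuousOn hB).norm
  obtain ⟨R, hR⟩ := isCompact_Icc.bddAbove_image hsum
  have hzR : ∀ t ∈ Set.Icc (0 : ℝ) 1, z t ∈ Metric.closedBall (0 : Fin d → ℂ) (max R 0) := by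
    intro t ht
    rw [mem_closedBall_zero_iff, pi_norm_le_iff_of_nonneg (le_max_right _ _)]
    exact fun i => ((Matrix.norm_le_of_isRoot_charpoly _ (hroot t i)).trans
      (hR (Set.mem_image_of_mem _ ht))).trans (le_max_left _ _)
  have hNcont : ContinuousOn N (Set.Icc 0 1) := by
    intro t0 ht0
    rw [ContinuousWithinAt, nhds_discrete, tendsto_pure]
    -- Otherwise the count differs from that at `t0` along a sequence tending to `t0`; by
    -- compactness the enumerated roots converge along a subsequence.
    by_contra hne
    obtain ⟨t, htend, ht⟩ := exists_seq_forall_of_frequently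
      ((not_eventually.1 hne).and_eventually self_mem_nhdsWithin)
    obtain ⟨y, -, φ, hφ, hy⟩ := (isCompact_closedBall (0 : Fin d → ℂ) (max R 0)).tendsto_subseq
      (x := fun k => z (t k)) fun k => hzR _ (ht k).2
    have hBt : Tendsto (fun k => B (t (φ k))) atTop (𝓝 (B t0)) :=
      (hB t0 ht0).tendsto.comp (htend.comp hφ.tendsto_atTop)
    have hyi : ∀ i, Tendsto (fun k => z (t (φ k)) i) atTop (𝓝 (y i)) := fun i =>
      ((continuous_apply i).tendsto y).comp hy
    -- Passing to the limit in the factorized polynomial identifies the limits `y i` as the roots at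
    -- `t0`, with multiplicities.
    have heval : ∀ x, (B t0).charpoly.eval x = ∏ i, (x - y i) := fun x => by
      have h1 : Tendsto (fun k => (B (t (φ k))).charpoly.eval x) atTop
          (𝓝 ((B t0).charpoly.eval x)) := by
        simp only [Matrix.eval_charpoly]
        have hc : Continuous fun M : Matrix ι ι ℂ => (Matrix.scalar ι x - M).det :=
          (continuous_const.sub continuous_id).matrix_det
        exact (hc.tendsto (B t0)).comp hBt
      have h2 : Tendsto (fun k => (B (t (φ k))).charpoly.eval x) atTop (𝓝 (∏ i, (x - y i))) := by
        simp only [Matrix.eval_charpoly_eq_prod (hz _)]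
        exact tendsto_finsetProd _ fun i _ => tendsto_const_nhds.sub (hyi i)
      exact tendsto_nhds_unique h1 h2
    have hpoly : (B t0).charpoly = (Multiset.map (fun a => X - C a) (Finset.univ.val.map y)).prod := by
      refine Polynomial.funext fun x => ?_
      rw [heval, Multiset.map_map]
      change _ = eval x (∏ i, (X - C (y i)))
      rw [eval_prod]
      simp
    have hroots : (B t0).charpoly.roots = Finset.univ.val.map y := by
      rw [hpoly, roots_multiset_prod_X_sub_C]
    have hyc : ∀ i, (y i).re ≠ c := fun i => by
      refine h t0 ht0 _ ((mem_roots (Matrix.charpoly_monic _).ne_zero).1 ?_)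
      rw [hroots]
      exact Multiset.mem_map_of_mem _ (Finset.mem_univ i)
    have hev : ∀ i, ∀ᶠ k in atTop, ((z (t (φ k)) i).re < c ↔ (y i).re < c) := fun i => by
      have hre : Tendsto (fun k => (z (t (φ k)) i).re) atTop (𝓝 (y i).re) :=
        (Complex.continuous_re.tendsto _).comp (hyi i)
      rcases lt_or_gt_of_ne (hyc i) with hlt | hgt
      · filter_upwards [hre.eventually_lt_const hlt] with k hk
        exact ⟨fun _ => hlt, fun _ => hk⟩
      · filter_upwards [hre.eventually_const_lt hgt] with k hk
        exact ⟨fun h => absurd h hk.not_gt, fun h => absurd h (not_lt.2 hgt.le)⟩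
    obtain ⟨k, hk⟩ := (eventually_all.2 hev).exists
    apply (ht (φ k)).1
    change Multiset.card _ = Multiset.card _
    rw [hz (t (φ k)), hroots, Multiset.filter_map, Multiset.filter_map, Multiset.card_map,
      Multiset.card_map]
    congr 1
    refine Multiset.filter_congr fun i _ => ?_
    exact hk i
  exact isPreconnected_Icc.constant hNcont (by norm_num) (by norm_num)

end

/-! ### Counting eigenvalues by deforming the potential to zero -/

section

variable {n : ℕ}

open Classical in
/-- The fixed point of `ricc`, as a function of the potential. -/
def riccSol (p : ℤ) (n : ℕ) (a : L2Z) : modes p n → L2Z :=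
  if h : IsLarge n ‖a‖ then (exists_fixed_ricc h p).choose else 0

theorem riccSol_spec {a : L2Z} (h : IsLarge n ‖a‖) (p : ℤ) :
    ricc a (riccSol p n a) = riccSol p n a ∧ ‖riccSol p n a‖ ≤ 2 * ‖a‖ / n := by
  rw [riccSol, dif_pos h]
  exact (exists_fixed_ricc h p).choose_spec

theorem IsLarge.mono {β γ : ℝ} (h : IsLarge n β) (h0 : 0 ≤ γ) (hγ : γ ≤ β) : IsLarge n γ :=
  ⟨h0, le_trans (by gcongr) h.2⟩

theorem norm_smul_le_of_mem_Icc {t : ℝ} (ht : t ∈ Set.Icc (0 : ℝ) 1) (a : L2Z) :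
    ‖(t : ℂ) • a‖ ≤ ‖a‖ := by
  rw [norm_smul, Complex.norm_real, Real.norm_of_nonneg ht.1]
  exact mul_le_of_le_one_left (norm_nonneg _) ht.2

theorem IsLarge.smul {a : L2Z} (h : IsLarge n ‖a‖) {t : ℝ} (ht : t ∈ Set.Icc (0 : ℝ) 1) :
    IsLarge n ‖(t : ℂ) • a‖ :=
  h.mono (norm_nonneg _) (norm_smul_le_of_mem_Icc ht a)

/-- `ricc` is linear in the potential, so the difference of the fixed points is `t` times a
difference contracted by `1/2`, plus `(t - s) ricc a Y`. Hence the chosen fixed points depend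
continuously on `t`. -/
theorem norm_riccSol_smul_sub_le {a : L2Z} (h : IsLarge n ‖a‖) (p : ℤ) {s t : ℝ}
    (hs : s ∈ Set.Icc (0 : ℝ) 1) (ht : t ∈ Set.Icc (0 : ℝ) 1) :
    ‖riccSol p n ((t : ℂ) • a) - riccSol p n ((s : ℂ) • a)‖ ≤ 4 * ‖a‖ / n * ‖t - s‖ := by
  obtain ⟨t1, t2⟩ := riccSol_spec (h.smul ht) p
  obtain ⟨s1, s2⟩ := riccSol_spec (h.smul hs) p
  set X := riccSol p n ((t : ℂ) • a)
  set Y := riccSol p n ((s : ℂ) • a)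
  have hX : ‖X‖ ≤ 2 * ‖a‖ / n := t2.trans (by gcongr; exact norm_smul_le_of_mem_Icc ht a)
  have hY : ‖Y‖ ≤ 2 * ‖a‖ / n := s2.trans (by gcongr; exact norm_smul_le_of_mem_Icc hs a)
  rw [ricc_smul] at t1 s1
  have e : X - Y = (t : ℂ) • (ricc a X - ricc a Y) + ((t - s : ℝ) : ℂ) • ricc a Y := by
    conv_lhs => rw [← t1, ← s1]
    push_cast
    module
  have h1 : ‖X - Y‖ ≤ 1 / 2 * ‖X - Y‖ + ‖t - s‖ * (2 * ‖a‖ / n) := by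
    conv_lhs => rw [e]
    refine (norm_add_le _ _).trans (add_le_add ?_ ?_)
    · rw [norm_smul, Complex.norm_real, Real.norm_of_nonneg ht.1]
      exact (mul_le_of_le_one_left (norm_nonneg _) ht.2).trans (norm_ricc_sub_le h hX hY)
    · rw [norm_smul, Complex.norm_real]
      exact mul_le_mul_of_nonneg_left (norm_ricc_le h hY) (norm_nonneg _)
  have e2 : 4 * ‖a‖ / n * ‖t - s‖ = 2 * (‖t - s‖ * (2 * ‖a‖ / n)) := by ring
  linarith

theorem continuousOn_invMat {a : L2Z} (h : IsLarge n ‖a‖) (p : ℤ) :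
    ContinuousOn (fun t : ℝ => invMat ((t : ℂ) • a) (riccSol p n ((t : ℂ) • a)))
      (Set.Icc 0 1) := by
  have hX : ContinuousOn (fun t : ℝ => riccSol p n ((t : ℂ) • a)) (Set.Icc 0 1) := by
    refine (LipschitzOnWith.of_dist_le_mul (K := ⟨4 * ‖a‖ / n, by positivity⟩)
      fun t ht s hs => ?_).continuousOn
    rw [dist_eq_norm, dist_eq_norm]
    exact norm_riccSol_smul_sub_le h p hs ht
  refine continuousOn_pi.2 fun i => continuousOn_pi.2 fun k => ?_
  simp only [invMat, Matrix.of_apply, L2Z.conv_smul]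
  refine continuousOn_const.add (Complex.continuous_ofReal.continuousOn.mul ?_)
  refine (L2Z.conv a i).continuous.comp_continuousOn ?_
  exact continuousOn_const.add ((continuous_apply k).comp_continuousOn hX)

/-- Roots of the characteristic polynomial of the matrix on the invariant subspace are eigenvalues. -/
theorem exists_isEigSeq_of_isRoot {a : L2Z} {p : ℤ} {X : modes p n → L2Z} (hX : ricc a X = X)
    (hn : 1 ≤ n) {mu : ℂ} (h : (invMat a X).charpoly.IsRoot mu) :
    ∃ u, u ≠ 0 ∧ IsEigSeq a p mu u := by
  rw [Polynomial.IsRoot.def, Matrix.eval_charpoly, ← Matrix.exists_mulVec_eq_zero_iff] at h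
  obtain ⟨v, hv0, hv⟩ := h
  rw [Matrix.sub_mulVec, sub_eq_zero] at hv
  have hv' : (invMat a X).mulVec v = mu • v := by
    rw [← hv]; funext i
    rw [Matrix.scalar_apply, Matrix.mulVec_diagonal]; rfl
  refine ⟨invMap X v, fun h0 => hv0 (invMap_injective hX hn (h0.trans (map_zero _).symm)),
    fun j => ?_⟩
  rw [invMap_eq hX hn, hv', map_smul, L2Z.smul_apply]

/-- The number of eigenvalues to the left of `cut m` is the number of modes of frequency less
than `m`. -/
theorem card_roots_invMat {a : L2Z} (h : IsLarge n ‖a‖) (p : ℤ) {m : ℕ} (hm : 1 ≤ m) (hmn : m ≤ n)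
    (ha : ‖a‖ ≤ m / 4) :
    ((invMat a (riccSol p n a)).charpoly.roots.filter fun z => z.re < cut m).card =
      (modes p m).card := by
  have hn : 1 ≤ n := h.one_le
  have key := Matrix.card_roots_re_lt_eq (continuousOn_invMat h p) (cut m) fun t ht mu hmu => by
    obtain ⟨u, hu0, hu⟩ := exists_isEigSeq_of_isRoot (riccSol_spec (h.smul ht) p).1 hn hmu
    exact hu.re_ne_cut hu0 hm ((norm_smul_le_of_mem_Icc ht a).trans ha)
  -- At `t = 0` the matrix is diagonal, with the free eigenvalues as entries.
  have e0 : invMat (((0 : ℝ) : ℂ) • a) (riccSol p n (((0 : ℝ) : ℂ) • a)) =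
      Matrix.diagonal fun k : modes p n => (freqSq p k : ℂ) := by
    ext i k
    rw [invMat, Matrix.of_apply, L2Z.conv_smul, Complex.ofReal_zero, zero_mul, add_zero,
      Matrix.diagonal_apply]
    by_cases hik : i = k
    · rw [if_pos hik, if_pos hik, hik]
    · rw [if_neg hik, if_neg hik]
  rw [Complex.ofReal_one, one_smul] at key
  rw [← key, e0, Matrix.charpoly_diagonal]
  rw [show (∏ i : modes p n, (Polynomial.X - Polynomial.C (freqSq p i : ℂ))) =
    (Multiset.map (fun a => Polynomial.X - Polynomial.C a)
      (Finset.univ.val.map fun k : modes p n => (freqSq p k : ℂ))).prod by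
      rw [Multiset.map_map]; rfl, Polynomial.roots_multiset_prod_X_sub_C, Multiset.filter_map,
    Multiset.card_map]
  have hlt : ∀ j : ℤ, freqSq p j < cut m ↔ j ∈ modes p m := fun j =>
    ⟨fun h => by_contra fun hj => (cut_lt_freqSq hm hj).not_gt h, freqSq_lt_cut⟩
  change (Finset.univ.filter fun k : modes p n => ((freqSq p k : ℝ) : ℂ).re < cut m).card = _
  simp only [Complex.ofReal_re, hlt]
  rw [← Finset.card_map (Function.Embedding.subtype _)]
  congr 1
  ext j
  simp only [Finset.mem_map, Finset.mem_filter, Finset.mem_univ, true_and,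
    Function.Embedding.subtype_apply, Subtype.exists, exists_and_right, exists_eq_right]
  refine ⟨fun h => ?_, fun h => ⟨?_, h⟩⟩
  · obtain ⟨_, h⟩ := h; exact h
  · rw [mem_modes] at h ⊢; omega

end

/-! ### Fourier modes of quasiperiodic functions -/

/-- The exponential `exp (π i k x)`, of period `2`. -/
def expMode (k : ℤ) (x : ℝ) : ℂ := Complex.exp (Real.pi * k * Complex.I * x)

theorem expMode_add (k l : ℤ) (x : ℝ) : expMode (k + l) x = expMode k x * expMode l x := by
  rw [expMode, expMode, expMode, ← Complex.exp_add]
  congr 1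
  push_cast
  ring

theorem expMode_zero (x : ℝ) : expMode 0 x = 1 := by simp [expMode]

theorem expMode_apply_zero (k : ℤ) : expMode k 0 = 1 := by simp [expMode]

theorem expMode_neg_mul (k : ℤ) (x : ℝ) : expMode (-k) x * expMode k x = 1 := by
  rw [← expMode_add, neg_add_cancel, expMode_zero]

theorem expMode_mul_neg (k : ℤ) (x : ℝ) : expMode k x * expMode (-k) x = 1 := by
  rw [mul_comm, expMode_neg_mul]

theorem norm_expMode (k : ℤ) (x : ℝ) : ‖expMode k x‖ = 1 := by
  rw [expMode, show (Real.pi * k * Complex.I * x : ℂ) = ((Real.pi * k * x : ℝ) : ℂ) * Complex.I by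
    push_cast; ring, Complex.norm_exp_ofReal_mul_I]

theorem conj_expMode (k : ℤ) (x : ℝ) : (starRingEnd ℂ) (expMode k x) = expMode (-k) x := by
  rw [expMode, expMode, ← Complex.exp_conj]
  congr 1
  simp

theorem hasDerivAt_expMode (k : ℤ) (x : ℝ) :
    HasDerivAt (expMode k) (Real.pi * k * Complex.I * expMode k x) x := by
  have h : HasDerivAt (fun x : ℝ => (Real.pi * k * Complex.I * x : ℂ))
      (Real.pi * k * Complex.I) x := by
    simpa using (Complex.ofRealCLM.hasDerivAt (x := x)).const_mul (Real.pi * k * Complex.I : ℂ)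
  have := h.cexp
  rwa [mul_comm (Complex.exp _)] at this

theorem continuous_expMode (k : ℤ) : Continuous (expMode k) :=
  continuous_iff_continuousAt.2 fun x => (hasDerivAt_expMode k x).continuousAt

theorem expMode_even_one (j : ℤ) : expMode (2 * j) 1 = 1 := by
  rw [expMode, Complex.exp_eq_one_iff]
  exact ⟨j, by push_cast; ring⟩

/-- All modes `2j + p` share one multiplier, `expMode p 1`, which is `1` for `p = 0` and `-1` for `p
= 1`. -/
theorem expMode_one (p j : ℤ) : expMode (2 * j + p) 1 = expMode p 1 := by
  rw [expMode_add, expMode_even_one, one_mul]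

theorem expMode_add_one (k : ℤ) (x : ℝ) : expMode k (x + 1) = expMode k 1 * expMode k x := by
  rw [expMode, expMode, expMode, ← Complex.exp_add]
  congr 1
  push_cast
  ring

theorem expMode_neg_one_one (k : ℤ) : expMode (-k) 1 = (expMode k 1)⁻¹ :=
  eq_inv_of_mul_eq_one_left (expMode_neg_mul k 1)

theorem expMode_ne_zero (k : ℤ) (x : ℝ) : expMode k x ≠ 0 := Complex.exp_ne_zero _

theorem fourier_eq_expMode (j : ℤ) (x : ℝ) :
    fourier j (x : UnitAddCircle) = expMode (2 * j) x := by
  rw [fourier_coe_apply, expMode]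
  congr 1
  push_cast
  ring

/-- The coefficient of a function on `[0,1]` at `exp (π i k x)`. -/
def modeCoeff (f : ℝ → ℂ) (k : ℤ) : ℂ := ∫ x in (0 : ℝ)..1, f x * expMode (-k) x

/-- Square integrability on `[0,1]`. -/
abbrev MemL2 (f : ℝ → ℂ) : Prop := MemLp f 2 (volume.restrict (Set.Ioc 0 1))

theorem MemL2.mul_expMode {f : ℝ → ℂ} (hf : MemL2 f) (k : ℤ) :
    MemL2 fun x => f x * expMode k x := by
  refine hf.of_le (hf.1.mul (continuous_expMode k).aestronglyMeasurable)
    (Filter.Eventually.of_forall fun x => ?_)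
  rw [norm_mul, norm_expMode, mul_one]

theorem MemL2.conj {f : ℝ → ℂ} (hf : MemL2 f) : MemL2 fun x => (starRingEnd ℂ) (f x) := hf.star

theorem MemL2.mul_bounded {f g : ℝ → ℂ} (hf : MemL2 f) (hg : Continuous g) {C : ℝ}
    (hC : ∀ x, ‖g x‖ ≤ C) : MemL2 fun x => f x * g x := by
  refine hf.of_le_mul (c := C) (hf.1.mul hg.aestronglyMeasurable)
    (Filter.Eventually.of_forall fun x => ?_)
  rw [norm_mul, mul_comm]
  exact mul_le_mul_of_nonneg_right (hC x) (norm_nonneg _)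

theorem Continuous.memL2 {f : ℝ → ℂ} (hf : Continuous f) : MemL2 f := by
  obtain ⟨C, hC⟩ := isCompact_Icc.exists_bound_of_continuousOn (s := Set.Icc (0 : ℝ) 1)
    hf.continuousOn
  refine MemLp.of_bound hf.aestronglyMeasurable C ?_
  exact (ae_restrict_iff' measurableSet_Ioc).2
    (Filter.Eventually.of_forall fun x hx => hC x (Set.Ioc_subset_Icc_self hx))

theorem MemL2.intervalIntegrable {f : ℝ → ℂ} (hf : MemL2 f) :
    IntervalIntegrable f volume 0 1 :=
  (intervalIntegrable_iff_integrableOn_Ioc_of_le zero_le_one).2 (hf.integrable (by norm_num))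

/-- A square integrable function on `[0,1]` as an element of `L²` of the circle. -/
def circleLp (f : ℝ → ℂ) (hf : MemL2 f) : L2Circle :=
  MemLp.toLp (liftIoc 1 0 f) (MemLp.memLp_liftIoc (t := 0) (by simpa using hf)).haarAddCircle

theorem fourierCoeff_circleLp (f : ℝ → ℂ) (hf : MemL2 f) (j : ℤ) :
    fourierCoeff (circleLp f hf) j = modeCoeff f (2 * j) := by
  rw [circleLp, fourierCoeff_congr_ae (MemLp.coeFn_toLp _), fourierCoeff_eq_intervalIntegral _ _ 0,
    modeCoeff, zero_add, div_one, one_smul]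
  refine intervalIntegral.integral_congr_ae (ae_of_all _ fun x hx => ?_)
  rw [Set.uIoc_of_le zero_le_one] at hx
  rw [liftIoc_coe_apply (by simpa using hx), fourier_eq_expMode, smul_eq_mul, mul_comm, mul_neg]

theorem summable_modeCoeff_sq {f : ℝ → ℂ} (hf : MemL2 f) (p : ℤ) :
    Summable fun j : ℤ => ‖modeCoeff f (2 * j + p)‖ ^ 2 := by
  have h := (hasSum_sq_fourierCoeff (circleLp _ (hf.mul_expMode (-p)))).summable
  refine h.congr fun j => ?_
  rw [fourierCoeff_circleLp, modeCoeff, modeCoeff]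
  congr 3
  funext x
  rw [mul_assoc, ← expMode_add]
  congr 2; ring

/-- The coefficients at the modes `2j+p` as an element of `ℓ²`. -/
def modeCoeffs (f : ℝ → ℂ) (hf : MemL2 f) (p : ℤ) : L2Z := L2Z.mk _ (summable_modeCoeff_sq hf p)

theorem modeCoeffs_apply (f : ℝ → ℂ) (hf : MemL2 f) (p j : ℤ) :
    modeCoeffs f hf p j = modeCoeff f (2 * j + p) := rfl

/-- Parseval's identity for the conjugate of `f` and `g`; the conjugation makes the pairing
bilinear. -/
theorem hasSum_modeCoeff_mul_even {f g : ℝ → ℂ} (hf : MemL2 f) (hg : MemL2 g) :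
    HasSum (fun j : ℤ => modeCoeff f (-(2 * j)) * modeCoeff g (2 * j))
      (∫ x in (0 : ℝ)..1, f x * g x) := by
  have h := fourierBasis.hasSum_inner_mul_inner (circleLp _ hf.conj) (circleLp g hg)
  have e1 : ∀ j : ℤ, inner ℂ (circleLp _ hf.conj) (fourierBasis j) = modeCoeff f (-(2 * j)) := by
    intro j
    rw [← inner_conj_symm, ← HilbertBasis.repr_apply_apply, fourierBasis_repr,
      fourierCoeff_circleLp, modeCoeff, modeCoeff, ← intervalIntegral.intervalIntegral_conj]
    simp only [map_mul, Complex.conj_conj, conj_expMode]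
  have e2 : ∀ j : ℤ, inner ℂ (fourierBasis j) (circleLp g hg) = modeCoeff g (2 * j) := by
    intro j
    rw [← HilbertBasis.repr_apply_apply, fourierBasis_repr, fourierCoeff_circleLp]
  simp only [e1, e2] at h
  have h0 : inner ℂ (circleLp _ hf.conj) (circleLp g hg) = ∫ x in (0 : ℝ)..1, f x * g x := by
    rw [L2.inner_def]
    have h1 : ∫ x, inner ℂ (circleLp _ hf.conj x) (circleLp g hg x) ∂haarAddCircle =
        ∫ x, liftIoc 1 0 (fun x => f x * g x) x ∂(haarAddCircle : Measure UnitAddCircle) := by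
      refine integral_congr_ae ?_
      filter_upwards [MemLp.coeFn_toLp (MemLp.memLp_liftIoc (T := 1) (t := 0)
        (by simpa using hf.conj)).haarAddCircle,
        MemLp.coeFn_toLp (MemLp.memLp_liftIoc (T := 1) (t := 0) (by simpa using hg)).haarAddCircle]
        with x hx hy
      rw [circleLp, circleLp, hx, hy, RCLike.inner_apply']
      simp [liftIoc]
    rw [h1, integral_haarAddCircle, integral_liftIoc_eq_intervalIntegral]
    simp
  rw [h0] at h
  exact h

/-- Parseval's identity for the bilinear pairing `∫ f g` and the modes `2j+p`. -/
theorem hasSum_modeCoeff_mul {f g : ℝ → ℂ} (hf : MemL2 f) (hg : MemL2 g) (p : ℤ) :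
    HasSum (fun j : ℤ => modeCoeff f (-(2 * j + p)) * modeCoeff g (2 * j + p))
      (∫ x in (0 : ℝ)..1, f x * g x) := by
  have h := hasSum_modeCoeff_mul_even (hf.mul_expMode p) (hg.mul_expMode (-p))
  convert h using 1
  · funext j
    simp only [modeCoeff, mul_assoc, ← expMode_add]
    rw [show -(-(2 * j + p)) = p + -(-(2 * j)) by ring, show -(2 * j + p) = -p + -(2 * j) by ring]
  · congr 1
    funext x
    linear_combination (-f x * g x) * expMode_mul_neg p x

/-- The potential as a function on the line. -/
def potential (q : L2Circle) (x : ℝ) : ℂ := q (x : UnitAddCircle)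

theorem memL2_potential (q : L2Circle) : MemL2 (potential q) := by
  have h := (Lp.memLp q).of_haarAddCircle.comp_measurePreserving
    (AddCircle.measurePreserving_mk 1 0)
  rw [zero_add] at h
  exact h

theorem potential_periodic (q : L2Circle) (x : ℝ) : potential q (x + 1) = potential q x := by
  rw [potential, potential, AddCircle.coe_add_period]

theorem modeCoeff_potential (q : L2Circle) (j : ℤ) :
    modeCoeff (potential q) (2 * j) = fourierCoeff q j := by
  rw [fourierCoeff_eq_intervalIntegral _ _ 0, modeCoeff, zero_add, div_one, one_smul]
  refine intervalIntegral.integral_congr fun x _ => ?_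
  rw [fourier_eq_expMode, smul_eq_mul, mul_comm, mul_neg, potential]

/-- The Fourier coefficients of the potential as an element of `ℓ²`. -/
def potCoeffs (q : L2Circle) : L2Z :=
  L2Z.mk (fourierCoeff q) (hasSum_sq_fourierCoeff q).summable

theorem potCoeffs_apply (q : L2Circle) (j : ℤ) : potCoeffs q j = fourierCoeff q j := rfl

/-- The coefficients of a product with the potential are given by a convolution. -/
theorem modeCoeff_potential_mul (q : L2Circle) {f : ℝ → ℂ} (hf : MemL2 f) (p j : ℤ) :
    modeCoeff (fun x => potential q x * f x) (2 * j + p) =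
      L2Z.conv (potCoeffs q) j (modeCoeffs f hf p) := by
  have h := hasSum_modeCoeff_mul ((memL2_potential q).mul_expMode (-(2 * j + p))) hf p
  have e : ∀ l : ℤ, modeCoeff (fun x => potential q x * expMode (-(2 * j + p)) x) (-(2 * l + p)) =
      potCoeffs q (j - l) := fun l => by
    rw [potCoeffs_apply, ← modeCoeff_potential, modeCoeff, modeCoeff]
    congr 1
    funext x
    rw [mul_assoc, ← expMode_add]
    congr 2; ring
  simp only [e] at h
  rw [L2Z.conv_apply]
  refine Eq.trans ?_ h.tsum_eq.symm
  rw [modeCoeff]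
  congr 1
  funext x
  ring

/-- Integration by parts for the primitive of an integrable function. -/
theorem integral_primitive_mul {r φ φ' : ℝ → ℂ} (hr : IntervalIntegrable r volume 0 1)
    (hφ : ∀ x, HasDerivAt φ (φ' x) x) (hφ' : Continuous φ') :
    ∫ x in (0 : ℝ)..1, (∫ t in (0 : ℝ)..x, r t) * φ' x =
      (∫ t in (0 : ℝ)..1, r t) * φ 1 - ∫ t in (0 : ℝ)..1, r t * φ t := by
  have hφc : Continuous φ := continuous_iff_continuousAt.2 fun x => (hφ x).continuousAt
  set μ : Measure ℝ := volume.restrict (Set.Ioc 0 1)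
  have hrμ : Integrable r μ := (intervalIntegrable_iff_integrableOn_Ioc_of_le zero_le_one).1 hr
  have hφμ : Integrable φ' μ := hφ'.memL2.integrable (by norm_num)
  -- As `r` is only integrable, its primitive need not be differentiable everywhere; Fubini on the
  -- triangle `t ≤ x` takes the place of the usual integration by parts.
  have hint : Integrable (Function.uncurry fun x t =>
      ({z : ℝ × ℝ | z.2 ≤ z.1}.indicator (fun z => φ' z.1 * r z.2)) (x, t)) (μ.prod μ) :=
    (hφμ.mul_prod hrμ).indicator (measurableSet_le measurable_snd measurable_fst)
  have hswap := integral_integral_swap hint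
  have hl : ∀ x ∈ Set.Ioc (0 : ℝ) 1, ∫ t, ({z : ℝ × ℝ | z.2 ≤ z.1}.indicator
      (fun z => φ' z.1 * r z.2)) (x, t) ∂μ = (∫ t in (0 : ℝ)..x, r t) * φ' x := by
    intro x hx
    have e : (fun t => ({z : ℝ × ℝ | z.2 ≤ z.1}.indicator (fun z => φ' z.1 * r z.2)) (x, t)) =
        (Set.Iic x).indicator fun t => φ' x * r t := by
      funext t; simp [Set.indicator]
    rw [e, integral_indicator measurableSet_Iic, Measure.restrict_restrict measurableSet_Iic,
      Set.inter_comm, Set.Ioc_inter_Iic, min_eq_right hx.2, integral_const_mul, mul_comm,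
      intervalIntegral.integral_of_le hx.1.le]
  have hrr : ∀ t ∈ Set.Ioc (0 : ℝ) 1, ∫ x, ({z : ℝ × ℝ | z.2 ≤ z.1}.indicator
      (fun z => φ' z.1 * r z.2)) (x, t) ∂μ = r t * (φ 1 - φ t) := by
    intro t ht
    have e : (fun x => ({z : ℝ × ℝ | z.2 ≤ z.1}.indicator (fun z => φ' z.1 * r z.2)) (x, t)) =
        (Set.Ici t).indicator fun x => φ' x * r t := by
      funext x; simp [Set.indicator]
    have e2 : Set.Ici t ∩ Set.Ioc 0 1 = Set.Icc t 1 := by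
      ext x; simp only [Set.mem_inter_iff, Set.mem_Ici, Set.mem_Ioc, Set.mem_Icc]
      exact ⟨fun h => ⟨h.1, h.2.2⟩, fun h => ⟨h.1, ht.1.trans_le h.1, h.2⟩⟩
    rw [e, integral_indicator measurableSet_Ici, Measure.restrict_restrict measurableSet_Ici, e2,
      integral_mul_const, integral_Icc_eq_integral_Ioc, ← intervalIntegral.integral_of_le ht.2,
      intervalIntegral.integral_eq_sub_of_hasDerivAt (fun x _ => hφ x)
        (hφ'.intervalIntegrable _ _), mul_comm]
  rw [intervalIntegral.integral_of_le zero_le_one, intervalIntegral.integral_of_le zero_le_one,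
    intervalIntegral.integral_of_le zero_le_one, ← integral_mul_const, ← integral_sub]
  · rw [← setIntegral_congr_fun measurableSet_Ioc hl, hswap,
      setIntegral_congr_fun measurableSet_Ioc hrr]
    simp only [mul_sub]
  · exact hrμ.mul_const _
  · have := hr.mul_continuousOn hφc.continuousOn
    exact (intervalIntegrable_iff_integrableOn_Ioc_of_le zero_le_one).1 this

/-! ### From Hill's operator to Fourier coefficients -/

section forward

variable {q : L2Circle} {ε : ℂ} {f h : ℝ → ℂ}

/-- The function `q f - h`, which is the second derivative of `f` if `L f = h`. -/
def secondDeriv (q : L2Circle) (f h : ℝ → ℂ) (x : ℝ) : ℂ := potential q x * f x - h x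

theorem IsHillImage.continuous (hf : IsHillImage q ε f h) : Continuous f :=
  hf.differentiable.continuous

theorem memL2_potential_mul (hf : Continuous f) : MemL2 fun x => potential q x * f x := by
  -- `f` may be unbounded on the line, so its argument is first clamped to `[0,1]`.
  refine MemLp.ae_eq ?_ (((memL2_potential q).mul_bounded (g := fun x => f (min (max x 0) 1))
    (C := (isCompact_Icc.exists_bound_of_continuousOn (s := Set.Icc (0 : ℝ) 1)
      hf.continuousOn).choose) (by fun_prop) fun x => ?_))
  · refine (ae_restrict_iff' measurableSet_Ioc).2 (Filter.Eventually.of_forall fun x hx => ?_)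
    simp only
    rw [max_eq_left hx.1.le, min_eq_left hx.2]
  · exact (isCompact_Icc.exists_bound_of_continuousOn (s := Set.Icc (0 : ℝ) 1)
      hf.continuousOn).choose_spec _ ⟨le_min (le_max_right _ _) zero_le_one, min_le_right _ _⟩

theorem memL2_secondDeriv (hf : Continuous f) (hh : MemL2 h) : MemL2 (secondDeriv q f h) :=
  (memL2_potential_mul hf).sub hh

theorem IsHillImage.deriv_eq' (hf : IsHillImage q ε f h) (x : ℝ) :
    deriv f x = deriv f 0 + ∫ t in (0 : ℝ)..x, secondDeriv q f h t := hf.deriv_eq x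

theorem IsHillImage.memL2_image (hf : IsHillImage q ε f h) : MemL2 h := hf.image_memLp

/-- The modes of a function in the domain of Hill's operator. -/
theorem IsHillImage.modeCoeffs_eq {p : ℤ} (hf : IsHillImage q (expMode p 1) f h) (j : ℤ) :
    (freqSq p j : ℂ) * modeCoeffs f hf.continuous.memL2 p j +
      L2Z.conv (potCoeffs q) j (modeCoeffs f hf.continuous.memL2 p) =
        modeCoeffs h hf.memL2_image p j := by
  set k : ℤ := 2 * j + p with hk
  have hr : MemL2 (secondDeriv q f h) := memL2_secondDeriv hf.continuous hf.memL2_image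
  set c : ℂ := Real.pi * k * Complex.I with hc
  have hφ : ∀ x, HasDerivAt (expMode (-k)) (-c * expMode (-k) x) x := fun x => by
    have := hasDerivAt_expMode (-k) x
    rwa [show (Real.pi * ((-k : ℤ) : ℂ) * Complex.I : ℂ) = -c by rw [hc]; push_cast; ring] at this
  have hφ' : Continuous fun x => -c * expMode (-k) x :=
    continuous_const.mul (continuous_expMode _)
  have e1 : expMode (-k) 1 = (expMode p 1)⁻¹ := by rw [expMode_neg_one_one, hk, expMode_one]
  have hε : expMode p 1 ≠ 0 := expMode_ne_zero p 1
  have hf1 : f 1 = expMode p 1 * f 0 := by simpa using hf.quasiperiodic 0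
  have hd : ∀ x, HasDerivAt f (deriv f x) x := fun x => (hf.differentiable x).hasDerivAt
  -- The second boundary condition comes from differentiating the quasiperiodicity of `f` at `0`.
  have hf1' : deriv f 1 = expMode p 1 * deriv f 0 := by
    have h1 : HasDerivAt (fun x => f (x + 1)) (deriv f 1) 0 :=
      HasDerivAt.comp_add_const 0 1 (by simpa using hd 1)
    have h2 : HasDerivAt (fun x => f (x + 1)) (expMode p 1 * deriv f 0) 0 := by
      rw [funext hf.quasiperiodic]
      exact (hd 0).const_mul _
    exact h1.unique h2
  have hrI := hr.intervalIntegrable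
  have hprim : ContinuousOn (fun x => ∫ t in (0 : ℝ)..x, secondDeriv q f h t) (Set.uIcc 0 1) :=
    intervalIntegral.continuousOn_primitive_interval'
      hrI (by rw [Set.uIcc_of_le zero_le_one]; exact Set.left_mem_Icc.2 zero_le_one)
  have hderivI : IntervalIntegrable (deriv f) volume 0 1 := by
    refine ContinuousOn.intervalIntegrable ?_
    rw [funext hf.deriv_eq']
    exact continuousOn_const.add hprim
  -- Two integrations by parts multiply the coefficient by `c² = -π²k²`. The boundary terms cancel
  -- because `expMode (-k) 1` is the inverse of the multiplier.
  have ibp1 := intervalIntegral.integral_mul_deriv_eq_deriv_mul (a := 0) (b := 1)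
    (u := expMode (-k)) (v := f) (fun x _ => hφ x) (fun x _ => hd x)
    (hφ'.intervalIntegrable _ _) hderivI
  have ibp2 := integral_primitive_mul hrI hφ hφ'
  have i1 : ∫ x in (0 : ℝ)..1, expMode (-k) x * deriv f x = c * modeCoeff f k := by
    rw [ibp1, e1, hf1, expMode_apply_zero, modeCoeff, ← intervalIntegral.integral_const_mul,
      inv_mul_cancel_left₀ hε, one_mul, sub_self, zero_sub, ← intervalIntegral.integral_neg]
    congr 1; funext x; ring
  have i2 : ∫ x in (0 : ℝ)..1, (∫ t in (0 : ℝ)..x, secondDeriv q f h t) * (-c * expMode (-k) x) =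
      -c * (c * modeCoeff f k) - deriv f 0 * (expMode (-k) 1 - 1) := by
    have e3 : ∀ x, (∫ t in (0 : ℝ)..x, secondDeriv q f h t) * (-c * expMode (-k) x) =
        -c * (expMode (-k) x * deriv f x) - deriv f 0 * (-c * expMode (-k) x) := fun x => by
      rw [hf.deriv_eq' x]; ring
    simp only [e3]
    rw [intervalIntegral.integral_sub, intervalIntegral.integral_const_mul, i1,
      intervalIntegral.integral_const_mul,
      intervalIntegral.integral_eq_sub_of_hasDerivAt (fun x _ => hφ x)
        (hφ'.intervalIntegrable _ _), expMode_apply_zero]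
    · exact (hderivI.continuousOn_mul (continuous_expMode _).continuousOn).const_mul _
    · exact (hφ'.intervalIntegrable _ _).const_mul _
  have i3 : ∫ t in (0 : ℝ)..1, secondDeriv q f h t = deriv f 1 - deriv f 0 := by
    rw [hf.deriv_eq' 1]; ring
  have i4 : modeCoeff (secondDeriv q f h) k = c ^ 2 * modeCoeff f k := by
    have h5 : ∫ t in (0 : ℝ)..1, secondDeriv q f h t * expMode (-k) t =
      modeCoeff (secondDeriv q f h) k := rfl
    rw [i2, i3, h5, hf1', e1] at ibp2
    have h6 := mul_inv_cancel₀ hε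
    linear_combination ibp2 + deriv f 0 * h6
  have i5 : modeCoeff (secondDeriv q f h) k =
      modeCoeff (fun x => potential q x * f x) k - modeCoeff h k := by
    rw [modeCoeff, modeCoeff, modeCoeff, ← intervalIntegral.integral_sub]
    · congr 1; funext x; rw [secondDeriv]; ring
    · exact ((memL2_potential_mul hf.continuous).mul_expMode (-k)).intervalIntegrable
    · exact (hf.memL2_image.mul_expMode (-k)).intervalIntegrable
  rw [modeCoeff_potential_mul q hf.continuous.memL2 p j, i4] at i5
  have hc2 : c ^ 2 = -(freqSq p j : ℂ) := by
    rw [hc, freqSq, ← hk, mul_pow, Complex.I_sq]; push_cast; ring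
  rw [modeCoeffs_apply, modeCoeffs_apply, ← hk]
  rw [hc2] at i5
  linear_combination -i5

end forward

/-! ### From Fourier coefficients to Hill's operator -/

/-- The function with given coefficients at the modes `2j+p`. -/
def synth (p : ℤ) (u : ℤ → ℂ) (x : ℝ) : ℂ := ∑' j, u j * expMode (2 * j + p) x

section synth

variable {p : ℤ} {u : ℤ → ℂ}

theorem summable_synth (hu : Summable fun j => ‖u j‖) (x : ℝ) :
    Summable fun j => u j * expMode (2 * j + p) x := by
  refine Summable.of_norm (hu.congr fun j => ?_)
  rw [norm_mul, norm_expMode, mul_one]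

theorem continuous_synth (hu : Summable fun j => ‖u j‖) : Continuous (synth p u) := by
  refine continuous_tsum (fun j => continuous_const.mul (continuous_expMode _)) hu fun j x => ?_
  rw [norm_mul, norm_expMode, mul_one]

theorem synth_add_one (x : ℝ) : synth p u (x + 1) = expMode p 1 * synth p u x := by
  rw [synth, synth, ← tsum_mul_left]
  refine tsum_congr fun j => ?_
  rw [expMode_add_one, expMode_one]; ring

/-- A continuous quasiperiodic function is determined by its coefficients, if they are summable. -/
theorem eq_synth_of_modeCoeff {f : ℝ → ℂ} (hf : Continuous f)
    (hp : ∀ x, f (x + 1) = expMode p 1 * f x) (hu : Summable fun j => ‖u j‖)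
    (h : ∀ j, modeCoeff f (2 * j + p) = u j) : f = synth p u := by
  set g : ℝ → ℂ := fun x => f x * expMode (-p) x with hg
  have hgp : Function.Periodic g 1 := fun x => by
    simp only [hg]
    rw [hp, expMode_add_one, expMode_neg_one_one]
    have := expMode_ne_zero p 1
    field_simp
  have hgc : Continuous g := hf.mul (continuous_expMode _)
  let G : C(UnitAddCircle, ℂ) := ⟨hgp.lift, continuous_coinduced_dom.2 hgc⟩
  have hG : ∀ x : ℝ, G (x : UnitAddCircle) = g x := fun x => rfl
  have hGc : ∀ j, fourierCoeff G j = u j := fun j => by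
    rw [← h, fourierCoeff_eq_intervalIntegral _ _ 0, modeCoeff, zero_add, div_one, one_smul]
    refine intervalIntegral.integral_congr fun x _ => ?_
    change fourier (-j) (x : UnitAddCircle) • G (x : UnitAddCircle) = _
    rw [hG, fourier_eq_expMode, smul_eq_mul, hg]
    simp only
    rw [show -(2 * j + p) = 2 * -j + -p by ring, expMode_add]; ring
  have hs : Summable (fourierCoeff G) := by
    rw [funext hGc]; exact hu.of_norm
  funext x
  have h1 := (has_pointwise_sum_fourier_series_of_summable hs (x : UnitAddCircle)).tsum_eq
  rw [hG] at h1
  have h2 : f x = g x * expMode p x := by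
    rw [hg]; simp only
    rw [mul_assoc, expMode_neg_mul, mul_one]
  rw [h2, ← h1, synth, ← tsum_mul_right]
  refine tsum_congr fun j => ?_
  rw [hGc, fourier_eq_expMode, smul_eq_mul, expMode_add]; ring

/-- After division by `expMode p` the series converges uniformly, hence in `L²` of the circle, where
the Fourier basis identifies its coefficients. -/
theorem modeCoeff_synth (hu : Summable fun j => ‖u j‖) (j : ℤ) :
    modeCoeff (synth p u) (2 * j + p) = u j := by
  have hsq : Summable fun j => ‖u j‖ ^ 2 := by
    refine Summable.of_norm_bounded_eventually hu ?_
    filter_upwards [hu.tendsto_cofinite_zero.eventually_le_const one_pos] with j hj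
    rw [norm_pow, norm_norm]
    exact pow_le_of_le_one (norm_nonneg _) hj two_ne_zero
  have hs : Summable fun j => u j • (fourier j : C(UnitAddCircle, ℂ)) := by
    refine Summable.of_norm (hu.congr fun j => ?_)
    rw [norm_smul, fourier_norm, mul_one]
  set F : C(UnitAddCircle, ℂ) := ∑' j, u j • fourier j with hF
  have hFx : ∀ x : ℝ, F (x : UnitAddCircle) = ∑' j, u j * expMode (2 * j) x := fun x => by
    have := ((ContinuousMap.evalCLM ℂ (x : UnitAddCircle)).hasSum hs.hasSum).tsum_eq
    change _ = F (x : UnitAddCircle) at this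
    rw [← this]
    refine tsum_congr fun j => ?_
    change u j * fourier j (x : UnitAddCircle) = _
    rw [fourier_eq_expMode]
  have hL2 : HasSum (fun j => u j • (fourierLp 2 j : L2Circle))
      (ContinuousMap.toLp (E := ℂ) 2 haarAddCircle ℂ F) := by
    have := (ContinuousMap.toLp (E := ℂ) 2 haarAddCircle ℂ).hasSum hs.hasSum
    simpa only [Function.comp_def, map_smul] using this
  have hL2' := (fourierBasis (T := 1)).hasSum_repr_symm (L2Z.mk u hsq)
  rw [coe_fourierBasis] at hL2'
  have heq := hL2.unique hL2'
  have hc : fourierCoeff F j = u j := by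
    rw [← fourierCoeff_toLp, ← fourierBasis_repr, heq, LinearIsometryEquiv.apply_symm_apply]
    rfl
  rw [← hc, fourierCoeff_eq_intervalIntegral _ _ 0, modeCoeff, zero_add, div_one, one_smul]
  refine intervalIntegral.integral_congr fun x _ => ?_
  rw [fourier_eq_expMode, smul_eq_mul, hFx, synth, ← tsum_mul_left, ← tsum_mul_right]
  refine tsum_congr fun l => ?_
  rw [mul_assoc, ← expMode_add, mul_left_comm, ← expMode_add]
  congr 2; ring

end synth

section converse

variable {q : L2Circle} {p : ℤ} {u v : L2Z}

theorem continuous_quasiperiodic_eq_zero {ε : ℂ} (hε : ε ≠ 0) {G : ℝ → ℂ}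
    (hG : ∀ x, G (x + 1) = ε * G x) (h0 : ∀ x ∈ Set.Icc (0 : ℝ) 1, G x = 0) (x : ℝ) : G x = 0 := by
  have hstep : ∀ x, G (x + 1) = 0 ↔ G x = 0 := fun x => by
    rw [hG, mul_eq_zero, or_iff_right hε]
  have hint : ∀ (n : ℤ) (x : ℝ), G (x + n) = 0 ↔ G x = 0 := fun n => by
    induction n using Int.induction_on with
    | zero => simp
    | succ i ih => intro x; rw [← ih x]; push_cast; rw [← add_assoc, hstep]
    | pred i ih =>
      intro x
      rw [← ih x, ← hstep (x + _)]
      push_cast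
      ring_nf
  rw [← Int.fract_add_floor x, hint]
  exact h0 _ ⟨Int.fract_nonneg x, (Int.fract_lt_one x).le⟩

/-- Solutions of the equation for the coefficients give functions in the domain of Hill's
operator. -/
theorem isHillImage_synth (hu : Summable fun j => ‖u j‖) (hv : Summable fun j => ‖v j‖)
    (h : ∀ j, (freqSq p j : ℂ) * u j + L2Z.conv (potCoeffs q) j u = v j) :
    IsHillImage q (expMode p 1) (synth p u) (synth p v) := by
  set f := synth p u with hf
  set g := synth p v with hg
  have hfc : Continuous f := continuous_synth hu
  have hgc : Continuous g := continuous_synth hv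
  set r := secondDeriv q f g with hrdef
  have hr : MemL2 r := memL2_secondDeriv hfc hgc.memL2
  have hfu : modeCoeffs f hfc.memL2 p = u := L2Z.ext_iff'.2 fun j => modeCoeff_synth hu j
  have hrc : ∀ j, modeCoeff r (2 * j + p) = -(freqSq p j : ℂ) * u j := fun j => by
    have h1 : modeCoeff r (2 * j + p) =
        modeCoeff (fun x => potential q x * f x) (2 * j + p) - modeCoeff g (2 * j + p) := by
      rw [modeCoeff, modeCoeff, modeCoeff, ← intervalIntegral.integral_sub]
      · congr 1; funext x; rw [hrdef, secondDeriv]; ring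
      · exact ((memL2_potential_mul hfc).mul_expMode _).intervalIntegrable
      · exact (hgc.memL2.mul_expMode _).intervalIntegrable
    rw [h1, modeCoeff_potential_mul q hfc.memL2, hfu, modeCoeff_synth hv, ← h j]
    ring
  -- These numbers are, up to sign, the coefficients of the square integrable function `r`.
  have hsq : Summable fun j => ‖(freqSq p j : ℂ) * u j‖ ^ 2 := by
    refine (summable_modeCoeff_sq hr p).congr fun j => ?_
    rw [hrc, neg_mul, norm_neg]
  -- Off the zero mode, `π|k||u| = ((πk)²|u|) · 1/(π|k|)` is at most the sum of the squares of the
  -- two factors, both summable. This permits termwise differentiation.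
  have hd : Summable fun j : ℤ => ‖(Real.pi * ((2 * j + p : ℤ) : ℂ) * Complex.I) * u j‖ := by
    refine Summable.of_nonneg_of_le (fun _ => norm_nonneg _) (fun j => ?_)
      (hsq.add (hasSum_int_one_div_sq.summable.comp_injective (freq_injective p)))
    simp only [Function.comp_apply]
    set k : ℤ := 2 * j + p with hk
    rw [norm_mul, norm_mul, norm_mul, norm_mul, Complex.norm_I, mul_one, Complex.norm_real,
      Complex.norm_real, Complex.norm_intCast, freqSq, ← hk]
    rcases eq_or_ne k 0 with h0 | h0
    · rw [h0]; simp
    · have hk0 : (0 : ℝ) < |(k : ℝ)| := abs_pos.2 (Int.cast_ne_zero.2 h0)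
      have hpi : ‖Real.pi‖ = Real.pi := Real.norm_of_nonneg Real.pi_pos.le
      rw [hpi, Real.norm_of_nonneg (sq_nonneg _), ← sq_abs (k : ℝ), ← sq_abs (Real.pi * k),
        abs_mul, abs_of_pos Real.pi_pos]
      set t := |(k : ℝ)|
      have e : Real.pi * t * ‖u j‖ = ((Real.pi * t) ^ 2 * ‖u j‖) * (1 / (Real.pi * t)) := by
        have := Real.pi_pos
        field_simp
      have e2 : (1 / (Real.pi * t)) ^ 2 ≤ 1 / t ^ 2 := by
        rw [div_pow, one_pow, mul_pow]
        refine one_div_le_one_div_of_le (by positivity) ?_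
        have := nine_lt_pi_sq
        nlinarith [sq_nonneg t]
      rw [e]
      nlinarith [sq_nonneg ((Real.pi * t) ^ 2 * ‖u j‖ - 1 / (Real.pi * t)),
        sq_nonneg ((Real.pi * t) ^ 2 * ‖u j‖), sq_nonneg (1 / (Real.pi * t))]
  have hderiv : ∀ x, HasDerivAt f
      (∑' j, u j * (Real.pi * ((2 * j + p : ℤ) : ℂ) * Complex.I * expMode (2 * j + p) x)) x := by
    intro x
    refine hasDerivAt_tsum hd (fun j y => (hasDerivAt_expMode _ y).const_mul _) (fun j y => ?_)
      (summable_synth hu 0) x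
    rw [norm_mul, norm_mul, norm_expMode, mul_one, ← norm_mul, mul_comm]
  have hfq : ∀ x, f (x + 1) = expMode p 1 * f x := fun x => synth_add_one x
  have hgq : ∀ x, g (x + 1) = expMode p 1 * g x := fun x => synth_add_one x
  have hfd : Differentiable ℝ f := fun x => (hderiv x).differentiableAt
  have hrq : ∀ x, r (x + 1) = expMode p 1 * r x := fun x => by
    rw [hrdef, secondDeriv, secondDeriv, potential_periodic, hfq, hgq]; ring
  have hrI : ∀ a b, IntervalIntegrable r volume a b := by
    have hper : Function.Periodic (fun x => r x * expMode (-p) x) 1 := fun x => by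
      simp only
      rw [hrq, expMode_add_one, expMode_neg_one_one]
      have := expMode_ne_zero p 1
      field_simp
    have h1 := (hr.mul_expMode (-p)).intervalIntegrable
    intro a b
    have h2 := hper.intervalIntegrable₀ one_ne_zero h1 a b
    refine (h2.mul_continuousOn (continuous_expMode p).continuousOn).congr ?_
    intro x _
    simp only
    rw [mul_assoc, expMode_neg_mul, mul_one]
  -- `G` is the defect in the equation to be shown. It vanishes on `[0,1]` by Parseval's identity
  -- for `r` and the indicator of `(0,x]`, and then everywhere by quasiperiodicity.
  set G : ℝ → ℂ := fun x => deriv f x - deriv f 0 - ∫ t in (0 : ℝ)..x, r t with hGdef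
  have hG0 : ∀ x ∈ Set.Icc (0 : ℝ) 1, G x = 0 := by
    intro x hx
    have hind : MemL2 ((Set.Ioc 0 x).indicator fun _ => (1 : ℂ)) :=
      (memLp_const (1 : ℂ)).indicator measurableSet_Ioc
    have hpars := (hasSum_modeCoeff_mul hind hr p).tsum_eq
    have e1 : ∫ t in (0 : ℝ)..1, (Set.Ioc 0 x).indicator (fun _ => (1 : ℂ)) t * r t =
        ∫ t in (0 : ℝ)..x, r t := by
      rw [intervalIntegral.integral_of_le zero_le_one, intervalIntegral.integral_of_le hx.1]
      have : (fun t => (Set.Ioc 0 x).indicator (fun _ => (1 : ℂ)) t * r t) =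
          (Set.Ioc 0 x).indicator r := by
        funext t; simp [Set.indicator]
      rw [this, setIntegral_indicator measurableSet_Ioc, Set.Ioc_inter_Ioc, max_self,
        min_eq_right hx.2]
    have e2 : ∀ k : ℤ, modeCoeff ((Set.Ioc 0 x).indicator fun _ => (1 : ℂ)) (-k) =
        ∫ t in (0 : ℝ)..x, expMode k t := fun k => by
      rw [modeCoeff, intervalIntegral.integral_of_le zero_le_one,
        intervalIntegral.integral_of_le hx.1, neg_neg]
      have : (fun t => (Set.Ioc 0 x).indicator (fun _ => (1 : ℂ)) t * expMode k t) =
          (Set.Ioc 0 x).indicator (expMode k) := by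
        funext t; simp [Set.indicator]
      rw [this, setIntegral_indicator measurableSet_Ioc, Set.Ioc_inter_Ioc, max_self,
        min_eq_right hx.2]
    have e3 : ∀ k : ℤ, Real.pi * k * Complex.I * ∫ t in (0 : ℝ)..x, expMode k t =
        expMode k x - 1 := fun k => by
      rw [← intervalIntegral.integral_const_mul,
        intervalIntegral.integral_eq_sub_of_hasDerivAt (fun t _ => hasDerivAt_expMode k t)
        ((continuous_const.mul (continuous_expMode k)).intervalIntegrable _ _), expMode_apply_zero]
    have hs : ∀ y, Summable fun j : ℤ =>
        u j * (Real.pi * ((2 * j + p : ℤ) : ℂ) * Complex.I * expMode (2 * j + p) y) := fun y => by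
      refine Summable.of_norm (hd.congr fun j => ?_)
      rw [norm_mul (u j), norm_mul _ (expMode _ _), norm_expMode, mul_one, ← norm_mul, mul_comm]
    rw [e1] at hpars
    simp only [hGdef]
    rw [(hderiv x).deriv, (hderiv 0).deriv, ← hpars, ← (hs x).tsum_sub (hs 0), sub_eq_zero]
    refine tsum_congr fun j => ?_
    rw [e2, hrc, expMode_apply_zero]
    have hc2 : (Real.pi * ((2 * j + p : ℤ) : ℂ) * Complex.I) ^ 2 = -(freqSq p j : ℂ) := by
      rw [freqSq, mul_pow, Complex.I_sq]; push_cast; ring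
    rw [← hc2]
    linear_combination -(u j * (Real.pi * ((2 * j + p : ℤ) : ℂ) * Complex.I)) * e3 (2 * j + p)
  have hderivq : ∀ x, deriv f (x + 1) = expMode p 1 * deriv f x := fun x => by
    have h1 : HasDerivAt (fun x => f (x + 1)) (deriv f (x + 1)) x :=
      HasDerivAt.comp_add_const x 1 (hfd (x + 1)).hasDerivAt
    have h2 : HasDerivAt (fun x => f (x + 1)) (expMode p 1 * deriv f x) x := by
      rw [funext hfq]
      exact (hfd x).hasDerivAt.const_mul _
    exact h1.unique h2
  have hGq : ∀ x, G (x + 1) = expMode p 1 * G x := fun x => by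
    have h1 := hG0 1 ⟨zero_le_one, le_rfl⟩
    have h2 : deriv f 1 = expMode p 1 * deriv f 0 := by simpa using hderivq 0
    have h3 : ∫ t in (0 : ℝ)..(x + 1), r t =
        (∫ t in (0 : ℝ)..1, r t) + expMode p 1 * ∫ t in (0 : ℝ)..x, r t := by
      rw [← intervalIntegral.integral_add_adjacent_intervals (hrI 0 1) (hrI 1 (x + 1)),
        ← intervalIntegral.integral_const_mul]
      congr 1
      have := intervalIntegral.integral_comp_add_right (a := 0) (b := x) r 1
      rw [zero_add] at this
      rw [← this]
      congr 1
      funext t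
      exact hrq t
    simp only [hGdef] at h1 ⊢
    rw [hderivq, h3]
    rw [h2] at h1
    linear_combination h1
  refine ⟨hfq, hgq, hgc.memL2, hfd, fun x => ?_⟩
  have := continuous_quasiperiodic_eq_zero (expMode_ne_zero p 1) hGq hG0 x
  change deriv f x = deriv f 0 + ∫ t in (0 : ℝ)..x, r t
  simp only [hGdef] at this
  linear_combination this

end converse

/-! ### Algebraic multiplicities as multiplicities of roots -/

section rootSpaces

variable {q : L2Circle} {p : ℤ} {n : ℕ} {X : modes p n → L2Z}

/-- By invariance, `freqSq` times the sequence is a difference of an `ℓ²` sequence and a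
convolution, hence bounded. -/
theorem summable_norm_invMap {a : L2Z} (hX : ricc a X = X) (hn : 1 ≤ n) (b : modes p n → ℂ) :
    Summable fun j => ‖invMap X b j‖ := by
  refine summable_norm_of_freqSq_mul_le (p := p)
    (C := ‖invMap X ((invMat a X).mulVec b)‖ + ‖a‖ * ‖invMap X b‖) fun j => ?_
  have h := invMap_eq hX hn b j
  rw [show (freqSq p j : ℂ) * invMap X b j =
    invMap X ((invMat a X).mulVec b) j - L2Z.conv a j (invMap X b) by rw [← h]; ring]
  exact (norm_sub_le _ _).trans (add_le_add (L2Z.norm_apply_le _ _) (L2Z.norm_conv_le _ _ _))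

/-- The functions of the invariant subspace. -/
def invFun {a : L2Z} (hX : ricc a X = X) (hn : 1 ≤ n) : (modes p n → ℂ) →ₗ[ℂ] (ℝ → ℂ) where
  toFun b := synth p (invMap X b)
  map_add' b c := by
    funext x
    rw [Pi.add_apply, synth, synth, synth,
      ← (summable_synth (summable_norm_invMap hX hn b) x).tsum_add
        (summable_synth (summable_norm_invMap hX hn c) x)]
    refine tsum_congr fun j => ?_
    rw [map_add, L2Z.add_apply, add_mul]
  map_smul' t b := by
    funext x
    rw [Pi.smul_apply, synth, synth, smul_eq_mul, ← tsum_mul_left]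
    refine tsum_congr fun j => ?_
    rw [map_smul, L2Z.smul_apply, RingHom.id_apply, mul_assoc]

theorem invFun_apply {a : L2Z} (hX : ricc a X = X) (hn : 1 ≤ n) (b : modes p n → ℂ) :
    invFun hX hn b = synth p (invMap X b) := rfl

theorem invFun_injective {a : L2Z} (hX : ricc a X = X) (hn : 1 ≤ n) :
    Function.Injective (invFun hX hn) := fun b c h => by
  refine invMap_injective hX hn (L2Z.ext_iff'.2 fun j => ?_)
  rw [← modeCoeff_synth (p := p) (summable_norm_invMap hX hn b) j,
    ← modeCoeff_synth (p := p) (summable_norm_invMap hX hn c) j, ← invFun_apply hX hn,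
    ← invFun_apply hX hn, h]

theorem isHillImage_invFun (hX : ricc (potCoeffs q) X = X) (hn : 1 ≤ n) (b : modes p n → ℂ) :
    IsHillImage q (expMode p 1) (invFun hX hn b)
      (invFun hX hn ((invMat (potCoeffs q) X).mulVec b)) :=
  isHillImage_synth (summable_norm_invMap hX hn _) (summable_norm_invMap hX hn _)
    (invMap_eq hX hn b)

theorem exists_eq_invFun (hX : ricc (potCoeffs q) X = X) (hn : 1 ≤ n)
    (hL : IsLarge n ‖potCoeffs q‖) (hXn : ‖X‖ ≤ 2 * ‖potCoeffs q‖ / n) {mu : ℂ}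
    (hmu : mu.re ≤ cut n) {f : ℝ → ℂ} {g : modes p n → ℂ}
    (hf : IsHillImage q (expMode p 1) f fun x => mu * f x + invFun hX hn g x) :
    ∃ b, f = invFun hX hn b ∧ (invMat (potCoeffs q) X).mulVec b = mu • b + g := by
  have hgs := summable_norm_invMap hX hn g
  have hgc : Continuous (invFun hX hn g) := continuous_synth hgs
  have h := hf.modeCoeffs_eq
  have hc : ∀ j, modeCoeffs _ hf.memL2_image p j =
      mu * modeCoeffs f hf.continuous.memL2 p j + invMap X g j := fun j => by
    rw [modeCoeffs_apply, modeCoeffs_apply, ← modeCoeff_synth (p := p) hgs j, modeCoeff, modeCoeff,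
      modeCoeff, ← intervalIntegral.integral_const_mul, ← intervalIntegral.integral_add]
    · congr 1; funext x; rw [invFun_apply]; ring
    · exact ((hf.continuous.memL2.mul_expMode _).intervalIntegrable).const_mul _
    · exact (hgc.memL2.mul_expMode _).intervalIntegrable
  simp only [hc] at h
  obtain ⟨b, hb, hb'⟩ := exists_eq_invMap hX hn hL hXn hmu h
  refine ⟨b, ?_, hb'⟩
  rw [invFun_apply, ← hb]
  refine eq_synth_of_modeCoeff hf.continuous hf.quasiperiodic ?_ fun j => rfl
  rw [hb]
  exact summable_norm_invMap hX hn b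

/-- Root functions correspond to generalized eigenvectors of the matrix on the invariant
subspace. -/
theorem isRootFunction_iff (hX : ricc (potCoeffs q) X = X) (hn : 1 ≤ n)
    (hL : IsLarge n ‖potCoeffs q‖) (hXn : ‖X‖ ≤ 2 * ‖potCoeffs q‖ / n) {mu : ℂ}
    (hmu : mu.re ≤ cut n) (k : ℕ) (f : ℝ → ℂ) :
    IsRootFunction q (expMode p 1) mu k f ↔
      ∃ b ∈ LinearMap.ker ((Matrix.toLin' (invMat (potCoeffs q) X) - algebraMap ℂ _ mu) ^ k),
        f = invFun hX hn b := by
  set T : Module.End ℂ (modes p n → ℂ) := Matrix.toLin' (invMat (potCoeffs q) X)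
  have hT : ∀ b, (T - algebraMap ℂ _ mu) b = (invMat (potCoeffs q) X).mulVec b - mu • b :=
    fun b => rfl
  induction k generalizing f with
  | zero =>
    rw [IsRootFunction, pow_zero]
    constructor
    · rintro rfl
      exact ⟨0, by simp, (map_zero _).symm⟩
    · rintro ⟨b, hb, rfl⟩
      have : b = 0 := by simpa using hb
      rw [this, map_zero]
  | succ k ih =>
    rw [IsRootFunction]
    constructor
    · rintro ⟨g, hg, hf⟩
      -- Once `g` lies in the invariant subspace, `exists_eq_invFun` puts `f` there too, so chains
      -- of root functions never leave it.
      obtain ⟨c, hc, rfl⟩ := (ih g).1 hg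
      obtain ⟨b, rfl, hb⟩ := exists_eq_invFun hX hn hL hXn hmu hf
      refine ⟨b, ?_, rfl⟩
      rw [LinearMap.mem_ker, pow_succ, Module.End.mul_apply, hT, hb, add_sub_cancel_left]
      exact hc
    · rintro ⟨b, hb, rfl⟩
      refine ⟨invFun hX hn ((T - algebraMap ℂ _ mu) b), (ih _).2 ⟨_, ?_, rfl⟩, ?_⟩
      · rw [LinearMap.mem_ker, pow_succ, Module.End.mul_apply] at hb
        exact hb
      · have h := isHillImage_invFun hX hn b
        convert h using 1
        funext x
        rw [hT, map_sub, map_smul, Pi.sub_apply, Pi.smul_apply, smul_eq_mul]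
        ring

theorem rootSpace_eq_map (hX : ricc (potCoeffs q) X = X) (hn : 1 ≤ n)
    (hL : IsLarge n ‖potCoeffs q‖) (hXn : ‖X‖ ≤ 2 * ‖potCoeffs q‖ / n) {mu : ℂ}
    (hmu : mu.re ≤ cut n) :
    rootSpace q (expMode p 1) mu =
      (Module.End.maxGenEigenspace (Matrix.toLin' (invMat (potCoeffs q) X)) mu).map
        (invFun hX hn) := by
  rw [rootSpace, ← Submodule.span_eq (Submodule.map _ _)]
  congr 1
  ext f
  simp only [Set.mem_ofPred_eq, SetLike.mem_coe, Submodule.mem_map,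
    isRootFunction_iff hX hn hL hXn hmu, Module.End.mem_maxGenEigenspace]
  constructor
  · rintro ⟨k, b, hb, rfl⟩
    exact ⟨b, ⟨k, hb⟩, rfl⟩
  · rintro ⟨b, ⟨k, hb⟩, rfl⟩
    exact ⟨k, b, hb, rfl⟩

-- The root space is the injective image of a maximal generalized eigenspace of the matrix, whose
-- dimension is the multiplicity of the root.
open Classical in
theorem toENat_rank_rootSpace (hX : ricc (potCoeffs q) X = X) (hn : 1 ≤ n)
    (hL : IsLarge n ‖potCoeffs q‖) (hXn : ‖X‖ ≤ 2 * ‖potCoeffs q‖ / n) {mu : ℂ}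
    (hmu : mu.re ≤ cut n) :
    Cardinal.toENat (Module.rank ℂ (rootSpace q (expMode p 1) mu)) =
      ((invMat (potCoeffs q) X).charpoly.roots.count mu : ℕ) := by
  have e := (Submodule.equivMapOfInjective (invFun hX hn) (invFun_injective hX hn)
    (Module.End.maxGenEigenspace (Matrix.toLin' (invMat (potCoeffs q) X)) mu)).rank_eq
  rw [rootSpace_eq_map hX hn hL hXn hmu, ← e, ← Module.finrank_eq_rank,
    LinearMap.finrank_maxGenEigenspace_eq, Matrix.charpoly_toLin', Polynomial.count_roots]
  simp

end rootSpaces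

open Classical in
/-- The eigenvalues to the left of `cut m` for one of the two boundary conditions. -/
theorem exists_multiset_spectrum (q : L2Circle) (p : ℤ) {m : ℕ} (hm : 1 ≤ m)
    (ha : ‖potCoeffs q‖ ≤ m / 4) :
    ∃ S : Multiset ℂ, S.card = (modes p m).card ∧
      (∀ mu ∈ S, mu.re < cut m ∧ ∃ u, u ≠ 0 ∧ IsEigSeq (potCoeffs q) p mu u) ∧
      ∀ mu : ℂ, mu.re < cut m →
        Cardinal.toENat (Module.rank ℂ (rootSpace q (expMode p 1) mu)) = (S.count mu : ℕ) := by
  obtain ⟨n0, hn0⟩ := exists_nat_ge (36 * (‖potCoeffs q‖ + 1) ^ 2)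
  -- `n` is large enough for the Riccati contraction, which `m` need not be; only the counting line
  -- belongs to `m`.
  set n := max n0 m
  have hL : IsLarge n ‖potCoeffs q‖ :=
    ⟨norm_nonneg _, hn0.trans (by exact_mod_cast le_max_left _ _)⟩
  have hn := hL.one_le
  obtain ⟨hX, hXn⟩ := riccSol_spec hL p
  refine ⟨(invMat (potCoeffs q) (riccSol p n (potCoeffs q))).charpoly.roots.filter
    fun z => z.re < cut m, ?_, fun mu hmu => ?_, fun mu hmu => ?_⟩
  · convert card_roots_invMat hL p hm (le_max_right _ _) ha
  · rw [Multiset.mem_filter] at hmu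
    exact ⟨hmu.2, exists_isEigSeq_of_isRoot hX hn (Polynomial.isRoot_of_mem_roots hmu.1)⟩
  · rw [toENat_rank_rootSpace hX hn hL hXn (hmu.le.trans (cut_le_cut (le_max_right _ _))),
      Multiset.count_filter_of_pos (p := fun z : ℂ => z.re < cut m) hmu]

/-! ### Listing points in increasing order -/

section listing

variable {α : Type*} [LinearOrder α]

/-- `S m` lists, with multiplicities `r`, the points of the lower sets `D m` exhausting `α`. -/
structure IsExhaustion (r : α → ℕ∞) (D : ℕ → Set α) (c : ℕ → ℕ) (S : ℕ → Multiset α) : Prop where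
  isLowerSet : ∀ m, IsLowerSet (D m)
  mono : Monotone D
  exists_mem : ∀ x, ∃ m, x ∈ D m
  lt_card : ∀ m, m < c m
  card_eq : ∀ m, (S m).card = c m
  mem_of_mem : ∀ m, ∀ x ∈ S m, x ∈ D m
  count_eq : ∀ m, ∀ x ∈ D m, r x = (S m).count x

/-- `f` lists all points in increasing order, with multiplicities `r`. -/
structure IsListing (r : α → ℕ∞) (f : ℕ → α) : Prop where
  monotone : Monotone f
  encard_eq : ∀ x, {k | f k = x}.encard = r x

variable {r : α → ℕ∞} {D : ℕ → Set α} {c : ℕ → ℕ} {S : ℕ → Multiset α} {f : ℕ → α}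

/-- The indices with values in the lower set `D m` form an initial segment of `ℕ`, and adding up
multiplicities it has `c m` elements. -/
theorem IsListing.lt_iff_mem (h : IsExhaustion r D c S) (hf : IsListing r f) (m k : ℕ) :
    k < c m ↔ f k ∈ D m := by
  classical
  have hcover : {k | f k ∈ D m} = ⋃ x ∈ (S m).toFinset, {k | f k = x} := by
    ext k
    simp only [Set.mem_ofPred_eq, Set.mem_iUnion, exists_prop, exists_eq_right',
      Multiset.mem_toFinset]
    refine ⟨fun hk => ?_, h.mem_of_mem m _⟩
    have h1 := hf.encard_eq (f k)
    rw [h.count_eq m _ hk] at h1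
    refine Multiset.count_pos.1 (Nat.pos_of_ne_zero fun h0 => ?_)
    rw [h0, Nat.cast_zero, Set.encard_eq_zero] at h1
    exact (Set.eq_empty_iff_forall_notMem.1 h1) k rfl
  have hcard : {k | f k ∈ D m}.encard = c m := by
    rw [hcover, ← h.card_eq m, ← Multiset.toFinset_sum_count_eq, Nat.cast_sum]
    have hdisj : ((S m).toFinset : Set α).PairwiseDisjoint fun x => {k | f k = x} := by
      intro x _ y _ hxy
      rw [Function.onFun, Set.disjoint_left]
      rintro k rfl hk
      exact hxy hk
    have hsum : ∀ T : Finset α, (T : Set α).PairwiseDisjoint (fun x => {k | f k = x}) →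
        (⋃ x ∈ T, {k | f k = x}).encard = ∑ x ∈ T, {k | f k = x}.encard := by
      intro T
      induction T using Finset.induction_on with
      | empty => simp
      | insert a T ha ih =>
        intro hT
        rw [Finset.set_biUnion_insert, Set.encard_union_eq, Finset.sum_insert ha,
          ih (hT.subset (by simp))]
        rw [Set.disjoint_iUnion₂_right]
        exact fun y hy => hT (by simp) (by simp [hy]) (fun e => ha (e ▸ hy))
    rw [hsum _ hdisj]
    refine Finset.sum_congr rfl fun x hx => ?_
    rw [hf.encard_eq, h.count_eq m x (h.mem_of_mem m x (Multiset.mem_toFinset.1 hx))]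
  have hfin : {k | f k ∈ D m}.Finite := by
    rw [← Set.encard_ne_top_iff, hcard]
    exact ENat.natCast_ne_top _
  have hlow : ∀ j k, j ≤ k → f k ∈ D m → f j ∈ D m :=
    fun j k hjk hk => h.isLowerSet m (hf.monotone hjk) hk
  constructor
  · intro hk
    by_contra hk'
    have hsub : {k | f k ∈ D m} ⊆ (Finset.range k : Set ℕ) := fun j hj => by
      rw [Finset.coe_range, Set.mem_Iio]
      by_contra hj'
      exact hk' (hlow k j (not_lt.1 hj') hj)
    have := Set.encard_le_encard hsub
    rw [hcard, Set.encard_coe_eq_coe_finsetCard, Finset.card_range] at this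
    exact absurd (by exact_mod_cast this) (not_le.2 hk)
  · intro hk
    have hsub : (Finset.range (k + 1) : Set ℕ) ⊆ {k | f k ∈ D m} := fun j hj => by
      rw [Finset.coe_range, Set.mem_Iio] at hj
      exact hlow j k (Nat.lt_succ_iff.1 hj) hk
    have := Set.encard_le_encard hsub
    rw [hcard, Set.encard_coe_eq_coe_finsetCard, Finset.card_range] at this
    exact_mod_cast this

theorem encard_fiber_eq_count {m : ℕ} {x : α} (hx : ∀ k, f k = x → k < m) :
    {k | f k = x}.encard = ((Multiset.range m).map f).count x := by
  have : {k | f k = x} = ((Finset.range m).filter fun k => x = f k : Finset ℕ) := by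
    ext k
    simp only [Finset.coe_filter, Finset.mem_range, Set.mem_ofPred_eq]
    exact ⟨fun h => ⟨hx k h, h.symm⟩, fun h => h.2.symm⟩
  rw [this, Set.encard_coe_eq_coe_finsetCard, Multiset.count_map]
  rfl

theorem IsListing.map_range (h : IsExhaustion r D c S) (hf : IsListing r f) (m : ℕ) :
    (Multiset.range (c m)).map f = S m := by
  ext x
  by_cases hx : x ∈ D m
  · have h1 := hf.encard_eq x
    rw [h.count_eq m x hx, encard_fiber_eq_count (m := c m)] at h1
    · exact_mod_cast h1
    · rintro k rfl
      exact (hf.lt_iff_mem h m k).2 hx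
  · rw [Multiset.count_eq_zero_of_notMem fun hx' => hx (h.mem_of_mem m x hx'),
      Multiset.count_eq_zero_of_notMem]
    intro hx'
    obtain ⟨k, hk, rfl⟩ := Multiset.mem_map.1 hx'
    exact hx ((hf.lt_iff_mem h m k).1 (Multiset.mem_range.1 hk))

theorem map_range_eq_sort {n : ℕ} (hf : Monotone f) {T : Multiset α}
    (h : (Multiset.range n).map f = T) : (List.range n).map f = T.sort := by
  refine List.Perm.eq_of_pairwise (le := (· ≤ ·)) (fun a b _ _ => le_antisymm) ?_
    (Multiset.pairwise_sort _ _) ?_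
  · rw [List.pairwise_map]
    exact List.pairwise_lt_range.imp fun h => hf h.le
  · rw [← Multiset.coe_eq_coe, Multiset.sort_eq, ← h]
    rfl

/-- Both restrictions to the first `c k` indices are the sorted list of `S k`, and `k < c k`. -/
theorem IsListing.unique (h : IsExhaustion r D c S) {g : ℕ → α} (hf : IsListing r f)
    (hg : IsListing r g) : f = g := by
  funext k
  have hl := (map_range_eq_sort hf.monotone (hf.map_range h k)).trans
    (map_range_eq_sort hg.monotone (hg.map_range h k)).symm
  exact List.map_inj_left.1 hl k (List.mem_range.2 (h.lt_card k))

/-- `S m` is the part of `S n` in the lower set `D m`, so everything else in `S n` comes later. -/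
theorem IsExhaustion.sort_prefix (h : IsExhaustion r D c S) {m n : ℕ} (hmn : m ≤ n) :
    ∃ R : List α, (S n).sort = (S m).sort ++ R ∧ ∀ x ∈ R, x ∉ D m := by
  classical
  have hS : (S n).filter (· ∈ D m) = S m := by
    ext x
    by_cases hx : x ∈ D m
    · rw [Multiset.count_filter_of_pos hx]
      have := (h.count_eq n x (h.mono hmn hx)).symm.trans (h.count_eq m x hx)
      exact_mod_cast this
    · rw [Multiset.count_filter_of_neg hx,
        Multiset.count_eq_zero_of_notMem fun hx' => hx (h.mem_of_mem m x hx')]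
  refine ⟨((S n).filter fun x => ¬ x ∈ D m).sort, ?_, fun x hx => ?_⟩
  · refine List.Perm.eq_of_pairwise (le := (· ≤ ·)) (fun a b _ _ => le_antisymm)
      (Multiset.pairwise_sort _ _) ?_ ?_
    · rw [List.pairwise_append]
      refine ⟨Multiset.pairwise_sort _ _, Multiset.pairwise_sort _ _, fun a ha b hb => ?_⟩
      rw [Multiset.mem_sort] at ha hb
      by_contra hab
      exact (Multiset.mem_filter.1 hb).2
        (h.isLowerSet m (not_le.1 hab).le (h.mem_of_mem m a ha))
    · rw [← Multiset.coe_eq_coe, ← Multiset.coe_add, Multiset.sort_eq, Multiset.sort_eq,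
        Multiset.sort_eq]
      rw [← hS]
      exact (Multiset.filter_add_not _ _).symm
  · rw [Multiset.mem_sort] at hx
    exact (Multiset.mem_filter.1 hx).2

/-- The `k`-th value is the `k`-th entry of the sorted `S k`; since the sorted lists extend each
other, any longer list gives the same value. -/
theorem IsExhaustion.exists_isListing (h : IsExhaustion r D c S) : ∃ f, IsListing r f := by
  have hlen : ∀ m, ((S m).sort).length = c m := fun m => by rw [Multiset.length_sort, h.card_eq]
  have hlt : ∀ k, k < ((S k).sort).length := fun k => by rw [hlen]; exact h.lt_card k
  have hget : ∀ m k (hk : k < ((S m).sort).length), ((S k).sort)[k]'(hlt k) = ((S m).sort)[k] := by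
    intro m k hk
    rcases le_total k m with hkm | hkm
    · obtain ⟨R, hR, -⟩ := h.sort_prefix hkm
      simp only [hR, List.getElem_append_left (hlt k)]
    · obtain ⟨R, hR, -⟩ := h.sort_prefix hkm
      simp only [hR, List.getElem_append_left hk]
  refine ⟨fun k => ((S k).sort)[k]'(hlt k), fun j k hjk => ?_, fun x => ?_⟩
  · rw [hget k j (hjk.trans_lt (hlt k))]
    rcases hjk.eq_or_lt with rfl | hjk
    · exact le_rfl
    · exact List.pairwise_iff_getElem.1 (Multiset.pairwise_sort (S k) (· ≤ ·)) _ _ _ _ hjk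
  · obtain ⟨m, hm⟩ := h.exists_mem x
    rw [h.count_eq m x hm, encard_fiber_eq_count (m := c m)]
    · congr 2
      rw [← Multiset.sort_eq (S m) (· ≤ ·), ← Multiset.coe_range, Multiset.map_coe]
      congr 1
      refine List.ext_getElem (by simp [h.card_eq]) fun i hi hi' => ?_
      rw [List.getElem_map, List.getElem_range]
      exact hget m i hi'
    · rintro k rfl
      by_contra hk
      rw [not_lt] at hk
      obtain ⟨R, hR, hRD⟩ := h.sort_prefix ((h.lt_card m).le.trans hk)
      refine hRD _ ?_ hm
      simp only [hR]
      rw [List.getElem_append_right (by rw [hlen]; exact hk)]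
      exact List.getElem_mem _

end listing

/-! ### Fourier tails and tails of `∑ 1/n²` -/

section tail

theorem fourierCoeff_fourierTail (N : ℕ) (q : L2Circle) (n : ℤ) :
    fourierCoeff (fourierTail N q) n = if (N : ℤ) ≤ |n| then fourierCoeff q n else 0 := by
  have hs := (fourierBasis (T := 1)).hasSum_repr q
  simp only [fourierBasis_repr, coe_fourierBasis] at hs
  have hs' : HasSum (fun i : {n : ℤ // (N : ℤ) ≤ |n|} =>
      fourierCoeff q (i : ℤ) • (fourierLp 2 (i : ℤ) : L2Circle)) (fourierTail N q) :=
    (hs.summable.subtype _).hasSum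
  have h := (innerSL ℂ ((fourierBasis (T := 1)) n)).hasSum hs'
  have hval : ∀ i : ℤ, innerSL ℂ ((fourierBasis (T := 1)) n)
      (fourierCoeff q i • (fourierLp 2 i : L2Circle)) = if i = n then fourierCoeff q n else 0 := by
    intro i
    rw [map_smul, innerSL_apply_apply, ← congrFun (coe_fourierBasis (T := 1)) i,
      orthonormal_iff_ite.1 (fourierBasis (T := 1)).orthonormal, smul_eq_mul]
    by_cases hi : i = n
    · subst hi; simp
    · rw [if_neg hi, if_neg (Ne.symm hi), mul_zero]
  rw [innerSL_apply_apply, ← HilbertBasis.repr_apply_apply, fourierBasis_repr] at h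
  simp only [hval] at h
  refine h.unique ?_
  split_ifs with hn
  · have := hasSum_ite_eq (⟨n, hn⟩ : {n : ℤ // (N : ℤ) ≤ |n|}) (fourierCoeff q n)
    simpa only [Subtype.ext_iff] using this
  · convert hasSum_zero with i
    rw [if_neg]
    intro hi
    exact hn (hi ▸ i.2)

theorem summable_sq_fourierTail {w : ℤ → ℝ} {q : L2Circle} (hq : q ∈ weightedSobolev w) (N : ℕ) :
    Summable fun n : ℤ => w n ^ 2 * ‖fourierCoeff (fourierTail N q) n‖ ^ 2 := by
  refine Summable.of_nonneg_of_le (fun n => by positivity) (fun n => ?_) hq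
  rw [fourierCoeff_fourierTail]
  split_ifs
  · exact le_rfl
  · rw [norm_zero, zero_pow two_ne_zero, mul_zero]
    positivity

/-- The terms at `n` and `-n` of the tail, summed over `n ≥ N`. -/
theorem hasSum_tail {w : ℤ → ℝ} {q : L2Circle} (hq : q ∈ weightedSobolev w) {N : ℕ} (hN : 1 ≤ N) :
    HasSum (fun n : Set.Ici N => w ((n : ℕ) : ℤ) ^ 2 * ‖fourierCoeff q ((n : ℕ) : ℤ)‖ ^ 2 +
      w (-((n : ℕ) : ℤ)) ^ 2 * ‖fourierCoeff q (-((n : ℕ) : ℤ))‖ ^ 2)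
      (wNorm w (fourierTail N q) ^ 2) := by
  have hs := summable_sq_fourierTail hq N
  rw [wNorm, Real.sq_sqrt (tsum_nonneg fun n => by positivity)]
  have h := hs.hasSum.nat_add_neg
  -- Folding `n` and `-n` counts index `0` twice; its term vanishes because `N ≥ 1`.
  have h0 : fourierCoeff (fourierTail N q) 0 = 0 := by
    rw [fourierCoeff_fourierTail, if_neg]
    simp only [abs_zero, not_le]
    exact_mod_cast hN
  rw [h0, norm_zero, zero_pow two_ne_zero, mul_zero, add_zero] at h
  rw [← hasSum_subtype_iff_of_support_subset (s := Set.Ici N)] at h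
  · refine h.congr_fun ?_
    intro n
    have hn : (N : ℤ) ≤ ((n : ℕ) : ℤ) := by exact_mod_cast n.2
    simp only [Function.comp_apply, fourierCoeff_fourierTail, abs_neg, Nat.abs_cast, if_pos hn]
  · intro n hn
    by_contra hn'
    refine hn ?_
    have hn'' : ¬ (N : ℤ) ≤ (n : ℤ) := by
      intro h; exact hn' (by exact_mod_cast h)
    simp only [fourierCoeff_fourierTail, abs_neg, Nat.abs_cast, if_neg hn'', norm_zero,
      zero_pow two_ne_zero, mul_zero, add_zero]

theorem norm_potCoeffs_le_wNorm {w : ℤ → ℝ} (hw : IsSubmulWeight w) {q : L2Circle}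
    (hq : q ∈ weightedSobolev w) : ‖potCoeffs q‖ ≤ wNorm w q := by
  rw [wNorm]
  refine Real.le_sqrt_of_sq_le ?_
  rw [L2Z.norm_sq_eq]
  refine (L2Z.summable_sq _).tsum_le_tsum (fun n => ?_) hq
  rw [potCoeffs_apply]
  exact le_mul_of_one_le_left (by positivity) (one_le_pow₀ (hw.one_le n))

theorem sum_inv_sq_Ici_le {N : ℕ} (hN : 1 ≤ N) (u : Finset (Set.Ici N)) :
    ∑ n ∈ u, (((n : ℕ) : ℝ) ^ 2)⁻¹ ≤ 2 / N := by
  obtain ⟨M, hM⟩ := (u.map (Function.Embedding.subtype _)).exists_nat_subset_range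
  -- The open interval from `N - 1` starts at `N`, and the bound is `2/((N - 1) + 1)`.
  have h := sum_Ioo_inv_sq_le (α := ℝ) (N - 1) M
  rw [Nat.cast_sub hN, Nat.cast_one, sub_add_cancel] at h
  refine le_trans ?_ h
  rw [show ∑ n ∈ u, (((n : ℕ) : ℝ) ^ 2)⁻¹ =
    ∑ n ∈ u.map (Function.Embedding.subtype _), ((n : ℝ) ^ 2)⁻¹ by rw [Finset.sum_map]; rfl]
  refine Finset.sum_le_sum_of_subset_of_nonneg (fun n hn => ?_) fun n _ _ => by positivity
  have h1 := Finset.mem_range.1 (hM hn)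
  obtain ⟨m, -, rfl⟩ := Finset.mem_map.1 hn
  have h2 : N ≤ (m : ℕ) := m.2
  rw [Finset.mem_Ioo]
  refine ⟨?_, h1⟩
  change N - 1 < (m : ℕ)
  omega

theorem hasSum_inv_sq_Ici {N : ℕ} (hN : 1 ≤ N) :
    Summable (fun n : Set.Ici N => (((n : ℕ) : ℝ) ^ 2)⁻¹) ∧
      ∑' n : Set.Ici N, (((n : ℕ) : ℝ) ^ 2)⁻¹ ≤ 2 / N := by
  have h := summable_of_sum_le (fun n : Set.Ici N => by positivity) (sum_inv_sq_Ici_le hN)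
  exact ⟨h, h.tsum_le_of_sum_le (sum_inv_sq_Ici_le hN)⟩

end tail

/-! ### The ordered spectrum and the final estimate -/

section spectrum

theorem lexPair_injective : Function.Injective fun z : ℂ => toLex (z.re, z.im) := fun z z' h => by
  have := toLex.injective h
  exact Complex.ext (congrArg Prod.fst this) (congrArg Prod.snd this)

/-- The lexicographic order as a linear order. -/
@[reducible] def lexOrder : LinearOrder ℂ :=
  LinearOrder.lift' (fun z : ℂ => toLex (z.re, z.im)) lexPair_injective

theorem lexOrder_le_iff (z z' : ℂ) : lexOrder.le z z' ↔ LexLE z z' :=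
  Prod.Lex.le_iff

theorem isPeriodicSpectrum_iff (q : L2Circle) (lam : ℕ → ℂ) :
    IsPeriodicSpectrum q lam ↔ @IsListing ℂ lexOrder (algMultiplicity q) lam :=
  ⟨fun h => @IsListing.mk ℂ lexOrder _ _ (fun j k hjk => (lexOrder_le_iff _ _).2 (h.ordered j k hjk))
    h.multiplicity,
   fun h => ⟨fun j k hjk => (lexOrder_le_iff _ _).1
    (@IsListing.monotone ℂ lexOrder _ _ h j k hjk), @IsListing.encard_eq ℂ lexOrder _ _ h⟩⟩

theorem tendsto_cut : Filter.Tendsto cut Filter.atTop Filter.atTop := by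
  refine Filter.tendsto_atTop_mono (fun n => ?_) tendsto_natCast_atTop_atTop
  unfold cut
  nlinarith only [nine_lt_pi_sq, sq_nonneg ((n : ℝ) - 1), sq_nonneg ((n : ℝ) - 1 / 2)]

theorem expMode_one_one : expMode 1 1 = -1 := by
  rw [expMode, ← Complex.exp_pi_mul_I]
  congr 1
  push_cast
  ring

open Classical in
/-- The periodic and anti-periodic eigenvalues to the left of `cut m`. -/
theorem exists_multiset_periodic (q : L2Circle) {m : ℕ} (hm : 1 ≤ m)
    (ha : ‖potCoeffs q‖ ≤ m / 4) :
    ∃ S : Multiset ℂ, S.card = 2 * m - 1 ∧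
      (∀ mu ∈ S, mu.re < cut m ∧ ∃ p u, u ≠ 0 ∧ IsEigSeq (potCoeffs q) p mu u) ∧
      ∀ mu : ℂ, mu.re < cut m → algMultiplicity q mu = (S.count mu : ℕ) := by
  obtain ⟨S0, hc0, hS0, hm0⟩ := exists_multiset_spectrum q 0 hm ha
  obtain ⟨S1, hc1, hS1, hm1⟩ := exists_multiset_spectrum q 1 hm ha
  refine ⟨S0 + S1, ?_, fun mu hmu => ?_, fun mu hmu => ?_⟩
  · rw [Multiset.card_add, hc0, hc1, card_modes_add_card_modes hm]
  · rcases Multiset.mem_add.1 hmu with h | h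
    · exact ⟨(hS0 mu h).1, 0, (hS0 mu h).2⟩
    · exact ⟨(hS1 mu h).1, 1, (hS1 mu h).2⟩
  · rw [algMultiplicity, Multiset.count_add, Nat.cast_add, ← hm0 mu hmu, ← hm1 mu hmu,
      expMode_zero, expMode_one_one]

variable {q : L2Circle} {N : ℕ}

/-- Open left half planes are lower sets for the lexicographic order, and those bounded by `cut (N +
m)` exhaust the plane because `cut` tends to infinity. -/
theorem exists_isExhaustion (hN : 1 ≤ N) (ha : ‖potCoeffs q‖ ≤ N / 4) :
    ∃ S : ℕ → Multiset ℂ, @IsExhaustion ℂ lexOrder (algMultiplicity q)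
      (fun m => {z : ℂ | z.re < cut (N + m)}) (fun m => 2 * (N + m) - 1) S ∧
      ∀ m, ∀ mu ∈ S m, ∃ p u, u ≠ 0 ∧ IsEigSeq (potCoeffs q) p mu u := by
  have hle : ∀ m : ℕ, ‖potCoeffs q‖ ≤ ((N + m : ℕ) : ℝ) / 4 := fun m => ha.trans (by
    rw [Nat.cast_add]
    linarith [(Nat.cast_nonneg m : (0 : ℝ) ≤ m)])
  choose S hc hS hm using fun m =>
    exists_multiset_periodic q (hN.trans (Nat.le_add_right N m)) (hle m)
  refine ⟨S, ?_, fun m mu hmu => (hS m mu hmu).2⟩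
  let _ := lexOrder
  refine ⟨fun m z z' hzz hz => ?_, fun m m' h z hz => ?_, fun z => ?_, fun m => by omega, hc,
    fun m x hx => (hS m x hx).1, fun m x hx => ?_⟩
  · rcases (lexOrder_le_iff z' z).1 hzz with h | h
    · exact h.trans hz
    · exact h.1.trans_lt hz
  · exact lt_of_lt_of_le hz (cut_le_cut (Nat.add_le_add_left h N))
  · obtain ⟨m, hm⟩ := (tendsto_cut.eventually_gt_atTop z.re).exists
    exact ⟨m, hm.trans_le (cut_le_cut (Nat.le_add_left m N))⟩
  · rw [hm m x hx]
    congr!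

theorem existsUnique_isPeriodicSpectrum (hN : 1 ≤ N) (ha : ‖potCoeffs q‖ ≤ N / 4) :
    ∃! lam : ℕ → ℂ, IsPeriodicSpectrum q lam := by
  obtain ⟨S, hS, -⟩ := exists_isExhaustion hN ha
  let _ := lexOrder
  simp only [isPeriodicSpectrum_iff]
  obtain ⟨f, hf⟩ := hS.exists_isListing
  exact ⟨f, hf, fun g hg => hg.unique hS hf⟩

/-- The `n`-th pair of eigenvalues lies in the `n`-th tile. -/
theorem IsPeriodicSpectrum.inTile {lam : ℕ → ℂ} (h : IsPeriodicSpectrum q lam) (hN : 1 ≤ N)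
    (ha : ‖potCoeffs q‖ ≤ N / 4) {n k : ℕ} (hn : N ≤ n) (hk : 2 * n - 1 ≤ k) (hk' : k ≤ 2 * n) :
    InTile n (lam k) ∧ ∃ p u, u ≠ 0 ∧ IsEigSeq (potCoeffs q) p (lam k) u := by
  obtain ⟨S, hS, hE⟩ := exists_isExhaustion hN ha
  obtain ⟨m, rfl⟩ := Nat.exists_eq_add_of_le hn
  let _ := lexOrder
  rw [isPeriodicSpectrum_iff] at h
  -- Exactly the indices below `2n - 1` lie to the left of `cut n`, and those below `2n + 1` to the
  -- left of `cut (n + 1)`, which leaves `2n - 1` and `2n` for the strip.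
  have h1 := h.lt_iff_mem hS m k
  have h2 := (h.lt_iff_mem hS (m + 1) k).1 (by omega)
  refine ⟨⟨?_, le_of_lt h2⟩, hE (m + 1) _ ?_⟩
  · by_contra hlt
    have := h1.2 (not_le.1 hlt)
    omega
  · rw [← h.map_range hS (m + 1)]
    exact Multiset.mem_map_of_mem _ (Multiset.mem_range.2 (by omega))

end spectrum

theorem gapLength_le {w : ℤ → ℝ} (hw : IsSubmulWeight w) {q : L2Circle} (hq : q ∈ weightedSobolev w)
    {N : ℕ} (hN : 1 ≤ N) (hNq : 4 * wNorm w q ≤ (N : ℝ)) {lam : ℕ → ℂ}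
    (h : IsPeriodicSpectrum q lam) {n : ℕ} (hn : N ≤ n) :
    w n * ‖gapLength lam n‖ ≤ 6 * wNorm w q ∧
      w n ^ 2 * ‖gapLength lam n‖ ^ 2 ≤
        6 * (w n ^ 2 * ‖fourierCoeff q n‖ ^ 2 + w (-n) ^ 2 * ‖fourierCoeff q (-n)‖ ^ 2) +
          22 * wNorm w q ^ 4 / n ^ 2 := by
  have ha := norm_potCoeffs_le_wNorm hw hq
  have hn' : (N : ℝ) ≤ n := by exact_mod_cast hn
  obtain ⟨t1, p1, u1, hu1, e1⟩ := h.inTile hN (by linarith) hn (k := 2 * n) (by omega) le_rfl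
  obtain ⟨t2, p2, u2, hu2, e2⟩ := h.inTile hN (by linarith) hn (k := 2 * n - 1) le_rfl (by omega)
  have hβ : wNorm w q ≤ n / 4 := by linarith
  exact weighted_gap_le hw (a := potCoeffs q) (β := wNorm w q) hq rfl (hN.trans hn) hβ e1 e2 hu1 hu2 t1 t2

end

theorem theorem1 (w : ℤ → ℝ) (hw : IsSubmulWeight w) (q : L2Circle) (hq : q ∈ weightedSobolev w)
    (N : ℕ) (hN : 1 ≤ N) (hNq : 4 * wNorm w q ≤ (N : ℝ)) :
    (∃! lam : ℕ → ℂ, IsPeriodicSpectrum q lam) ∧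
    ∀ lam : ℕ → ℂ, IsPeriodicSpectrum q lam →
      (Summable (fun n : Set.Ici N => w ((n : ℕ) : ℤ) ^ 2 * ‖gapLength lam (n : ℕ)‖ ^ 2) ∧
        ∑' n : Set.Ici N, w ((n : ℕ) : ℤ) ^ 2 * ‖gapLength lam (n : ℕ)‖ ^ 2 ≤
          9 * wNorm w (fourierTail N q) ^ 2 + 576 / (N : ℝ) * wNorm w q ^ 4) ∧
      ∀ n : ℕ, N ≤ n → w (n : ℤ) * ‖gapLength lam n‖ ≤ 6 * wNorm w q := by
  have ha := norm_potCoeffs_le_wNorm hw hq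
  refine ⟨existsUnique_isPeriodicSpectrum hN (by linarith), fun lam h =>
    ⟨?_, fun n hn => (gapLength_le hw hq hN hNq h hn).1⟩⟩
  obtain ⟨hs, hs2⟩ := hasSum_inv_sq_Ici hN
  have ht := hasSum_tail hq hN
  have hb := (ht.mul_left 6).add (hs.hasSum.mul_left (22 * wNorm w q ^ 4))
  have hle : ∀ n : Set.Ici N, w ((n : ℕ) : ℤ) ^ 2 * ‖gapLength lam (n : ℕ)‖ ^ 2 ≤ _ :=
    fun n => (gapLength_le hw hq hN hNq h n.2).2
  simp only [div_eq_mul_inv (22 * wNorm w q ^ 4)] at hle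
  have hsum := Summable.of_nonneg_of_le (fun n => by positivity) hle hb.summable
  refine ⟨hsum, (hsum.tsum_le_tsum hle hb.summable).trans ?_⟩
  rw [hb.tsum_eq]
  have h4 : 0 ≤ wNorm w q ^ 4 := by positivity
  have hN0 : (0 : ℝ) ≤ wNorm w q ^ 4 / N := by positivity
  have h5 := mul_le_mul_of_nonneg_left hs2 h4
  rw [show wNorm w q ^ 4 * (2 / N) = 2 * (wNorm w q ^ 4 / N) by ring] at h5
  rw [show 576 / (N : ℝ) * wNorm w q ^ 4 = 576 * (wNorm w q ^ 4 / N) by ring]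
  -- The sum is bounded by `6‖T_N q‖_w² + (44/N)‖q‖_w⁴`, where `44 = 22 · 2`.
  linarith [sq_nonneg (wNorm w (fourierTail N q))]
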